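/- **Notation.** Let $S^\infty$ be the Banach space of compact operators on $\ell^2$ (operator norm) and $S^1$ the Banach space of trace class operators on $\ell^2$ (norm $\|b\|_1=\mathrm{tr}\,|b|$). For $h\in L^1(\mathbb R)$ put $\widehat h(u)=\int_{\mathbb R} h(t)e^{-itu}\,dt$. Let $H^1(\mathbb R)=\{h\in L^1(\mathbb R):\widehat h(u)=0 \text{ for all } u\le 0\}$ and let $H^1(\mathbb R;S^1)$ be the closure of $H^1(\mathbb R)\otimes S^1$ in the Bochner space $L^1(\mathbb R;S^1)$. Let $H^\infty(\mathbb R)$ be the space of all $f\in L^\infty(\mathbb R)$ whose (distributional) Fourier transform has support in $[0,\infty)$, and put $Z_0=\{z\in C_0(\mathbb R): z(-\,\cdot\,)\in H^\infty(\mathbb R)\}$. Let $Z_0\overset{\vee}{\otimes}S^\infty$ be the closure of $Z_0\otimes S^\infty$ in $C_0(\mathbb R;S^\infty)$, and write $\dot f$ for the class of $f\in C_0(\mathbb R;S^\infty)$ in the quotient $C_0(\mathbb R;S^\infty)/(Z_0\overset{\vee}{\otimes}S^\infty)$. Let $$P=\frac{C_0(\mathbb R;S^\infty)}{Z_0\overset{\vee}{\otimes}S^\infty}\;\widehat\otimes\;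 H^1(\mathbb R;S^1)$$ (completed projective tensor product). For $f\in C_0(\mathbb R;S^\infty)$ and $h\in H^1(\mathbb R;S^1)$ put $$(f*h)(s)=\int_{\mathbb R}\mathrm{tr}\bigl(f(t)h(s-t)\bigr)\,dt,\qquad \langle h,f\rangle=\int_{\mathbb R}\mathrm{tr}\bigl(f(-t)h(t)\bigr)\,dt .$$ Let $\mathcal A_{0,S^1}(\mathbb R)$ be the space of all functions $F:\mathbb R\to\mathbb C$ of the form $F=\sum_{k\ge1}f_k*h_k$ (pointwise) with $f_k\in C_0(\mathbb R;S^\infty)$, $h_k\in H^1(\mathbb R;S^1)$ and $\sum_k\|f_k\|_\infty\|h_k\|_1<\infty$, normed by the infimum of $\sum_k\|f_k\|_\infty\|h_k\|_1$ over all such representations. Let $\mathcal A_0(\mathbb R)$ be defined in the same way with $C_0(\mathbb R)$, $H^1(\mathbb R)$ and the product of $\mathbb C$ in place of $C_0(\mathbb R;S^\infty)$, $H^1(\mathbb R;S^1)$ and $\mathrm{tr}(ab)$. Let $\mathcal M(H^1(\mathbb R))$ be the space of bounded Fourier multipliers on $H^1(\mathbb R)$, that is, of all $T\in B(H^1(\mathbb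 R))$ for which there is $m\in L^\infty(0,\infty)$ with $\widehat{T(h)}=m\widehat h$ a.e. on $(0,\infty)$ for all $h\in H^1(\mathbb R)$, with the operator norm. Let $\mathcal M_{S^1}(H^1(\mathbb R))$ be the space of all $T\in\mathcal M(H^1(\mathbb R))$ such that $T\otimes I_{S^1}$ extends to a (necessarily unique) bounded operator $T\overline\otimes I_{S^1}$ on $H^1(\mathbb R;S^1)$, with the norm $\|T\overline\otimes I_{S^1}\|$. It is regarded as a subspace of $B(H^1(\mathbb R;S^1))$ via $T\mapsto T\overline\otimes I_{S^1}$. **Proposition.** 1. The formula $\langle W,\dot f\otimes h\rangle=\langle W(h),f\rangle$ defines an isometric linear embedding $\Theta$ of $B(H^1(\mathbb R;S^1))$ into $P^*$. There is a bounded linear map $\Lambda:P\to\mathcal A_{0,S^1}(\mathbb R)$ with $\Lambda(\dot f\otimes h)=f*h$ for all $f\in C_0(\mathbb R;S^\infty)$ and $h\in H^1(\mathbb R;S^1)$, and it is a quotient map: $\|\Lambda\|\le1$, and every $F$ with $\|F\|<1$ is $\Lambda(\Phi)$ for some $\Phi$ with $\|\Phi\|<1$. 2. The adjoint of $\Lambda$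 takes its values in the range of $\Theta$. Regarded, through $\Theta$, as a map $\Lambda^*:\mathcal A_{0,S^1}(\mathbb R)^*\to B(H^1(\mathbb R;S^1))$, it is a linear isometry, and its range is exactly $\mathcal M_{S^1}(H^1(\mathbb R))$. 3. Hence $\Lambda^*$ induces an isometric isomorphism $\mathcal A_{0,S^1}(\mathbb R)^*\simeq\mathcal M_{S^1}(H^1(\mathbb R))$. 4. Likewise there is an isometric isomorphism $J_0:\mathcal A_0(\mathbb R)^*\to\mathcal M(H^1(\mathbb R))$ such that $\varphi(f*h)=\int_{\mathbb R}f(-t)\,\bigl(J_0(\varphi)h\bigr)(t)\,dt$ for all $\varphi\in\mathcal A_0(\mathbb R)^*$, $f\in C_0(\mathbb R)$ and $h\in H^1(\mathbb R)$. -/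

import Mathlib

open MeasureTheory
open scoped ENNReal ZeroAtInfty ContDiff TensorProduct InnerProductSpace

set_option linter.unusedSectionVars false

namespace HardyMultipliers

noncomputable section

section TraceClass

variable {H : Type*} [NormedAddCommGroup H] [InnerProductSpace ℂ H] [CompleteSpace H]

/- Shortcuts for instances that Mathlib already provides; they only speed up the search. -/

instance instNonUnitalCFCOperators :
    NonUnitalContinuousFunctionalCalculus ℝ (H →L[ℂ] H) IsSelfAdjoint := inferInstance

instance instCFCOperators : ContinuousFunctionalCalculus ℝ (H →L[ℂ] H) IsSelfAdjoint := inferInstance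

instance instNonnegSpectrumOperators : NonnegSpectrumClass ℝ (H →L[ℂ] H) := inferInstance

instance instT2Operators : T2Space (H →L[ℂ] H) := inferInstance

instance instTopRingOperators : IsTopologicalRing (H →L[ℂ] H) := inferInstance

instance instAlgOperators : Algebra ℝ (H →L[ℂ] H) := inferInstance

/-- The trace norm `tr |b| = ∑ ⟨|b| e_i, e_i⟩`, where `|b| = (b* b)^{1/2}`. It is only meaningful for
trace class operators. -/
def traceNorm (e : HilbertBasis ℕ ℂ H) (b : H →L[ℂ] H) : ℝ :=
  ∑' i, (inner ℂ (e i) (CFC.abs b (e i))).re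

/-- `b` is trace class if the series `tr |b| = ∑ ⟨|b| e_i, e_i⟩` of nonnegative terms converges. -/
def IsTraceClass (e : HilbertBasis ℕ ℂ H) (b : H →L[ℂ] H) : Prop :=
  Summable fun i => (inner ℂ (e i) (CFC.abs b (e i))).re

/-- The trace `∑ ⟨b e_i, e_i⟩` (the Mathlib inner product is linear in the second variable). -/
def opTrace (e : HilbertBasis ℕ ℂ H) (b : H →L[ℂ] H) : ℂ :=
  ∑' i, inner ℂ (e i) (b (e i))

theorem abs_isPositive (b : H →L[ℂ] H) : (CFC.abs b).IsPositive :=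
  (ContinuousLinearMap.nonneg_iff_isPositive _).1 (CFC.abs_nonneg b)

theorem norm_abs_apply (b : H →L[ℂ] H) (x : H) : ‖CFC.abs b x‖ = ‖b x‖ := by
  have hsa : star (CFC.abs b) = CFC.abs b := (CFC.abs_nonneg b).isSelfAdjoint.star_eq
  have h1 : star (CFC.abs b) * CFC.abs b = star b * b := by rw [hsa, CFC.abs_mul_abs]
  have key (a : H →L[ℂ] H) : inner ℂ x ((star a * a) x) = ((‖a x‖ : ℂ)) ^ 2 := by
    rw [ContinuousLinearMap.star_eq_adjoint, mul_apply_eq_comp,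
      ContinuousLinearMap.adjoint_inner_right, inner_self_eq_norm_sq_to_K]; rfl
  have h2 := key (CFC.abs b)
  rw [h1, key b] at h2
  have h3 : ‖b x‖ ^ 2 = ‖CFC.abs b x‖ ^ 2 := by exact_mod_cast h2
  exact ((sq_eq_sq₀ (norm_nonneg _) (norm_nonneg _)).1 h3).symm

/-- Polar decomposition `b = u |b|`, `u* b = |b|` with a contraction `u`. -/
theorem exists_polar (b : H →L[ℂ] H) :
    ∃ u : H →L[ℂ] H, ‖u‖ ≤ 1 ∧ u * CFC.abs b = b ∧ star u * b = CFC.abs b := by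
  set K : Submodule ℂ H := (LinearMap.range ((CFC.abs b : H →L[ℂ] H) : H →ₗ[ℂ] H)).topologicalClosure with hK
  have hmem (x : H) : CFC.abs b x ∈ K :=
    Submodule.le_topologicalClosure _ ⟨x, rfl⟩
  have : CompleteSpace K :=
    (Submodule.isClosed_topologicalClosure _).completeSpace_coe
  let r : H →ₗ[ℂ] K := ((CFC.abs b : H →L[ℂ] H) : H →ₗ[ℂ] H).codRestrict K hmem
  have hr : DenseRange r := by
    rw [DenseRange, Subtype.dense_iff]
    intro x hx
    have h : (Subtype.val '' Set.range r) = (LinearMap.range ((CFC.abs b : H →L[ℂ] H) : H →ₗ[ℂ] H) : Set H) := by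
      ext y; constructor
      · rintro ⟨_, ⟨z, rfl⟩, rfl⟩; exact ⟨z, rfl⟩
      · rintro ⟨z, rfl⟩; exact ⟨r z, ⟨z, rfl⟩, rfl⟩
    have hx' : x ∈ closure (LinearMap.range ((CFC.abs b : H →L[ℂ] H) : H →ₗ[ℂ] H) : Set H) := hx
    rw [← h] at hx'
    exact hx'
  have hn (x : H) : ‖(b : H →ₗ[ℂ] H) x‖ ≤ 1 * ‖r x‖ := by
    rw [one_mul]; exact (norm_abs_apply b x).ge
  let v : K →L[ℂ] H := (b : H →ₗ[ℂ] H).extendOfNorm r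
  have hv (x : H) : v (r x) = b x := LinearMap.extendOfNorm_eq hr ⟨1, hn⟩ x
  have hvn : ‖v‖ ≤ 1 := LinearMap.opNorm_extendOfNorm_le hr zero_le_one hn
  refine ⟨v ∘L K.orthogonalProjectionOnto, ?_, ?_, ?_⟩
  · refine (ContinuousLinearMap.opNorm_comp_le _ _).trans ?_
    exact mul_le_one₀ hvn (norm_nonneg _) (Submodule.orthogonalProjectionOnto_norm_le K)
  · ext x
    rw [mul_apply_eq_comp, ContinuousLinearMap.comp_apply]
    have : K.orthogonalProjectionOnto (CFC.abs b x) = r x :=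
      Submodule.orthogonalProjectionOnto_mem_subspace_eq_self (r x)
    rw [this, hv]
  · ext x
    refine ext_inner_left ℂ fun y => ?_
    rw [ContinuousLinearMap.star_eq_adjoint, mul_apply_eq_comp,
      ContinuousLinearMap.adjoint_inner_right, ContinuousLinearMap.comp_apply]
    have h1 : inner ℂ y (CFC.abs b x) =
        inner ℂ (K.orthogonalProjectionOnto y : H) (CFC.abs b x) :=
      (Submodule.inner_orthogonalProjectionOnto_eq_of_mem_right ⟨_, hmem x⟩ y).symm
    rw [h1]
    generalize K.orthogonalProjectionOnto y = w
    refine hr.induction_on w ?_ ?_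
    · exact isClosed_eq (by fun_prop) (by fun_prop)
    · intro z
      rw [hv]
      change _ = inner ℂ (CFC.abs b z) (CFC.abs b x)
      have hsa : star (CFC.abs b) = CFC.abs b := (CFC.abs_nonneg b).isSelfAdjoint.star_eq
      rw [← ContinuousLinearMap.adjoint_inner_right, ← ContinuousLinearMap.adjoint_inner_right,
        ← ContinuousLinearMap.star_eq_adjoint, ← ContinuousLinearMap.star_eq_adjoint,
        ← mul_apply_eq_comp, ← mul_apply_eq_comp, hsa, CFC.abs_mul_abs]

/-- Squared Hilbert-Schmidt norm, an auxiliary quantity for the triangle inequality. -/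
def hsSq (e : HilbertBasis ℕ ℂ H) (a : H →L[ℂ] H) : ℝ≥0∞ := ∑' i, ENNReal.ofReal (‖a (e i)‖ ^ 2)

theorem parseval (e : HilbertBasis ℕ ℂ H) (x : H) :
    ENNReal.ofReal (‖x‖ ^ 2) = ∑' j, ENNReal.ofReal (‖(inner ℂ (e j) x : ℂ)‖ ^ 2) := by
  have h := e.hasSum_inner_mul_inner x x
  have h2 : HasSum (fun j => ‖(inner ℂ (e j) x : ℂ)‖ ^ 2) (‖x‖ ^ 2) := by
    have h3 := Complex.hasSum_re h
    convert h3 using 1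
    · ext j
      rw [← inner_conj_symm x (e j), ← Complex.normSq_eq_conj_mul_self, Complex.normSq_eq_norm_sq]
      exact (Complex.ofReal_re _).symm
    · exact (inner_self_eq_norm_sq (𝕜 := ℂ) x).symm
  rw [← h2.tsum_eq, ENNReal.ofReal_tsum_of_nonneg (fun _ => by positivity) h2.summable]

theorem hsSq_star (e : HilbertBasis ℕ ℂ H) (a : H →L[ℂ] H) : hsSq e (star a) = hsSq e a := by
  unfold hsSq
  simp_rw [parseval e]
  rw [ENNReal.tsum_comm]
  refine tsum_congr fun i => tsum_congr fun j => ?_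
  rw [ContinuousLinearMap.star_eq_adjoint, ContinuousLinearMap.adjoint_inner_right,
    norm_inner_symm]

theorem hsSq_mul_le (e : HilbertBasis ℕ ℂ H) (c a : H →L[ℂ] H) (hc : ‖c‖ ≤ 1) :
    hsSq e (c * a) ≤ hsSq e a := by
  refine ENNReal.tsum_le_tsum fun i => ENNReal.ofReal_le_ofReal ?_
  have : ‖(c * a) (e i)‖ ≤ ‖a (e i)‖ := by
    rw [mul_apply_eq_comp]
    exact (c.le_of_opNorm_le hc _).trans (one_mul _).le
  gcongr

theorem abs_diag_nonneg (e : HilbertBasis ℕ ℂ H) (b : H →L[ℂ] H) (i : ℕ) :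
    0 ≤ (inner ℂ (e i) (CFC.abs b (e i))).re := (abs_isPositive b).re_inner_nonneg_right (e i)

theorem hsSq_sqrt (e : HilbertBasis ℕ ℂ H) (b : H →L[ℂ] H) :
    hsSq e (CFC.sqrt (CFC.abs b)) =
      ∑' i, ENNReal.ofReal (inner ℂ (e i) (CFC.abs b (e i))).re := by
  refine tsum_congr fun i => ?_
  congr 1
  have hsa : star (CFC.sqrt (CFC.abs b)) = CFC.sqrt (CFC.abs b) :=
    (CFC.sqrt_nonneg (CFC.abs b)).isSelfAdjoint
  conv_rhs => rw [← CFC.sqrt_mul_sqrt_self (CFC.abs b) (CFC.abs_nonneg b)]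
  rw [mul_apply_eq_comp]
  rw [← ContinuousLinearMap.adjoint_inner_left, ← ContinuousLinearMap.star_eq_adjoint, hsa]
  exact (inner_self_eq_norm_sq (𝕜 := ℂ) _).symm

/-- The trace norm controls the diagonal of `c b` for every contraction `c`. -/
theorem tsum_diag_le (e : HilbertBasis ℕ ℂ H) (c b : H →L[ℂ] H) (hc : ‖c‖ ≤ 1) :
    ∑' i, ENNReal.ofReal ‖(inner ℂ (e i) ((c * b) (e i)) : ℂ)‖ ≤
      ∑' i, ENNReal.ofReal (inner ℂ (e i) (CFC.abs b (e i))).re := by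
  obtain ⟨u, hu, hub, -⟩ := exists_polar b
  set r := CFC.sqrt (CFC.abs b) with hr
  have hsa : star r = r := (CFC.sqrt_nonneg (CFC.abs b)).isSelfAdjoint
  have hrr : r * r = CFC.abs b := CFC.sqrt_mul_sqrt_self _ (CFC.abs_nonneg b)
  set d := c * u with hd
  have hdn : ‖d‖ ≤ 1 := (norm_mul_le _ _).trans (mul_le_one₀ hc (norm_nonneg _) hu)
  have hcb : c * b = d * r * r := by rw [mul_assoc, hrr, hd, mul_assoc, hub]
  have hT : ∑' i, ENNReal.ofReal (inner ℂ (e i) (CFC.abs b (e i))).re = hsSq e r :=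
    (hsSq_sqrt e b).symm
  rw [hT]
  have h1 : hsSq e (star (d * r)) ≤ hsSq e r := by
    rw [hsSq_star]; exact hsSq_mul_le e d r hdn
  have h2 : ∑' i, ENNReal.ofReal ‖(inner ℂ (e i) ((c * b) (e i)) : ℂ)‖ ≤
      ∑' i, (2⁻¹ * ENNReal.ofReal (‖star (d * r) (e i)‖ ^ 2)
        + 2⁻¹ * ENNReal.ofReal (‖r (e i)‖ ^ 2)) := by
    refine ENNReal.tsum_le_tsum fun i => ?_
    rw [hcb, mul_apply_eq_comp, ← ContinuousLinearMap.adjoint_inner_left,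
      ← ContinuousLinearMap.star_eq_adjoint]
    have h2' : (2⁻¹ : ℝ≥0∞) = ENNReal.ofReal 2⁻¹ := by
      rw [ENNReal.ofReal_inv_of_pos two_pos]; simp
    rw [h2', ← ENNReal.ofReal_mul (by norm_num), ← ENNReal.ofReal_mul (by norm_num),
      ← ENNReal.ofReal_add (by positivity) (by positivity)]
    refine ENNReal.ofReal_le_ofReal ((norm_inner_le_norm _ _).trans ?_)
    nlinarith [sq_nonneg (‖star (d * r) (e i)‖ - ‖r (e i)‖)]
  refine h2.trans ?_
  rw [ENNReal.tsum_add, ENNReal.tsum_mul_left, ENNReal.tsum_mul_left]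
  change 2⁻¹ * hsSq e _ + 2⁻¹ * hsSq e r ≤ _
  calc 2⁻¹ * hsSq e (star (d * r)) + 2⁻¹ * hsSq e r ≤ 2⁻¹ * hsSq e r + 2⁻¹ * hsSq e r := by gcongr
    _ = hsSq e r := by rw [← add_mul, ENNReal.inv_two_add_inv_two, one_mul]

theorem IsTraceClass.diag {e : HilbertBasis ℕ ℂ H} {b : H →L[ℂ] H} (hb : IsTraceClass e b)
    (c : H →L[ℂ] H) (hc : ‖c‖ ≤ 1) :
    Summable (fun i => ‖(inner ℂ (e i) ((c * b) (e i)) : ℂ)‖) ∧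
      ∑' i, ‖(inner ℂ (e i) ((c * b) (e i)) : ℂ)‖ ≤ traceNorm e b := by
  have h := tsum_diag_le e c b hc
  rw [← ENNReal.ofReal_tsum_of_nonneg (abs_diag_nonneg e b) hb] at h
  have hs : Summable (fun i => ‖(inner ℂ (e i) ((c * b) (e i)) : ℂ)‖) := by
    have h' := ENNReal.summable_toReal (ne_top_of_le_ne_top ENNReal.ofReal_ne_top h)
    simpa [ENNReal.toReal_ofReal] using h'
  refine ⟨hs, ?_⟩
  rw [← ENNReal.ofReal_tsum_of_nonneg (fun _ => norm_nonneg _) hs] at h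
  exact (ENNReal.ofReal_le_ofReal_iff (tsum_nonneg (abs_diag_nonneg e b))).1 h

theorem IsTraceClass.add {e : HilbertBasis ℕ ℂ H} {a b : H →L[ℂ] H} (ha : IsTraceClass e a)
    (hb : IsTraceClass e b) :
    IsTraceClass e (a + b) ∧ traceNorm e (a + b) ≤ traceNorm e a + traceNorm e b := by
  obtain ⟨u, hu, -, hub⟩ := exists_polar (a + b)
  have hc : ‖star u‖ ≤ 1 := by rwa [norm_star]
  obtain ⟨sa, la⟩ := ha.diag _ hc
  obtain ⟨sb, lb⟩ := hb.diag _ hc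
  have hle (i : ℕ) : (inner ℂ (e i) (CFC.abs (a + b) (e i))).re ≤
      ‖(inner ℂ (e i) ((star u * a) (e i)) : ℂ)‖ + ‖(inner ℂ (e i) ((star u * b) (e i)) : ℂ)‖ := by
    rw [← hub, mul_add, add_apply, inner_add_right]
    exact (Complex.re_le_norm _).trans (norm_add_le _ _)
  have hs : IsTraceClass e (a + b) :=
    Summable.of_nonneg_of_le (abs_diag_nonneg e _) hle (sa.add sb)
  refine ⟨hs, ?_⟩
  calc traceNorm e (a + b) ≤ _ := hs.tsum_le_tsum hle (sa.add sb)
    _ = _ := sa.tsum_add sb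
    _ ≤ _ := add_le_add la lb

theorem abs_smul_diag (e : HilbertBasis ℕ ℂ H) (c : ℂ) (b : H →L[ℂ] H) (i : ℕ) :
    (inner ℂ (e i) (CFC.abs (c • b) (e i))).re = ‖c‖ * (inner ℂ (e i) (CFC.abs b (e i))).re := by
  rw [CFC.abs_smul, smul_apply, inner_smul_right_eq_smul, Complex.smul_re,
    smul_eq_mul]

/-- The trace class operators form a linear subspace of the bounded operators. -/
def traceClass (e : HilbertBasis ℕ ℂ H) : Submodule ℂ (H →L[ℂ] H) where
  carrier := {b | IsTraceClass e b}
  zero_mem' := by simp [IsTraceClass, CFC.abs_zero, summable_zero]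
  add_mem' ha hb := (ha.add hb).1
  smul_mem' c b hb := by
    change Summable _
    simp_rw [abs_smul_diag]
    exact Summable.mul_left _ hb

theorem eq_zero_of_traceNorm {e : HilbertBasis ℕ ℂ H} {b : H →L[ℂ] H} (hb : IsTraceClass e b)
    (h : traceNorm e b = 0) : b = 0 := by
  have h0 : hsSq e (CFC.sqrt (CFC.abs b)) = 0 := by
    rw [hsSq_sqrt, ← ENNReal.ofReal_tsum_of_nonneg (abs_diag_nonneg e b) hb]
    change ENNReal.ofReal (traceNorm e b) = 0
    rw [h, ENNReal.ofReal_zero]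
  have h1 (i : ℕ) : CFC.sqrt (CFC.abs b) (e i) = 0 := by
    have := ENNReal.tsum_eq_zero.1 h0 i
    rw [ENNReal.ofReal_eq_zero] at this
    exact norm_eq_zero.1 (pow_eq_zero_iff two_ne_zero |>.1 (le_antisymm this (by positivity)))
  have h2 : CFC.sqrt (CFC.abs b) = 0 := by
    refine ContinuousLinearMap.ext_on (s := Set.range e) ?_ ?_
    · exact Submodule.dense_iff_topologicalClosure_eq_top.2 e.dense_span
    · rintro _ ⟨i, rfl⟩; simpa using h1 i
  have h3 : CFC.abs b = 0 := by
    rw [← CFC.sqrt_mul_sqrt_self (CFC.abs b) (CFC.abs_nonneg b), h2, mul_zero]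
  ext x
  have := norm_abs_apply b x
  rw [h3] at this
  simpa using this.symm


theorem tsum_diag_bound {e : HilbertBasis ℕ ℂ H} {b : H →L[ℂ] H} (hb : IsTraceClass e b)
    (a : H →L[ℂ] H) :
    Summable (fun i => (inner ℂ (e i) ((a * b) (e i)) : ℂ)) ∧
      ‖opTrace e (a * b)‖ ≤ ‖a‖ * traceNorm e b := by
  rcases eq_or_ne a 0 with rfl | ha
  · simp [opTrace, summable_zero]
  have hn : ‖a‖ ≠ 0 := norm_ne_zero_iff.2 ha
  obtain ⟨hs, hl⟩ := hb.diag ((‖a‖⁻¹ : ℂ) • a) (by simp [norm_smul, hn])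
  have hk (i : ℕ) : ‖(inner ℂ (e i) ((a * b) (e i)) : ℂ)‖ =
      ‖a‖ * ‖(inner ℂ (e i) ((((‖a‖⁻¹ : ℂ) • a) * b) (e i)) : ℂ)‖ := by
    rw [smul_mul_assoc, smul_apply, inner_smul_right, norm_mul, norm_inv, Complex.norm_real,
      norm_norm, mul_inv_cancel_left₀ hn]
  have hs' : Summable fun i => ‖(inner ℂ (e i) ((a * b) (e i)) : ℂ)‖ := by
    simp_rw [hk]; exact hs.mul_left _
  refine ⟨hs'.of_norm, (norm_tsum_le_tsum_norm hs').trans ?_⟩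
  simp_rw [hk]
  rw [tsum_mul_left]
  gcongr

/-- The Banach space of trace class operators. It is a type of its own because it carries the trace
norm and not the operator norm. -/
def TraceClassOp (e : HilbertBasis ℕ ℂ H) : Type _ := ↥(traceClass e)

namespace TraceClassOp

variable (e : HilbertBasis ℕ ℂ H)

instance : AddCommGroup (TraceClassOp e) := inferInstanceAs (AddCommGroup ↥(traceClass e))

instance : Module ℂ (TraceClassOp e) := inferInstanceAs (Module ℂ ↥(traceClass e))

/-- The underlying bounded operator of a trace class operator. -/
def toCLM : TraceClassOp e →ₗ[ℂ] (H →L[ℂ] H) := (traceClass e).subtype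

instance : Norm (TraceClassOp e) := ⟨fun b => traceNorm e (toCLM e b)⟩

theorem isTraceClass_toCLM (b : TraceClassOp e) : IsTraceClass e (toCLM e b) := b.2

theorem core : NormedSpace.Core ℂ (TraceClassOp e) where
  norm_nonneg b := tsum_nonneg (abs_diag_nonneg e _)
  norm_smul c b := by
    change traceNorm e (toCLM e (c • b)) = ‖c‖ * traceNorm e (toCLM e b)
    rw [map_smul, traceNorm, traceNorm, ← tsum_mul_left]
    exact tsum_congr fun i => abs_smul_diag e c _ i
  norm_triangle a b := by
    change traceNorm e (toCLM e (a + b)) ≤ _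
    rw [map_add]
    exact (IsTraceClass.add a.2 b.2).2
  norm_eq_zero_iff b := by
    constructor
    · intro h
      exact Subtype.ext (eq_zero_of_traceNorm b.2 h)
    · rintro rfl
      change traceNorm e (toCLM e 0) = 0
      simp [traceNorm, CFC.abs_zero]

instance : NormedAddCommGroup (TraceClassOp e) := NormedAddCommGroup.ofCore (core e)

instance : NormedSpace ℂ (TraceClassOp e) := NormedSpace.ofCore (core e)

/-- Rank one projections are trace class, so there are nonzero trace class operators. -/
instance : Nontrivial (TraceClassOp e) := by
  let p : H →L[ℂ] H := InnerProductSpace.rankOne ℂ (e 0) (e 0)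
  have hp : CFC.abs p = p := CFC.abs_of_nonneg p <|
    (ContinuousLinearMap.nonneg_iff_isPositive _).2 (InnerProductSpace.isPositive_rankOne_self _)
  have hd (i : ℕ) : (inner ℂ (e i) (p (e i)) : ℂ) = if i = 0 then 1 else 0 := by
    have := (orthonormal_iff_ite.1 e.orthonormal)
    simp only [p, InnerProductSpace.rankOne_apply, inner_smul_right, this]
    split_ifs <;> simp_all
  have ht : IsTraceClass e p := by
    unfold IsTraceClass
    simp_rw [hp, hd]
    exact summable_of_ne_finset_zero (s := {0}) fun i hi => by
      rw [if_neg (by simpa using hi), Complex.zero_re]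
  refine ⟨⟨⟨p, ht⟩, 0, fun h => ?_⟩⟩
  have h' : p = 0 := congrArg Subtype.val h
  have := hd 0
  rw [h'] at this
  simp at this

end TraceClassOp

/-- The Banach space of compact operators on `H`, with the operator norm. -/
abbrev CompactOp (H : Type*) [NormedAddCommGroup H] [InnerProductSpace ℂ H] : Type _ :=
  ↥(compactOperator (RingHom.id ℂ) H H)

/-- The duality pairing `(a, b) ↦ tr (a b)` between compact and trace class operators. -/
def trPairing (e : HilbertBasis ℕ ℂ H) : CompactOp H →L[ℂ] TraceClassOp e →L[ℂ] ℂ :=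
  LinearMap.mkContinuous₂
    (LinearMap.mk₂ ℂ
      (fun (a : CompactOp H) (b : TraceClassOp e) =>
        opTrace e ((a : H →L[ℂ] H) * TraceClassOp.toCLM e b))
      (fun a a' b => by
        unfold opTrace
        rw [← (tsum_diag_bound (TraceClassOp.isTraceClass_toCLM e b) a).1.tsum_add (tsum_diag_bound (TraceClassOp.isTraceClass_toCLM e b) a').1]
        refine tsum_congr fun i => ?_
        rw [Submodule.coe_add, add_mul, add_apply, inner_add_right])
      (fun c a b => by
        unfold opTrace
        rw [Submodule.coe_smul, smul_mul_assoc, smul_eq_mul, ← tsum_mul_left]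
        exact tsum_congr fun i => by rw [smul_apply, inner_smul_right])
      (fun a b b' => by
        unfold opTrace
        rw [← (tsum_diag_bound (TraceClassOp.isTraceClass_toCLM e b) a).1.tsum_add (tsum_diag_bound (TraceClassOp.isTraceClass_toCLM e b') a).1]
        refine tsum_congr fun i => ?_
        rw [map_add, mul_add, add_apply, inner_add_right])
      (fun c a b => by
        unfold opTrace
        rw [map_smul, mul_smul_comm, smul_eq_mul, ← tsum_mul_left]
        exact tsum_congr fun i => by rw [smul_apply, inner_smul_right]))
    1
    (fun a b => by
      rw [one_mul]
      exact (tsum_diag_bound (TraceClassOp.isTraceClass_toCLM e b) a).2)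

end TraceClass

/-- The Hilbert space `ℓ²`. -/
abbrev Ell2 : Type := lp (fun _ : ℕ => ℂ) 2

/-- The standard Hilbert basis of `ℓ²`. -/
def stdBasis : HilbertBasis ℕ ℂ Ell2 := HilbertBasis.ofRepr (LinearIsometryEquiv.refl ℂ Ell2)

/-- `S^∞`, the compact operators on `ℓ²` with the operator norm. -/
abbrev SInf : Type := CompactOp Ell2

/-- `S^1`, the trace class operators on `ℓ²` with the trace norm. -/
abbrev SOne : Type := TraceClassOp stdBasis

/-- The duality pairing `(a, b) ↦ tr (a b)` between `S^∞` and `S^1`. -/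
def trDual : SInf →L[ℂ] SOne →L[ℂ] ℂ := trPairing stdBasis

theorem stdBasis_apply (i : ℕ) : stdBasis i = (lp.single 2 i (1 : ℂ) : Ell2) := by
  rw [← stdBasis.repr_symm_single]; rfl

section Hardy

/-- The Fourier transform `u ↦ ∫ h(t) e^{-itu} dt` of `h ∈ L^1(ℝ)`. -/
def fourierL1 (h : Lp ℂ 1 (volume : Measure ℝ)) (u : ℝ) : ℂ :=
  ∫ t, h t * Complex.exp (-(Complex.I * t * u))

theorem integrable_fourierL1 (h : Lp ℂ 1 (volume : Measure ℝ)) (u : ℝ) :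
    Integrable fun t : ℝ => h t * Complex.exp (-(Complex.I * t * u)) := by
  refine (L1.integrable_coeFn h).mul_bdd (c := 1) (by fun_prop) (ae_of_all _ fun t => ?_)
  rw [Complex.norm_exp]
  simp

theorem fourierL1_add (h g : Lp ℂ 1 (volume : Measure ℝ)) (u : ℝ) :
    fourierL1 (h + g) u = fourierL1 h u + fourierL1 g u := by
  unfold fourierL1
  rw [← integral_add (integrable_fourierL1 h u) (integrable_fourierL1 g u)]
  refine integral_congr_ae ?_
  filter_upwards [Lp.coeFn_add h g] with t ht
  rw [ht, Pi.add_apply, add_mul]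

theorem fourierL1_smul (c : ℂ) (h : Lp ℂ 1 (volume : Measure ℝ)) (u : ℝ) :
    fourierL1 (c • h) u = c * fourierL1 h u := by
  unfold fourierL1
  rw [← integral_const_mul]
  refine integral_congr_ae ?_
  filter_upwards [Lp.coeFn_smul c h] with t ht
  rw [ht, Pi.smul_apply, smul_eq_mul, mul_assoc]

theorem fourierL1_zero (u : ℝ) : fourierL1 0 u = 0 := by
  simpa using fourierL1_smul 0 0 u

/-- The Hardy space `H^1(ℝ)`: all `h ∈ L^1(ℝ)` whose Fourier transform vanishes on `(-∞, 0]`. -/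
def hardyOne : Submodule ℂ (Lp ℂ 1 (volume : Measure ℝ)) where
  carrier := {h | ∀ u : ℝ, u ≤ 0 → fourierL1 h u = 0}
  zero_mem' u _ := fourierL1_zero u
  add_mem' {h g} hh hg u hu := by rw [fourierL1_add, hh u hu, hg u hu, add_zero]
  smul_mem' c h hh u hu := by rw [fourierL1_smul, hh u hu, mul_zero]

variable {Z : Type*} [NormedAddCommGroup Z] [NormedSpace ℂ Z]

/-- The function `h ⊗ z : t ↦ h(t) z` in `L^1(ℝ; Z)`. -/
def tensorL1 (h : Lp ℂ 1 (volume : Measure ℝ)) (z : Z) : Lp Z 1 (volume : Measure ℝ) :=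
  (ContinuousLinearMap.toSpanSingleton ℂ z).compLp h

variable (Z) in
/-- `H^1(ℝ; Z)`: the closure of `H^1(ℝ) ⊗ Z` in the Bochner space `L^1(ℝ; Z)`. -/
def hardyOneVec : Submodule ℂ (Lp Z 1 (volume : Measure ℝ)) :=
  (Submodule.span ℂ {g | ∃ h ∈ hardyOne, ∃ z : Z, g = tensorL1 h z}).topologicalClosure

/-- The elementary tensor `h ⊗ z` as an element of `H^1(ℝ; Z)`. -/
def hardyTensor (h : hardyOne) (z : Z) : hardyOneVec Z :=
  ⟨tensorL1 h.1 z, Submodule.le_topologicalClosure _ (Submodule.subset_span ⟨h.1, h.2, z, rfl⟩)⟩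

theorem hardyTensor_add (h g : hardyOne) (z : Z) :
    hardyTensor (h + g) z = hardyTensor h z + hardyTensor g z :=
  Subtype.ext (map_add (ContinuousLinearMap.compLpₗ 1 volume
    (ContinuousLinearMap.toSpanSingleton ℂ z)) h.1 g.1)

theorem hardyTensor_smul (c : ℂ) (h : hardyOne) (z : Z) :
    hardyTensor (c • h) z = c • hardyTensor h z :=
  Subtype.ext (map_smul (ContinuousLinearMap.compLpₗ 1 volume
    (ContinuousLinearMap.toSpanSingleton ℂ z)) c h.1)

theorem eq_zero_of_hardyTensor {h : hardyOne} {z : Z} (hz : z ≠ 0) (hh : hardyTensor h z = 0) :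
    h = 0 := by
  have h1 : tensorL1 h.1 z = 0 := congrArg Subtype.val hh
  have h2 := (ContinuousLinearMap.toSpanSingleton ℂ z).coeFn_compLp h.1
  refine Subtype.ext (Lp.ext ?_)
  have h3 : (ContinuousLinearMap.toSpanSingleton ℂ z).compLp h.1 = 0 := h1
  rw [h3] at h2
  filter_upwards [h2, Lp.coeFn_zero Z 1 (volume : Measure ℝ),
    Lp.coeFn_zero ℂ 1 (volume : Measure ℝ)] with t ht h0 h0'
  rw [h0] at ht
  change h.1 t = (0 : Lp ℂ 1 (volume : Measure ℝ)) t
  rw [h0']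
  have : h.1 t • z = 0 := ht.symm
  exact (smul_eq_zero.1 this).resolve_right hz

theorem hardyOneVec_ext {W W' : hardyOneVec Z →L[ℂ] hardyOneVec Z}
    (hW : ∀ h z, W (hardyTensor h z) = W' (hardyTensor h z)) : W = W' := by
  set P : Submodule ℂ (Lp Z 1 (volume : Measure ℝ)) :=
    (LinearMap.eqLocus (W : hardyOneVec Z →ₗ[ℂ] hardyOneVec Z)
      (W' : hardyOneVec Z →ₗ[ℂ] hardyOneVec Z)).map (hardyOneVec Z).subtype with hP
  have hc : IsClosed {g : hardyOneVec Z | W g = W' g} := isClosed_eq W.continuous W'.continuous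
  have hPc : IsClosed (P : Set (Lp Z 1 (volume : Measure ℝ))) :=
    (Submodule.isClosed_topologicalClosure _).isClosedEmbedding_subtypeVal.isClosedMap _ hc
  have hle : hardyOneVec Z ≤ P := by
    refine Submodule.topologicalClosure_minimal _ (Submodule.span_le.2 ?_) hPc
    rintro _ ⟨h, hh, z, rfl⟩
    exact ⟨hardyTensor ⟨h, hh⟩ z, hW ⟨h, hh⟩ z, rfl⟩
  ext1 g
  obtain ⟨g', hg', hgg⟩ := hle g.2
  have : g' = g := Subtype.ext hgg
  rw [← this]
  exact hg'

/-- `M(H^1(ℝ))`: the bounded Fourier multipliers on `H^1(ℝ)`, that is, the bounded operators `T` for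
which there is a symbol `m ∈ L^∞(0, ∞)` such that the Fourier transform of `T h` is `m` times that of
`h`, for all `h`. As a subspace of `B(H^1(ℝ))` it carries the operator norm. -/
def fourierMultipliers : Submodule ℂ (hardyOne →L[ℂ] hardyOne) where
  carrier := {T | ∃ m : Lp ℂ ∞ (volume.restrict (Set.Ioi (0 : ℝ))), ∀ h : hardyOne,
    ∀ᵐ u ∂volume.restrict (Set.Ioi (0 : ℝ)), fourierL1 (T h) u = m u * fourierL1 h u}
  zero_mem' := by
    refine ⟨0, fun h => ?_⟩
    filter_upwards [Lp.coeFn_zero ℂ ∞ (volume.restrict (Set.Ioi (0 : ℝ)))] with u hu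
    rw [hu, Pi.zero_apply, zero_mul]
    exact fourierL1_zero u
  add_mem' := by
    rintro T S ⟨m, hm⟩ ⟨n, hn⟩
    refine ⟨m + n, fun h => ?_⟩
    filter_upwards [Lp.coeFn_add m n, hm h, hn h] with u hu h1 h2
    rw [hu, Pi.add_apply, add_mul, ← h1, ← h2, ← fourierL1_add]
    rfl
  smul_mem' := by
    rintro c T ⟨m, hm⟩
    refine ⟨c • m, fun h => ?_⟩
    filter_upwards [Lp.coeFn_smul c m, hm h] with u hu h1
    rw [hu, Pi.smul_apply, smul_eq_mul, mul_assoc, ← h1, ← fourierL1_smul]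
    rfl

variable (Z) in
/-- The `Z`-bounded Fourier multipliers: the `T ∈ M(H^1(ℝ))` such that `T ⊗ I_Z`, defined on
`H^1(ℝ) ⊗ Z`, extends to a bounded operator on `H^1(ℝ; Z)`. -/
def boundedMultipliers : Submodule ℂ (hardyOne →L[ℂ] hardyOne) where
  carrier := {T | T ∈ fourierMultipliers ∧ ∃ W : hardyOneVec Z →L[ℂ] hardyOneVec Z,
    ∀ h z, W (hardyTensor h z) = hardyTensor (T h) z}
  zero_mem' := ⟨zero_mem _, 0, fun h z => by
    rw [zero_apply, zero_apply]; simpa using (hardyTensor_smul 0 0 z).symm⟩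
  add_mem' := by
    rintro T S ⟨hT, W, hW⟩ ⟨hS, V, hV⟩
    exact ⟨add_mem hT hS, W + V, fun h z => by
      rw [add_apply, add_apply, hW, hV, hardyTensor_add]⟩
  smul_mem' := by
    rintro c T ⟨hT, W, hW⟩
    exact ⟨Submodule.smul_mem _ c hT, c • W, fun h z => by
      rw [smul_apply, smul_apply, hW, hardyTensor_smul]⟩

variable (Z) in
/-- The space `M_Z(H^1(ℝ))` of `Z`-bounded Fourier multipliers. It is a type of its own because its
norm is the norm of the extension of `T ⊗ I_Z` to `H^1(ℝ; Z)`, not the norm of `T`. -/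
def MultSpace : Type _ := ↥(boundedMultipliers Z)

namespace MultSpace

instance : AddCommGroup (MultSpace Z) := inferInstanceAs (AddCommGroup ↥(boundedMultipliers Z))

instance : Module ℂ (MultSpace Z) := inferInstanceAs (Module ℂ ↥(boundedMultipliers Z))

variable (Z) in
/-- The underlying operator on `H^1(ℝ)`. -/
def toCLM : MultSpace Z →ₗ[ℂ] (hardyOne →L[ℂ] hardyOne) := (boundedMultipliers Z).subtype

variable (Z) in
/-- The map taking `T` to the unique bounded extension of `T ⊗ I_Z` to `H^1(ℝ; Z)`. -/
def tensorExt : MultSpace Z →ₗ[ℂ] (hardyOneVec Z →L[ℂ] hardyOneVec Z) where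
  toFun T := T.2.2.choose
  map_add' T S := hardyOneVec_ext fun h z => by
    rw [add_apply, (T + S).2.2.choose_spec, T.2.2.choose_spec, S.2.2.choose_spec,
      ← hardyTensor_add]
    rfl
  map_smul' c T := hardyOneVec_ext fun h z => by
    rw [RingHom.id_apply, smul_apply, (c • T).2.2.choose_spec, T.2.2.choose_spec,
      ← hardyTensor_smul]
    rfl

theorem tensorExt_hardyTensor (T : MultSpace Z) (h : hardyOne) (z : Z) :
    tensorExt Z T (hardyTensor h z) = hardyTensor (toCLM Z T h) z :=
  T.2.2.choose_spec h z

theorem tensorExt_injective [Nontrivial Z] : Function.Injective (tensorExt Z) := by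
  rw [← LinearMap.ker_eq_bot, LinearMap.ker_eq_bot']
  intro T hT
  obtain ⟨z, hz⟩ := exists_ne (0 : Z)
  refine Subtype.ext (ContinuousLinearMap.ext fun h => ?_)
  refine eq_zero_of_hardyTensor hz ?_
  change hardyTensor (toCLM Z T h) z = 0
  rw [← tensorExt_hardyTensor, hT, zero_apply]

instance [Nontrivial Z] : NormedAddCommGroup (MultSpace Z) :=
  NormedAddCommGroup.induced _ _ (tensorExt Z) tensorExt_injective

instance [Nontrivial Z] : NormedSpace ℂ (MultSpace Z) := NormedSpace.induced ℂ _ _ (tensorExt Z)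

theorem norm_def [Nontrivial Z] (T : MultSpace Z) : ‖T‖ = ‖tensorExt Z T‖ := rfl

end MultSpace

end Hardy

section Tensor

/-- Quotient maps between Banach spaces: contractions that map the open unit ball onto the open unit
ball. -/
def IsBanachQuotientMap {Y Z : Type*} [SeminormedAddCommGroup Y] [NormedSpace ℂ Y]
    [SeminormedAddCommGroup Z] [NormedSpace ℂ Z] (T : Y →L[ℂ] Z) : Prop :=
  ‖T‖ ≤ 1 ∧ ∀ z : Z, ‖z‖ < 1 → ∃ y : Y, T y = z ∧ ‖y‖ < 1

variable (X Y : Type*) [SeminormedAddCommGroup X] [NormedSpace ℂ X]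
  [SeminormedAddCommGroup Y] [NormedSpace ℂ Y]

/-- The algebraic tensor product `X ⊗ Y`, to be equipped with the projective (semi)norm. -/
def PreProj : Type _ := X ⊗[ℂ] Y

namespace PreProj

instance : AddCommGroup (PreProj X Y) := inferInstanceAs (AddCommGroup (X ⊗[ℂ] Y))

instance : Module ℂ (PreProj X Y) := inferInstanceAs (Module ℂ (X ⊗[ℂ] Y))

variable {X Y}

/-- The elementary tensor `x ⊗ y`. -/
def mk (x : X) (y : Y) : PreProj X Y := x ⊗ₜ[ℂ] y

/-- All sums `∑ ‖x_k‖ ‖y_k‖` over the finite representations `u = ∑ x_k ⊗ y_k`. -/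
def costs (u : PreProj X Y) : Set ℝ :=
  {r | ∃ l : List (X × Y), (l.map fun p => mk p.1 p.2).sum = u ∧
    r = (l.map fun p => ‖p.1‖ * ‖p.2‖).sum}

/-- The projective norm. -/
instance : Norm (PreProj X Y) := ⟨fun u => sInf (costs u)⟩

theorem costs_nonneg {u : PreProj X Y} {r : ℝ} (hr : r ∈ costs u) : 0 ≤ r := by
  obtain ⟨l, -, rfl⟩ := hr
  refine List.sum_nonneg fun x hx => ?_
  obtain ⟨p, -, rfl⟩ := List.mem_map.1 hx
  positivity

theorem costs_bddBelow (u : PreProj X Y) : BddBelow (costs u) := ⟨0, fun _ => costs_nonneg⟩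

theorem costs_add {u v : PreProj X Y} {r s : ℝ} (hr : r ∈ costs u) (hs : s ∈ costs v) :
    r + s ∈ costs (u + v) := by
  obtain ⟨l, rfl, rfl⟩ := hr
  obtain ⟨k, rfl, rfl⟩ := hs
  exact ⟨l ++ k, by simp, by simp⟩

theorem costs_smul (c : ℂ) {u : PreProj X Y} {r : ℝ} (hr : r ∈ costs u) :
    ‖c‖ * r ∈ costs (c • u) := by
  obtain ⟨l, rfl, rfl⟩ := hr
  refine ⟨l.map fun p => (c • p.1, p.2), ?_, ?_⟩
  · induction l with
    | nil => simp
    | cons p l ih =>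
      simp only [List.map_cons, List.sum_cons, smul_add] at ih ⊢
      rw [ih]
      rfl
  · induction l with
    | nil => simp
    | cons p l ih =>
      simp only [List.map_cons, List.sum_cons, mul_add] at ih ⊢
      rw [ih, norm_smul, mul_assoc]

theorem costs_nonempty (u : PreProj X Y) : (costs u).Nonempty := by
  induction u using TensorProduct.induction_on with
  | zero => exact ⟨0, [], rfl, by simp⟩
  | tmul x y => exact ⟨‖x‖ * ‖y‖, [(x, y)], by simp only [List.map_cons, List.map_nil, List.sum_singleton]; rfl, by simp⟩
  | add u v hu hv => exact ⟨_, costs_add hu.some_mem hv.some_mem⟩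

end PreProj

end Tensor

/-- An infimum over a family of sets of costs that is compatible with sums and multiples is a
seminorm. -/
theorem seminormCore_of_costs {E : Type*} [AddCommGroup E] [Module ℂ E] [Norm E]
    (C : E → Set ℝ) (hC : ∀ u : E, ‖u‖ = sInf (C u)) (h0 : (0 : ℝ) ∈ C 0)
    (hne : ∀ u, (C u).Nonempty) (hnn : ∀ u, ∀ r ∈ C u, 0 ≤ r)
    (hadd : ∀ u v, ∀ r ∈ C u, ∀ s ∈ C v, r + s ∈ C (u + v))
    (hsmul : ∀ (c : ℂ) (u), ∀ r ∈ C u, ‖c‖ * r ∈ C (c • u)) : SeminormedSpace.Core ℂ E := by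
  have hb (u : E) : BddBelow (C u) := ⟨0, hnn u⟩
  have hn (u : E) : 0 ≤ ‖u‖ := by rw [hC]; exact le_csInf (hne u) (hnn u)
  have hle (c : ℂ) (u : E) : ‖c • u‖ ≤ ‖c‖ * ‖u‖ := by
    rcases eq_or_ne c 0 with rfl | hc
    · rw [zero_smul, hC, norm_zero, zero_mul]
      exact csInf_le (hb 0) h0
    · have hp : 0 < ‖c‖ := norm_pos_iff.2 hc
      rw [← div_le_iff₀' hp, hC u]
      refine le_csInf (hne u) fun r hr => ?_
      rw [div_le_iff₀' hp, hC]
      exact csInf_le (hb _) (hsmul c u r hr)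
  refine ⟨hn, fun c u => le_antisymm (hle c u) ?_, fun u v => ?_⟩
  · rcases eq_or_ne c 0 with rfl | hc
    · rw [norm_zero, zero_mul]; exact hn _
    · have hp : 0 < ‖c‖ := norm_pos_iff.2 hc
      have h := hle c⁻¹ (c • u)
      rw [smul_smul, inv_mul_cancel₀ hc, one_smul, norm_inv] at h
      rwa [le_inv_mul_iff₀ hp] at h
  · refine le_of_forall_pos_le_add fun ε hε => ?_
    obtain ⟨r, hr, hr'⟩ := exists_lt_of_csInf_lt (hne u) (lt_add_of_pos_right (sInf (C u)) (half_pos hε))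
    obtain ⟨s, hs, hs'⟩ := exists_lt_of_csInf_lt (hne v) (lt_add_of_pos_right (sInf (C v)) (half_pos hε))
    rw [hC (u + v), hC u, hC v]
    have := csInf_le (hb _) (hadd u v r hr s hs)
    linarith

section Tensor
variable (X Y : Type*) [SeminormedAddCommGroup X] [NormedSpace ℂ X]
  [SeminormedAddCommGroup Y] [NormedSpace ℂ Y]

namespace PreProj

theorem core : SeminormedSpace.Core ℂ (PreProj X Y) :=
  seminormCore_of_costs costs (fun _ => rfl) ⟨[], rfl, by simp⟩ costs_nonempty
    (fun _ _ => costs_nonneg) (fun _ _ _ hr _ hs => costs_add hr hs) (fun c _ _ hr => costs_smul c hr)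

instance : SeminormedAddCommGroup (PreProj X Y) := SeminormedAddCommGroup.ofCore (core X Y)

instance : NormedSpace ℂ (PreProj X Y) where
  norm_smul_le c u := ((core X Y).norm_smul c u).le

end PreProj

/-- The projective tensor product of `X` and `Y`: the completion of `X ⊗ Y` for the projective norm. -/
abbrev ProjTensor : Type _ := UniformSpace.Completion (PreProj X Y)

variable {X Y} in
/-- The elementary tensor `x ⊗ y` in the projective tensor product. -/
def projTmul (x : X) (y : Y) : ProjTensor X Y := ((PreProj.mk x y : PreProj X Y) : ProjTensor X Y)

end Tensor

section A0

variable {X Z : Type*} [NormedAddCommGroup X] [NormedSpace ℂ X]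
  [NormedAddCommGroup Z] [NormedSpace ℂ Z]

/-- The convolution `(f ∗ h)(s) = ∫ ⟨f(t), h(s - t)⟩ dt` associated with a bounded pairing `β` between
`X` and `Z`. -/
def convPair (β : X →L[ℂ] Z →L[ℂ] ℂ) (f : C₀(ℝ, X)) (h : Lp Z 1 (volume : Measure ℝ)) (s : ℝ) : ℂ :=
  ∫ t, β (f t) (h (s - t))

/-- The duality pairing `⟨h, f⟩ = ∫ ⟨f(-t), h(t)⟩ dt` between `L^1(ℝ; Z)` and `C_0(ℝ; X)` associated
with a bounded pairing `β` between `X` and `Z`. -/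
def dualPair (β : X →L[ℂ] Z →L[ℂ] ℂ) (f : C₀(ℝ, X)) (h : Lp Z 1 (volume : Measure ℝ)) : ℂ :=
  ∫ t, β (f (-t)) (h t)

theorem norm_convPair_le (β : X →L[ℂ] Z →L[ℂ] ℂ) (f : C₀(ℝ, X)) (h : Lp Z 1 (volume : Measure ℝ))
    (s : ℝ) : ‖convPair β f h s‖ ≤ ‖β‖ * (‖f‖ * ‖h‖) := by
  have hi : Integrable (fun t => ‖h (s - t)‖) := ((L1.integrable_coeFn h).comp_sub_left s).norm
  have hf (t : ℝ) : ‖f t‖ ≤ ‖f‖ := f.toBCF.norm_coe_le_norm t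
  refine (norm_integral_le_integral_norm _).trans ?_
  calc ∫ t, ‖β (f t) (h (s - t))‖ ≤ ∫ t, (‖β‖ * ‖f‖) * ‖h (s - t)‖ := by
        refine integral_mono_of_nonneg (ae_of_all _ fun _ => norm_nonneg _) (hi.const_mul _)
          (ae_of_all _ fun t => (β.le_opNorm₂ _ _).trans ?_)
        exact mul_le_mul_of_nonneg_right
          (mul_le_mul_of_nonneg_left (hf t) β.opNorm_nonneg) (norm_nonneg _)
    _ = ‖β‖ * (‖f‖ * ‖h‖) := by
        rw [integral_const_mul, integral_sub_left_eq_self (fun t => ‖h t‖) volume s,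
          L1.norm_eq_integral_norm, mul_assoc]

theorem convPair_smul (β : X →L[ℂ] Z →L[ℂ] ℂ) (c : ℂ) (f : C₀(ℝ, X))
    (h : Lp Z 1 (volume : Measure ℝ)) (s : ℝ) :
    convPair β (c • f) h s = c * convPair β f h s := by
  unfold convPair
  rw [← integral_const_mul]
  exact integral_congr_ae (ae_of_all _ fun t => by simp)

variable (β : X →L[ℂ] Z →L[ℂ] ℂ) (V : Submodule ℂ (Lp Z 1 (volume : Measure ℝ)))

/-- `F = ∑ f_k ∗ h_k` pointwise, with `f_k ∈ C_0(ℝ; X)`, `h_k ∈ V` and `∑ ‖f_k‖ ‖h_k‖ < ∞`. -/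
def IsRep (F : ℝ → ℂ) (f : ℕ → C₀(ℝ, X)) (h : ℕ → V) : Prop :=
  Summable (fun k => ‖f k‖ * ‖h k‖) ∧ ∀ s, F s = ∑' k, convPair β (f k) (h k : Lp Z 1 volume) s

/-- All sums `∑ ‖f_k‖ ‖h_k‖` over the representations `F = ∑ f_k ∗ h_k`. -/
def repCosts (F : ℝ → ℂ) : Set ℝ :=
  {r | ∃ (f : ℕ → C₀(ℝ, X)) (h : ℕ → V), IsRep β V F f h ∧ r = ∑' k, ‖f k‖ * ‖h k‖}

variable {β V}

theorem summable_convPair {f : ℕ → C₀(ℝ, X)} {h : ℕ → V}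
    (hs : Summable (fun k => ‖f k‖ * ‖h k‖)) (s : ℝ) :
    Summable fun k => ‖convPair β (f k) (h k : Lp Z 1 volume) s‖ :=
  Summable.of_nonneg_of_le (fun _ => norm_nonneg _)
    (fun k => norm_convPair_le β (f k) (h k : Lp Z 1 volume) s) (hs.mul_left ‖β‖)

theorem repCosts_nonneg {F : ℝ → ℂ} {r : ℝ} (hr : r ∈ repCosts β V F) : 0 ≤ r := by
  obtain ⟨f, h, -, rfl⟩ := hr
  exact tsum_nonneg fun _ => by positivity

theorem norm_le_of_repCosts {F : ℝ → ℂ} {r : ℝ} (hr : r ∈ repCosts β V F) (s : ℝ) :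
    ‖F s‖ ≤ ‖β‖ * r := by
  obtain ⟨f, h, ⟨hs, hF⟩, rfl⟩ := hr
  rw [hF, ← tsum_mul_left]
  refine (norm_tsum_le_tsum_norm (summable_convPair hs s)).trans ?_
  exact (summable_convPair hs s).tsum_le_tsum
    (fun k => norm_convPair_le β (f k) (h k : Lp Z 1 volume) s) (hs.mul_left ‖β‖)

theorem repCosts_zero : (0 : ℝ) ∈ repCosts β V 0 := by
  refine ⟨fun _ => 0, fun _ => 0, ⟨by simp [summable_zero], fun s => ?_⟩, by simp⟩
  simp [convPair]

theorem repCosts_smul (c : ℂ) {F : ℝ → ℂ} {r : ℝ} (hr : r ∈ repCosts β V F) :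
    ‖c‖ * r ∈ repCosts β V (c • F) := by
  obtain ⟨f, h, ⟨hs, hF⟩, rfl⟩ := hr
  refine ⟨fun k => c • f k, h, ⟨?_, fun s => ?_⟩, ?_⟩
  · simp_rw [norm_smul, mul_assoc]; exact hs.mul_left _
  · simp_rw [convPair_smul]
    rw [tsum_mul_left, Pi.smul_apply, smul_eq_mul, hF]
  · simp_rw [norm_smul, mul_assoc]; rw [tsum_mul_left]

theorem repCosts_add {F G : ℝ → ℂ} {r s : ℝ} (hr : r ∈ repCosts β V F) (hr' : s ∈ repCosts β V G) :
    r + s ∈ repCosts β V (F + G) := by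
  obtain ⟨f, h, ⟨hs, hF⟩, rfl⟩ := hr
  obtain ⟨f', h', ⟨hs', hF'⟩, rfl⟩ := hr'
  set σ := Equiv.natSumNatEquivNat.symm
  have hsum : HasSum (fun k => ‖Sum.elim f f' (σ k)‖ * ‖Sum.elim h h' (σ k)‖)
      (∑' k, ‖f k‖ * ‖h k‖ + ∑' k, ‖f' k‖ * ‖h' k‖) :=
    (σ.hasSum_iff (f := fun k => ‖Sum.elim f f' k‖ * ‖Sum.elim h h' k‖)).2
      (HasSum.sum hs.hasSum hs'.hasSum)
  refine ⟨fun k => Sum.elim f f' (σ k), fun k => Sum.elim h h' (σ k), ⟨hsum.summable, fun s => ?_⟩,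
    hsum.tsum_eq.symm⟩
  have h1 : HasSum (fun k => convPair β (Sum.elim f f' (σ k))
      (Sum.elim h h' (σ k) : V).1 s) (F s + G s) := by
    rw [hF, hF']
    exact (σ.hasSum_iff (f := fun k => convPair β (Sum.elim f f' k)
      (Sum.elim h h' k : V).1 s)).2
      (HasSum.sum (summable_convPair hs s).of_norm.hasSum (summable_convPair hs' s).of_norm.hasSum)
  exact h1.tsum_eq.symm

variable (β V)

/-- The functions `F : ℝ → ℂ` that have a representation `F = ∑ f_k ∗ h_k`. -/
def algA0 : Submodule ℂ (ℝ → ℂ) where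
  carrier := {F | ∃ (f : ℕ → C₀(ℝ, X)) (h : ℕ → V), IsRep β V F f h}
  zero_mem' := by
    obtain ⟨f, h, hF, -⟩ := repCosts_zero (β := β) (V := V)
    exact ⟨f, h, hF⟩
  add_mem' := by
    rintro F G ⟨f, h, hF⟩ ⟨f', h', hG⟩
    obtain ⟨f'', h'', hFG, -⟩ := repCosts_add ⟨f, h, hF, rfl⟩ ⟨f', h', hG, rfl⟩
    exact ⟨f'', h'', hFG⟩
  smul_mem' := by
    rintro c F ⟨f, h, hF⟩
    obtain ⟨f'', h'', hFG, -⟩ := repCosts_smul c ⟨f, h, hF, rfl⟩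
    exact ⟨f'', h'', hFG⟩

/-- The space of all functions `F = ∑ f_k ∗ h_k` with `f_k ∈ C_0(ℝ; X)`, `h_k ∈ V`, whose norm is the
infimum of `∑ ‖f_k‖ ‖h_k‖` over all such representations. -/
def A0Space : Type := ↥(algA0 β V)

namespace A0Space

instance : AddCommGroup (A0Space β V) := inferInstanceAs (AddCommGroup ↥(algA0 β V))

instance : Module ℂ (A0Space β V) := inferInstanceAs (Module ℂ ↥(algA0 β V))

/-- The underlying function. -/
def toFun : A0Space β V →ₗ[ℂ] (ℝ → ℂ) := (algA0 β V).subtype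

instance : Norm (A0Space β V) := ⟨fun F => sInf (repCosts β V (toFun β V F))⟩

theorem repCosts_nonempty (F : A0Space β V) : (repCosts β V (toFun β V F)).Nonempty := by
  obtain ⟨f, h, hF⟩ := F.2
  exact ⟨_, f, h, hF, rfl⟩

theorem core : NormedSpace.Core ℂ (A0Space β V) where
  toCore := seminormCore_of_costs (fun F => repCosts β V (toFun β V F)) (fun _ => rfl)
    repCosts_zero (repCosts_nonempty β V) (fun _ _ => repCosts_nonneg)
    (fun _ _ _ hr _ hs => repCosts_add hr hs) (fun c _ _ hr => repCosts_smul c hr)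
  norm_eq_zero_iff F := by
    constructor
    · intro hF
      refine Subtype.ext (funext fun s => norm_le_zero_iff.1 ?_)
      refine le_of_forall_pos_le_add fun ε hε => ?_
      have hp : 0 < ‖β‖ + 1 := by positivity
      obtain ⟨r, hr, hr'⟩ := exists_lt_of_csInf_lt (repCosts_nonempty β V F)
        (show sInf (repCosts β V (toFun β V F)) < ε / (‖β‖ + 1) from
          (show sInf (repCosts β V (toFun β V F)) = 0 from hF) ▸ by positivity)
      have h1 := norm_le_of_repCosts hr s
      have h2 := repCosts_nonneg hr
      rw [lt_div_iff₀ hp] at hr'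
      change ‖toFun β V F s‖ ≤ 0 + ε
      nlinarith
    · rintro rfl
      exact le_antisymm (csInf_le ⟨0, fun _ => repCosts_nonneg⟩ repCosts_zero)
        (le_csInf (repCosts_nonempty β V 0) fun _ => repCosts_nonneg)

instance : NormedAddCommGroup (A0Space β V) := NormedAddCommGroup.ofCore (core β V)

instance : NormedSpace ℂ (A0Space β V) := NormedSpace.ofCore (core β V)

/-- The element `f ∗ h`. -/
def conv (f : C₀(ℝ, X)) (h : V) : A0Space β V :=
  ⟨convPair β f h.1, by
    refine ⟨fun k => if k = 0 then f else 0, fun k => if k = 0 then h else 0,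
      ⟨summable_of_ne_finset_zero (s := {0}) fun k hk => ?_, fun s => ?_⟩⟩
    · have hk' : k ≠ 0 := by simpa using hk
      simp [hk']
    · rw [tsum_eq_single 0]
      · simp
      · intro k hk
        simp [hk, convPair]⟩

end A0Space
end A0

section Z0

/-- `f ∈ H^∞(ℝ)`: `f ∈ L^∞(ℝ)` and the distributional Fourier transform of `f` has support in
`[0, ∞)`, that is, it vanishes on all test functions supported in `(-∞, 0)`. -/
def IsHardyInf (f : ℝ → ℂ) : Prop :=
  MemLp f ∞ volume ∧ ∀ φ : ℝ → ℂ, ContDiff ℝ ∞ φ → HasCompactSupport φ →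
    tsupport φ ⊆ Set.Iio 0 →
      ∫ t, f t * (∫ u, φ u * Complex.exp (-(Complex.I * t * u))) = 0

/-- `Z_0`: the functions `z ∈ C_0(ℝ)` such that `t ↦ z(-t)` is in `H^∞(ℝ)`. -/
def Z0 : Set C₀(ℝ, ℂ) := {z | IsHardyInf fun t => z (-t)}

variable {X : Type*} [NormedAddCommGroup X] [NormedSpace ℂ X]

/-- The function `z ⊗ a : t ↦ z(t) a` in `C_0(ℝ; X)`. -/
def c0Tensor (z : C₀(ℝ, ℂ)) (a : X) : C₀(ℝ, X) where
  toFun t := z t • a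
  continuous_toFun := z.continuous.smul continuous_const
  zero_at_infty' := by simpa using (zero_at_infty z).smul_const a

variable (X) in
/-- The injective tensor product of `Z_0` and `X`, that is, the closure of `Z_0 ⊗ X` in `C_0(ℝ; X)`. -/
def Z0Tensor : Submodule ℂ C₀(ℝ, X) :=
  (Submodule.span ℂ {g | ∃ z ∈ Z0, ∃ a : X, g = c0Tensor z a}).topologicalClosure

variable (X) in
/-- The quotient of `C_0(ℝ; X)` by the closure of `Z_0 ⊗ X`, with the quotient norm. -/
abbrev C0Quot : Type _ := C₀(ℝ, X) ⧸ Z0Tensor X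

instance : SeminormedAddCommGroup (C0Quot X) :=
  Submodule.Quotient.seminormedAddCommGroup (Z0Tensor X)

instance : NormedSpace ℂ (C0Quot X) := Submodule.Quotient.normedSpace (Z0Tensor X) ℂ

end Z0

section Main

/-- `H^1(ℝ; S^1)`. -/
abbrev HardySOne : Type := ↥(hardyOneVec SOne)

/-- The algebra `A_{0,S^1}(ℝ)`: sums `∑ f_k ∗ h_k` with `f_k ∈ C_0(ℝ; S^∞)`, `h_k ∈ H^1(ℝ; S^1)` and
`(f ∗ h)(s) = ∫ tr (f(t) h(s - t)) dt`. -/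
abbrev A0SOne : Type := A0Space trDual (hardyOneVec SOne)

/-- The algebra `A_0(ℝ)`: sums `∑ f_k ∗ h_k` with `f_k ∈ C_0(ℝ)` and `h_k ∈ H^1(ℝ)`. -/
abbrev A0 : Type := A0Space (ContinuousLinearMap.mul ℂ ℂ) hardyOne

/-- The projective tensor product of `C_0(ℝ; S^∞)` modulo the closure of `Z_0 ⊗ S^∞` with
`H^1(ℝ; S^1)`. -/
abbrev PreSpace : Type := ProjTensor (C0Quot SInf) HardySOne

/-- The class of `f` tensored with `h`. -/
def classTmul (f : C₀(ℝ, SInf)) (h : HardySOne) : PreSpace :=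
  projTmul (Submodule.Quotient.mk f : C0Quot SInf) h

end Main

end

end HardyMultipliers

open HardyMultipliers

/-!
The convolution `f ∗ h` is a coefficient of the translation group, `(f ∗ h)(s) = ⟨τ_{-s} h, f⟩`.
Hence a functional on the algebra is a bounded bilinear form in `(f, h)` that commutes with
translations, and the theorem says that such forms are given by Fourier multipliers. All results are
proved for a contractive pairing `β` of `X` and `Z` for which the unit ball of `X` computes the norm
of `Z` (`IsNorming`); the trace pairing of `S^∞` and `S^1` (`isNorming_trPairing`) and the product of
`ℂ` are such pairings. The unit ball of `C_0(ℝ; X)` then computes the norm of `L^1(ℝ; Z)`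
(`norm_le_of_dualPair_le`), which gives the isometries. That `Λ` is well defined on the quotient by
`Z_0 ⊗ X` is the orthogonality of `Z_0` to the band limited functions, which are dense in `H^1`
(`hardyOne_subset_closure_bandLimited`).

From functionals to multipliers: on elementary tensors, `f ∗ (g ⊗ z)` is a scalar convolution. A
bilinear form on scalar functions that depends only on `f ∗ g` is given on a band limited
`g = κ ∗ g` by the continuous function `w(t) = Φ(κ(· + t), g)`, which is integrable because
`f ↦ ∫ f(-t) w(t) dt` is bounded (`bandLimited_represented`). Since the set of vectors on which a
form is represented is closed (`isClosed_represented`), one gets a bounded operator `T` from `H^1` to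
`L^1`. It commutes with translations, hence with convolutions, so `T g` has no negative spectrum and
the ratio of the transforms of `T g` and `g` does not depend on `g`
(`exists_multiplier_of_shift`). The same closedness extends `T ⊗ I` to `H^1(ℝ; Z)`
(`exists_operator_of_functional`).

From multipliers to functionals (`exists_functional_of_operator`): an integrable function `w` acts on
the algebra by `F ↦ ∫ w(s) F(-s) ds`, and sends `f ∗ h` to `⟨w ∗ h, f⟩`. For `w = T ρ_n`, where `ρ_n` in
`H^1` is an approximate identity of `H^1`, one has `w ∗ h = W (ρ_n ∗ h)` with `W` the extension of
`T ⊗ I`. So these functionals are bounded by a multiple of `‖W‖`, and a weak* cluster point of them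
represents `W`.
-/

namespace HardyMultipliers

noncomputable section

open Filter Topology

/-! ### Completeness of the trace class and its duality with the compact operators -/

/-- The pairing `β` lets the unit ball of `X` compute the norm of `Z`. -/
def IsNorming {X Z : Type*} [NormedAddCommGroup X] [NormedSpace ℂ X] [NormedAddCommGroup Z]
    [NormedSpace ℂ Z] (β : X →L[ℂ] Z →L[ℂ] ℂ) : Prop :=
  ∀ (z : Z) (ε : ℝ), 0 < ε → ∃ x : X, ‖x‖ ≤ 1 ∧ ‖z‖ - ε < (β x z).re

section TraceClass

variable {H : Type*} [NormedAddCommGroup H] [InnerProductSpace ℂ H] [CompleteSpace H]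

theorem ofReal_norm_apply_sq_le_hsSq (e : HilbertBasis ℕ ℂ H) (a : H →L[ℂ] H) (x : H) :
    ENNReal.ofReal (‖a x‖ ^ 2) ≤ ENNReal.ofReal (‖x‖ ^ 2) * hsSq e a := by
  rw [← hsSq_star e a, parseval e (a x), hsSq, ← ENNReal.tsum_mul_left]
  refine ENNReal.tsum_le_tsum fun j => ?_
  rw [← ENNReal.ofReal_mul (by positivity), ← mul_pow]
  refine ENNReal.ofReal_le_ofReal ?_
  have : ‖(inner ℂ (e j) (a x) : ℂ)‖ ≤ ‖x‖ * ‖star a (e j)‖ := by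
    rw [← ContinuousLinearMap.adjoint_inner_left, ← ContinuousLinearMap.star_eq_adjoint, mul_comm]
    exact norm_inner_le_norm _ _
  gcongr

theorem IsTraceClass.opNorm_le {e : HilbertBasis ℕ ℂ H} {b : H →L[ℂ] H}
    (hb : IsTraceClass e b) : ‖b‖ ≤ traceNorm e b := by
  have hT : 0 ≤ traceNorm e b := tsum_nonneg (abs_diag_nonneg e b)
  set r := CFC.sqrt (CFC.abs b) with hr
  have hrr : r * r = CFC.abs b := CFC.sqrt_mul_sqrt_self _ (CFC.abs_nonneg b)
  have hs : hsSq e r = ENNReal.ofReal (traceNorm e b) := by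
    rw [hr, hsSq_sqrt, ← ENNReal.ofReal_tsum_of_nonneg (abs_diag_nonneg e b) hb]; rfl
  have key (x : H) : ‖r x‖ ^ 2 ≤ ‖x‖ ^ 2 * traceNorm e b := by
    have := ofReal_norm_apply_sq_le_hsSq e r x
    rwa [hs, ← ENNReal.ofReal_mul (by positivity), ENNReal.ofReal_le_ofReal_iff (by positivity)]
      at this
  refine ContinuousLinearMap.opNorm_le_bound _ hT fun x => ?_
  rw [← norm_abs_apply, ← hrr, mul_apply_eq_comp]
  refine abs_le_of_sq_le_sq' ?_ (by positivity) |>.2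
  calc ‖r (r x)‖ ^ 2 ≤ ‖r x‖ ^ 2 * traceNorm e b := key _
    _ ≤ ‖x‖ ^ 2 * traceNorm e b * traceNorm e b := by gcongr; exact key x
    _ = (traceNorm e b * ‖x‖) ^ 2 := by ring

/-- The trace norm is lower semicontinuous for the operator norm. -/
theorem isTraceClass_of_tendsto {e : HilbertBasis ℕ ℂ H} {b : ℕ → H →L[ℂ] H} {b' : H →L[ℂ] H}
    {c : ℝ} (hb : Tendsto b atTop (𝓝 b'))
    (hc : ∀ᶠ n in atTop, IsTraceClass e (b n) ∧ traceNorm e (b n) ≤ c) :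
    IsTraceClass e b' ∧ traceNorm e b' ≤ c := by
  obtain ⟨u, hu, -, hub⟩ := exists_polar b'
  have hsu : ‖star u‖ ≤ 1 := by rwa [norm_star]
  have key (N : ℕ) : ∑ i ∈ Finset.range N, (inner ℂ (e i) (CFC.abs b' (e i))).re ≤ c := by
    have hlim : Tendsto (fun n => ∑ i ∈ Finset.range N,
        (inner ℂ (e i) ((star u * b n) (e i)) : ℂ).re) atTop
        (𝓝 (∑ i ∈ Finset.range N, (inner ℂ (e i) ((star u * b') (e i)) : ℂ).re)) := by
      refine tendsto_finsetSum _ fun i _ => ?_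
      have h1 : Continuous fun d : H →L[ℂ] H => (inner ℂ (e i) ((star u * d) (e i)) : ℂ).re := by
        fun_prop
      exact (h1.tendsto b').comp hb
    rw [hub] at hlim
    refine le_of_tendsto hlim (hc.mono fun n hn => ?_)
    obtain ⟨hs, hl⟩ := hn.1.diag _ hsu
    calc ∑ i ∈ Finset.range N, (inner ℂ (e i) ((star u * b n) (e i)) : ℂ).re
        ≤ ∑ i ∈ Finset.range N, ‖(inner ℂ (e i) ((star u * b n) (e i)) : ℂ)‖ :=
          Finset.sum_le_sum fun i _ => Complex.re_le_norm _
      _ ≤ _ := hs.sum_le_tsum _ fun i _ => norm_nonneg _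
      _ ≤ _ := hl
      _ ≤ c := hn.2
  exact ⟨summable_of_sum_range_le (abs_diag_nonneg e b') key,
    Real.tsum_le_of_sum_range_le (abs_diag_nonneg e b') key⟩

instance TraceClassOp.instCompleteSpace (e : HilbertBasis ℕ ℂ H) :
    CompleteSpace (TraceClassOp e) := by
  refine Metric.complete_of_cauchySeq_tendsto fun b hb => ?_
  have hcau : CauchySeq fun n => TraceClassOp.toCLM e (b n) := by
    rw [Metric.cauchySeq_iff] at hb ⊢
    intro ε hε
    obtain ⟨N, hN⟩ := hb ε hε
    refine ⟨N, fun m hm n hn => lt_of_le_of_lt ?_ (hN m hm n hn)⟩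
    rw [dist_eq_norm, dist_eq_norm, ← map_sub]
    exact (TraceClassOp.isTraceClass_toCLM e (b m - b n)).opNorm_le
  obtain ⟨b', hb'⟩ := cauchySeq_tendsto_of_complete hcau
  have key (ε : ℝ) (hε : 0 < ε) : ∃ N, ∀ m ≥ N, IsTraceClass e (TraceClassOp.toCLM e (b m) - b') ∧
      traceNorm e (TraceClassOp.toCLM e (b m) - b') ≤ ε := by
    obtain ⟨N, hN⟩ := Metric.cauchySeq_iff.1 hb ε hε
    refine ⟨N, fun m hm => isTraceClass_of_tendsto
      (b := fun n => TraceClassOp.toCLM e (b m) - TraceClassOp.toCLM e (b n))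
      (tendsto_const_nhds.sub hb') ?_⟩
    filter_upwards [eventually_ge_atTop N] with n hn
    rw [← map_sub]
    refine ⟨TraceClassOp.isTraceClass_toCLM e _, ?_⟩
    have := (hN m hm n hn).le
    rwa [dist_eq_norm] at this
  obtain ⟨N, hN⟩ := key 1 one_pos
  have hmem : b' ∈ traceClass e := by
    have h1 : TraceClassOp.toCLM e (b N) - b' ∈ traceClass e := (hN N le_rfl).1
    have h2 := Submodule.sub_mem _ (show TraceClassOp.toCLM e (b N) ∈ traceClass e from (b N).2) h1
    rwa [sub_sub_cancel] at h2
  let B : TraceClassOp e := ⟨b', hmem⟩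
  refine ⟨B, Metric.tendsto_atTop'.2 fun ε hε => ?_⟩
  obtain ⟨N, hN⟩ := key (ε / 2) (half_pos hε)
  refine ⟨N, fun n hn => ?_⟩
  rw [dist_eq_norm]
  exact (hN n hn.le).2.trans_lt (half_lt_self hε)

theorem norm_trPairing_le (e : HilbertBasis ℕ ℂ H) : ‖trPairing e‖ ≤ 1 :=
  LinearMap.mkContinuous₂_norm_le _ zero_le_one _

theorem trPairing_apply (e : HilbertBasis ℕ ℂ H) (a : CompactOp H) (b : TraceClassOp e) :
    trPairing e a b = ∑' i, inner ℂ (e i) (((a : H →L[ℂ] H) * TraceClassOp.toCLM e b) (e i)) := rfl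

/-- With the polar decomposition `b = u |b|` and the projections `P_N` onto the first `N` basis
vectors, the finite rank contractions `P_N u*` satisfy `tr (P_N u* b) = ∑_{i < N} ⟨|b| e_i, e_i⟩`,
which tends to `tr |b|`. -/
theorem isNorming_trPairing (e : HilbertBasis ℕ ℂ H) : IsNorming (trPairing e) := by
  intro b ε hε
  obtain ⟨u, hu, -, hub⟩ := exists_polar (TraceClassOp.toCLM e b)
  have hs := TraceClassOp.isTraceClass_toCLM e b
  have hlim : Tendsto (fun N => ∑ i ∈ Finset.range N,
      (inner ℂ (e i) (CFC.abs (TraceClassOp.toCLM e b) (e i))).re) atTop (𝓝 ‖b‖) :=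
    hs.hasSum.tendsto_sum_nat
  obtain ⟨N, hN⟩ := (hlim.eventually (lt_mem_nhds (sub_lt_self ‖b‖ hε))).exists
  let U : Submodule ℂ H := Submodule.span ℂ (e '' (Finset.range N : Set ℕ))
  have hfin : FiniteDimensional ℂ U :=
    FiniteDimensional.span_of_finite ℂ ((Finset.finite_toSet _).image _)
  let P : H →L[ℂ] H := U.starProjection
  have hPn : ‖P‖ ≤ 1 := Submodule.starProjection_norm_le U
  have hcomp : IsCompactOperator (P * star u : H →L[ℂ] H) := by
    have h1 : IsCompactOperator (P : H →L[ℂ] H) := by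
      have h2 : IsCompactOperator (U.orthogonalProjectionOnto : H →L[ℂ] U) := by
        have := FiniteDimensional.proper ℂ U
        exact isCompactOperator_of_locallyCompactSpace_dom U.orthogonalProjectionOnto
      exact h2.clm_comp U.subtypeL
    exact h1.comp_clm (star u)
  refine ⟨⟨P * star u, hcomp⟩, ?_, ?_⟩
  · refine (norm_mul_le P (star u)).trans ?_
    rw [norm_star]
    exact mul_le_one₀ hPn (norm_nonneg _) hu
  · rw [trPairing_apply]
    have hterm (i : ℕ) : (inner ℂ (e i) ((P * star u * TraceClassOp.toCLM e b) (e i)) : ℂ) =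
        if i ∈ Finset.range N then inner ℂ (e i) (CFC.abs (TraceClassOp.toCLM e b) (e i)) else 0 := by
      rw [mul_assoc, hub, mul_apply_eq_comp,
        ← Submodule.inner_starProjection_left_eq_right]
      split_ifs with hi
      · have hmem : e i ∈ U := Submodule.subset_span ⟨i, by exact_mod_cast hi, rfl⟩
        rw [Submodule.starProjection_eq_self_iff.2 hmem]
      · rw [(Submodule.starProjection_apply_eq_zero_iff U).2, inner_zero_left]
        rw [Submodule.mem_orthogonal]
        intro v hv
        refine Submodule.span_induction ?_ (by simp) ?_ ?_ hv
        · rintro _ ⟨j, hj, rfl⟩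
          rw [orthonormal_iff_ite.1 e.orthonormal, if_neg]
          rintro rfl
          exact hi (by exact_mod_cast hj)
        · intro x y _ _ hx hy
          rw [inner_add_left, hx, hy, add_zero]
        · intro c x _ hx
          rw [inner_smul_left, hx, mul_zero]
    change ‖b‖ - ε < (∑' i, (inner ℂ (e i) ((P * star u * TraceClassOp.toCLM e b) (e i)) : ℂ)).re
    simp_rw [hterm]
    rw [tsum_eq_sum (s := Finset.range N) fun i hi => if_neg hi, Complex.re_sum]
    refine hN.trans_le (Finset.sum_le_sum fun i hi => ?_)
    rw [if_pos hi]

end TraceClass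

/-! ### Translations and convolutions on the Bochner spaces `L^1(ℝ; Z)` -/

/-- The Bochner space `L^1(ℝ; Z)`. -/
abbrev LOne (Z : Type*) [NormedAddCommGroup Z] : Type _ := Lp Z 1 (volume : Measure ℝ)

section Shift

variable {Z : Type*} [NormedAddCommGroup Z] [NormedSpace ℂ Z]

/-- The translation `(τ_s h)(t) = h(t - s)` on `L^1(ℝ; Z)`. -/
def shift (s : ℝ) : LOne Z →ₗᵢ[ℂ] LOne Z :=
  Lp.compMeasurePreservingₗᵢ ℂ (fun t : ℝ => t - s) (measurePreserving_sub_right volume s)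

theorem coeFn_shift (s : ℝ) (h : LOne Z) : shift s h =ᵐ[volume] fun t => h (t - s) :=
  Lp.coeFn_compMeasurePreserving h (measurePreserving_sub_right volume s)

theorem continuous_shift (h : LOne Z) : Continuous fun s : ℝ => shift s h := by
  let g : C(ℝ, C(ℝ, ℝ)) := ContinuousMap.curry ⟨fun p : ℝ × ℝ => p.2 - p.1, by fun_prop⟩
  exact (continuous_const (y := h)).compMeasurePreservingLp g.continuous
    (fun s => measurePreserving_sub_right volume s) ENNReal.one_ne_top

theorem shift_shift (s r : ℝ) (h : LOne Z) : shift s (shift r h) = shift (s + r) h := by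
  refine Lp.ext ?_
  have h1 := (measurePreserving_sub_right volume s).quasiMeasurePreserving.ae_eq_comp
    (coeFn_shift r h)
  filter_upwards [coeFn_shift s (shift r h), coeFn_shift (s + r) h, h1] with t h2 h3 h4
  rw [h2, h3]
  simp only [Function.comp] at h4
  rw [h4]
  congr 1
  ring

theorem shift_zero (h : LOne Z) : shift 0 h = h := by
  refine Lp.ext ?_
  filter_upwards [coeFn_shift 0 h] with t ht
  rw [ht, sub_zero]

theorem integrable_smul_shift (k : LOne ℂ) (c : ℝ) (h : LOne Z) :
    Integrable fun s : ℝ => k s • shift (c * s) h := by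
  refine ((L1.integrable_coeFn k).norm.mul_const ‖h‖).mono'
    ((Lp.aestronglyMeasurable k).smul
      ((continuous_shift h).comp (continuous_const.mul continuous_id)).aestronglyMeasurable)
    (ae_of_all _ fun s => ?_)
  rw [norm_smul, LinearIsometry.norm_map]

/-- The convolution `∫ k(s) τ_{c s} h ds` of `h ∈ L^1(ℝ; Z)` with the dilation of `k ∈ L^1(ℝ)` by the
factor `c`, a Bochner integral in `L^1(ℝ; Z)`; for `c = 1` this is `k ∗ h`, and for `c = 0` it is
`(∫ k) h`. -/
def dilConv (k : LOne ℂ) (c : ℝ) : LOne Z →L[ℂ] LOne Z :=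
  LinearMap.mkContinuous
    { toFun := fun h => ∫ s : ℝ, k s • shift (c * s) h
      map_add' := fun h g => by
        rw [← integral_add (integrable_smul_shift k c h) (integrable_smul_shift k c g)]
        simp_rw [map_add, smul_add]
      map_smul' := fun a h => by
        rw [RingHom.id_apply, ← integral_smul]
        simp_rw [map_smul, smul_comm a] }
    ‖k‖ (fun h => by
      refine (norm_integral_le_integral_norm _).trans (le_of_eq ?_)
      simp_rw [norm_smul, LinearIsometry.norm_map]
      rw [integral_mul_const, ← L1.norm_eq_integral_norm])

theorem dilConv_apply (k : LOne ℂ) (c : ℝ) (h : LOne Z) :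
    dilConv k c h = ∫ s : ℝ, k s • shift (c * s) h := rfl

theorem norm_dilConv_le (k : LOne ℂ) (c : ℝ) : ‖(dilConv k c : LOne Z →L[ℂ] LOne Z)‖ ≤ ‖k‖ :=
  LinearMap.mkContinuous_norm_le _ (norm_nonneg _) _

theorem map_dilConv [CompleteSpace Z] {F : Type*} [NormedAddCommGroup F] [NormedSpace ℂ F]
    [CompleteSpace F] (L : LOne Z →L[ℂ] F) (k : LOne ℂ) (c : ℝ) (h : LOne Z) :
    L (dilConv k c h) = ∫ s : ℝ, k s • L (shift (c * s) h) := by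
  rw [dilConv_apply, ← L.integral_comp_comm (integrable_smul_shift k c h)]
  simp_rw [map_smul]

section Invariant

variable [CompleteSpace Z] {V : Submodule ℂ (LOne Z)} [CompleteSpace V]

theorem exists_integral_shift (hV : ∀ (s : ℝ), ∀ h ∈ V, shift s h ∈ V) (k : LOne ℂ) (c : ℝ)
    (h : V) : Integrable (fun s : ℝ => k s • (⟨shift (c * s) h.1, hV _ _ h.2⟩ : V)) ∧
      ((∫ s : ℝ, k s • (⟨shift (c * s) h.1, hV _ _ h.2⟩ : V) : V) : LOne Z) = dilConv k c h.1 := by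
  have hi : Integrable (fun s : ℝ => k s • (⟨shift (c * s) h.1, hV _ _ h.2⟩ : V)) := by
    refine ((L1.integrable_coeFn k).norm.mul_const ‖h‖).mono'
      ((Lp.aestronglyMeasurable k).smul (Continuous.aestronglyMeasurable ?_))
      (ae_of_all _ fun s => ?_)
    · exact ((continuous_shift h.1).comp (continuous_const.mul continuous_id)).subtype_mk _
    · rw [norm_smul]
      refine le_of_eq (congrArg _ ?_)
      exact LinearIsometry.norm_map (shift (c * s)) h.1
  refine ⟨hi, ?_⟩
  have := V.subtypeL.integral_comp_comm hi
  exact this.symm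

theorem dilConv_mem (hV : ∀ (s : ℝ), ∀ h ∈ V, shift s h ∈ V) (k : LOne ℂ) (c : ℝ) {h : LOne Z}
    (hh : h ∈ V) : dilConv k c h ∈ V := by
  rw [← (exists_integral_shift hV k c ⟨h, hh⟩).2]
  exact Subtype.property _

theorem map_dilConv_of_mem (hV : ∀ (s : ℝ), ∀ h ∈ V, shift s h ∈ V)
    {F : Type*} [NormedAddCommGroup F] [NormedSpace ℂ F] [CompleteSpace F] (L : V →L[ℂ] F)
    (k : LOne ℂ) (c : ℝ) {h : LOne Z} (hh : h ∈ V) :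
    L ⟨dilConv k c h, dilConv_mem hV k c hh⟩ = ∫ s : ℝ, k s • L ⟨shift (c * s) h, hV _ _ hh⟩ := by
  obtain ⟨hi, he⟩ := exists_integral_shift hV k c ⟨h, hh⟩
  have : (⟨dilConv k c h, dilConv_mem hV k c hh⟩ : V) =
      ∫ s : ℝ, k s • (⟨shift (c * s) h, hV _ _ hh⟩ : V) := Subtype.ext he.symm
  rw [this, ← L.integral_comp_comm hi]
  simp_rw [map_smul]

end Invariant

/-- The dilations of `k` are an approximate identity up to the factor `∫ k`. -/
theorem tendsto_dilConv [CompleteSpace Z] (k : LOne ℂ) (h : LOne Z) {c : ℕ → ℝ}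
    (hc : Tendsto c atTop (𝓝 0)) :
    Tendsto (fun n => dilConv k (c n) h) atTop (𝓝 ((∫ s, k s) • h)) := by
  rw [← integral_smul_const]
  simp_rw [dilConv_apply]
  refine tendsto_integral_of_dominated_convergence (fun s => ‖k s‖ * ‖h‖)
    (fun n => (integrable_smul_shift k (c n) h).aestronglyMeasurable)
    ((L1.integrable_coeFn k).norm.mul_const _)
    (fun n => ae_of_all _ fun s => by rw [norm_smul, LinearIsometry.norm_map])
    (ae_of_all _ fun s => ?_)
  have h1 : Tendsto (fun n => c n * s) atTop (𝓝 0) := by simpa using hc.mul_const s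
  have h2 := ((continuous_shift h).tendsto 0).comp h1
  rw [shift_zero] at h2
  exact h2.const_smul (k s)

/-- The map `h ↦ h ⊗ z` from `L^1(ℝ)` to `L^1(ℝ; Z)`. -/
def tensorCLM (z : Z) : LOne ℂ →L[ℂ] LOne Z :=
  (ContinuousLinearMap.toSpanSingleton ℂ z).compLpL 1 volume

theorem tensorCLM_apply (h : LOne ℂ) (z : Z) : tensorCLM z h = tensorL1 h z := rfl

theorem coeFn_tensorL1 (h : LOne ℂ) (z : Z) : tensorL1 h z =ᵐ[volume] fun t => h t • z :=
  (ContinuousLinearMap.toSpanSingleton ℂ z).coeFn_compLp h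

theorem shift_tensorL1 (s : ℝ) (h : LOne ℂ) (z : Z) :
    shift s (tensorL1 h z) = tensorL1 (shift s h) z := by
  refine Lp.ext ?_
  have h1 := (measurePreserving_sub_right volume s).quasiMeasurePreserving.ae_eq_comp
    (coeFn_tensorL1 h z)
  filter_upwards [coeFn_shift s (tensorL1 h z), coeFn_tensorL1 (shift s h) z, coeFn_shift s h, h1]
    with t h2 h3 h4 h5
  rw [h2, h3, h4]
  exact h5

theorem dilConv_tensorL1 [CompleteSpace Z] (k : LOne ℂ) (c : ℝ) (h : LOne ℂ) (z : Z) :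
    dilConv k c (tensorL1 h z) = tensorL1 (dilConv k c h) z := by
  rw [← tensorCLM_apply (dilConv k c h), map_dilConv, dilConv_apply]
  simp_rw [shift_tensorL1]
  rfl

end Shift

/-! ### The Fourier transform on `L^1(ℝ)` -/

section Fourier

open FourierTransform SchwartzMap

theorem norm_fourierL1_le (h : LOne ℂ) (u : ℝ) : ‖fourierL1 h u‖ ≤ ‖h‖ := by
  rw [L1.norm_eq_integral_norm]
  refine (norm_integral_le_integral_norm _).trans (le_of_eq ?_)
  congr 1
  ext t
  rw [norm_mul, Complex.norm_exp]
  simp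

/-- The Fourier transform at the frequency `u`, as a bounded functional. -/
def fourierCLM (u : ℝ) : LOne ℂ →L[ℂ] ℂ :=
  LinearMap.mkContinuous
    { toFun := fun h => fourierL1 h u
      map_add' := fun h g => fourierL1_add h g u
      map_smul' := fun c h => fourierL1_smul c h u }
    1 (fun h => by rw [one_mul]; exact norm_fourierL1_le h u)

theorem fourierCLM_apply (u : ℝ) (h : LOne ℂ) : fourierCLM u h = fourierL1 h u := rfl

theorem fourierL1_sub (h g : LOne ℂ) (u : ℝ) :
    fourierL1 (h - g) u = fourierL1 h u - fourierL1 g u := map_sub (fourierCLM u) h g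

theorem continuous_fourierL1 (h : LOne ℂ) : Continuous (fourierL1 h) := by
  refine continuous_of_dominated (bound := fun t => ‖h t‖)
    (fun u => (integrable_fourierL1 h u).aestronglyMeasurable)
    (fun u => ae_of_all _ fun t => ?_) (L1.integrable_coeFn h).norm
    (ae_of_all _ fun t => by fun_prop)
  rw [norm_mul, Complex.norm_exp]
  simp

theorem fourierL1_toL1 {f : ℝ → ℂ} (hf : Integrable f) (u : ℝ) :
    fourierL1 (hf.toL1 f) u = ∫ t, f t * Complex.exp (-(Complex.I * t * u)) := by
  refine integral_congr_ae ?_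
  filter_upwards [hf.coeFn_toL1] with t ht
  rw [ht]

theorem fourierL1_shift (s : ℝ) (h : LOne ℂ) (u : ℝ) :
    fourierL1 (shift s h) u = Complex.exp (-(Complex.I * s * u)) * fourierL1 h u := by
  unfold fourierL1
  rw [← integral_const_mul]
  conv_rhs => rw [← integral_sub_right_eq_self _ s]
  refine integral_congr_ae ?_
  filter_upwards [coeFn_shift s h] with t ht
  rw [ht, mul_left_comm, ← Complex.exp_add]
  congr 2
  push_cast
  ring

theorem fourierL1_dilConv (k : LOne ℂ) (c : ℝ) (h : LOne ℂ) (u : ℝ) :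
    fourierL1 (dilConv k c h) u = fourierL1 k (c * u) * fourierL1 h u := by
  rw [← fourierCLM_apply, map_dilConv]
  simp_rw [fourierCLM_apply, fourierL1_shift, smul_eq_mul, ← mul_assoc]
  rw [integral_mul_const]
  congr 2
  ext t
  congr 2
  push_cast
  ring

/-- The multiplication formula, which moves the Fourier transform from one factor to the other. -/
theorem integral_mul_fourier (h : LOne ℂ) {θ : ℝ → ℂ} (hθ : Integrable θ) :
    ∫ t, h t * (∫ u, θ u * Complex.exp (-(Complex.I * t * u))) = ∫ u, fourierL1 h u * θ u := by
  unfold fourierL1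
  simp_rw [← integral_const_mul, ← integral_mul_const]
  rw [integral_integral_swap]
  · congr 1
    ext u
    congr 1
    ext t
    ring
  · have h1 : Integrable (fun p : ℝ × ℝ => h p.1 * θ p.2) (volume.prod volume) :=
      (L1.integrable_coeFn h).mul_prod hθ
    have h2 : Integrable (fun p : ℝ × ℝ => h p.1 * θ p.2 *
        Complex.exp (-(Complex.I * p.1 * p.2))) (volume.prod volume) := h1.mul_bdd (c := 1)
      (Continuous.aestronglyMeasurable (by fun_prop)) (ae_of_all _ fun p => by
        rw [Complex.norm_exp]; simp)
    refine h2.congr (ae_of_all _ fun p => ?_)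
    simp only [Function.uncurry]
    ring

/-- Fourier inversion for test functions, in the normalization `∫ κ(t) e^{-itu} dt`. -/
theorem exists_schwartz_fourier {θ : ℝ → ℂ} (hθ : ContDiff ℝ ∞ θ) (hc : HasCompactSupport θ) :
    ∃ κ : 𝓢(ℝ, ℂ), (∀ u : ℝ, ∫ t, κ t * Complex.exp (-(Complex.I * t * u)) = θ u) ∧
      ∀ t : ℝ, κ t = (2 * Real.pi : ℂ)⁻¹ * ∫ u, θ u * Complex.exp (Complex.I * t * u) := by
  have hpi : (2 * Real.pi : ℝ) ≠ 0 := by positivity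
  have hc' : HasCompactSupport fun x : ℝ => θ (2 * Real.pi * x) :=
    hc.comp_homeomorph (Homeomorph.mulLeft₀ _ hpi)
  let ψ : 𝓢(ℝ, ℂ) := hc'.toSchwartzMap (hθ.comp (by fun_prop))
  have hψ (x : ℝ) : ψ x = θ (2 * Real.pi * x) := rfl
  refine ⟨𝓕⁻ ψ, fun u => ?_, fun t => ?_⟩
  · have h1 : 𝓕 (𝓕⁻ ψ) (u / (2 * Real.pi)) = ψ (u / (2 * Real.pi)) := by
      rw [FourierTransform.fourier_fourierInv_eq]
    rw [hψ, mul_div_cancel₀ _ hpi, fourier_coe, Real.fourier_real_eq_integral_exp_smul] at h1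
    rw [← h1]
    congr 1
    ext t
    rw [smul_eq_mul, mul_comm]
    congr 2
    push_cast
    field_simp
  · rw [fourierInv_coe, Real.fourierInv_eq']
    have h2 := Measure.integral_comp_mul_left
      (fun u : ℝ => θ u * Complex.exp (Complex.I * t * u)) (2 * Real.pi)
    rw [abs_of_pos (by positivity), Complex.real_smul] at h2
    push_cast at h2
    rw [← h2]
    congr 1
    ext x
    rw [smul_eq_mul, hψ, mul_comm]
    congr 2
    simp
    ring

theorem eq_zero_of_fourierL1_ae {h : LOne ℂ} (hh : ∀ᵐ u, fourierL1 h u = 0) : h = 0 := by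
  refine Lp.ext ?_
  have h0 : ∀ᵐ t, h t = 0 := by
    refine ae_eq_zero_of_integral_contDiff_smul_eq_zero
      (L1.integrable_coeFn h).locallyIntegrable fun g hg hgc => ?_
    obtain ⟨κ, hκ, -⟩ := exists_schwartz_fourier (θ := fun t => (g t : ℂ))
      (Complex.ofRealCLM.contDiff.comp hg) (hgc.comp_left (g := Complex.ofReal) (by simp))
    have h1 := integral_mul_fourier h κ.integrable
    have h2 (t : ℝ) : ∫ u, κ u * Complex.exp (-(Complex.I * t * u)) = g t := by
      rw [← hκ t]
      congr 1
      ext u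
      congr 2
      ring
    simp_rw [h2] at h1
    have h3 : ∫ u, fourierL1 h u * κ u = 0 := by
      refine integral_eq_zero_of_ae ?_
      filter_upwards [hh] with u hu
      rw [hu, zero_mul, Pi.zero_apply]
    rw [h3] at h1
    rw [← h1]
    congr 1
    ext t
    rw [Complex.real_smul, mul_comm]
  filter_upwards [h0, Lp.coeFn_zero ℂ 1 (volume : Measure ℝ)] with t ht ht'
  rw [ht, ht', Pi.zero_apply]

theorem fourierL1_injective {h g : LOne ℂ} (hh : ∀ᵐ u, fourierL1 h u = fourierL1 g u) : h = g := by
  refine sub_eq_zero.1 (eq_zero_of_fourierL1_ae ?_)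
  filter_upwards [hh] with u hu
  rw [fourierL1_sub, hu, sub_self]

/-- Every test function is the Fourier transform of an integrable function, which has a Schwartz
function as a representative. -/
theorem exists_fourierL1_eq {θ : ℝ → ℂ} (hθ : ContDiff ℝ ∞ θ) (hc : HasCompactSupport θ) :
    ∃ (κ : 𝓢(ℝ, ℂ)) (k : LOne ℂ), k =ᵐ[volume] κ ∧ (∀ u, fourierL1 k u = θ u) ∧
      ∀ t : ℝ, κ t = (2 * Real.pi : ℂ)⁻¹ * ∫ u, θ u * Complex.exp (Complex.I * t * u) := by
  obtain ⟨κ, hκ, hκ'⟩ := exists_schwartz_fourier hθ hc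
  exact ⟨κ, κ.integrable.toL1 κ, κ.integrable.coeFn_toL1,
    fun u => (fourierL1_toL1 κ.integrable u).trans (hκ u), hκ'⟩

end Fourier

/-! ### Band limited functions are dense in `H^1(ℝ)` -/

section Band

open FourierTransform SchwartzMap

theorem isClosed_hardyOne : IsClosed (hardyOne : Set (LOne ℂ)) := by
  have : (hardyOne : Set (LOne ℂ)) = ⋂ u ∈ Set.Iic (0 : ℝ), {h | fourierCLM u h = 0} := by
    ext h
    simp only [Set.mem_iInter]
    rfl
  rw [this]
  exact isClosed_biInter fun u _ =>
    isClosed_eq (fourierCLM u).continuous continuous_const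

instance : CompleteSpace hardyOne := isClosed_hardyOne.completeSpace_coe

theorem shift_mem_hardyOne (s : ℝ) (h : LOne ℂ) (hh : h ∈ hardyOne) : shift s h ∈ hardyOne :=
  fun u hu => by rw [fourierL1_shift, hh u hu, mul_zero]

/-- The integrable functions whose Fourier transform is a test function supported in `(0, ∞)`. -/
def bandLimited : Set (LOne ℂ) :=
  {k | ContDiff ℝ ∞ (fourierL1 k) ∧ HasCompactSupport (fourierL1 k) ∧
    tsupport (fourierL1 k) ⊆ Set.Ioi 0}

theorem bandLimited_subset_hardyOne {k : LOne ℂ} (hk : k ∈ bandLimited) : k ∈ hardyOne :=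
  fun _ hu => image_eq_zero_of_notMem_tsupport fun h => (not_lt.2 hu) (hk.2.2 h)

theorem exists_cutoff : ∃ η : ℝ → ℂ, ContDiff ℝ ∞ η ∧ HasCompactSupport η ∧
    (∀ u, |u| ≤ 1 → η u = 1) ∧ ∀ u, 2 ≤ |u| → η u = 0 := by
  let f : ContDiffBump (0 : ℝ) := ⟨1, 2, one_pos, one_lt_two⟩
  refine ⟨fun u => (f u : ℂ), Complex.ofRealCLM.contDiff.comp f.contDiff,
    f.hasCompactSupport.comp_left (g := Complex.ofReal) (by simp), fun u hu => ?_, fun u hu => ?_⟩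
  · simp only [f.one_of_mem_closedBall (by simpa using hu : u ∈ Metric.closedBall 0 f.rIn),
      Complex.ofReal_one]
  · simp only [f.zero_of_le_dist (by simpa using hu : f.rOut ≤ dist u 0), Complex.ofReal_zero]

theorem contDiff_fourierL1 {f : ℝ → ℂ} (hf : Integrable f)
    (hd : ∀ n : ℕ, Integrable fun t : ℝ => ‖t‖ ^ n * ‖f t‖) :
    ContDiff ℝ ∞ (fourierL1 (hf.toL1 f)) := by
  have h1 : ContDiff ℝ ∞ (𝓕 f) := Real.contDiff_fourier (N := ⊤) fun n _ => hd n
  have h2 : fourierL1 (hf.toL1 f) = fun u => 𝓕 f (u / (2 * Real.pi)) := by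
    ext u
    rw [fourierL1_toL1, Real.fourier_real_eq_integral_exp_smul]
    congr 1
    ext t
    rw [smul_eq_mul, mul_comm]
    congr 2
    push_cast
    field_simp
  rw [h2]
  exact h1.comp (by fun_prop)

/-- A function whose Fourier transform is smooth and supported away from `(-∞, 0]` becomes band
limited when it is convolved with an approximate identity that has compactly supported Fourier
transform. -/
theorem mem_closure_bandLimited_of_contDiff {g : LOne ℂ} (hg : ContDiff ℝ ∞ (fourierL1 g))
    {ε : ℝ} (hε : 0 < ε) (h0 : ∀ u ≤ ε, fourierL1 g u = 0) : g ∈ closure bandLimited := by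
  obtain ⟨η, hη, hηc, hη1, -⟩ := exists_cutoff
  obtain ⟨-, k, -, hk, -⟩ := exists_fourierL1_eq hη hηc
  have hk1 : ∫ s, k s = 1 := by
    have h1 := hk 0
    rw [hη1 0 (by simp), fourierL1] at h1
    simpa using h1
  have hlim := tendsto_dilConv k g (tendsto_one_div_add_atTop_nhds_zero_nat (𝕜 := ℝ))
  rw [hk1, one_smul] at hlim
  refine mem_closure_of_tendsto hlim (Eventually.of_forall fun n => ?_)
  set c : ℝ := 1 / ((n : ℝ) + 1) with hc
  have hc0 : c ≠ 0 := by positivity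
  have hF : fourierL1 (dilConv k c g) = fun u => η (c * u) * fourierL1 g u := by
    ext u
    rw [fourierL1_dilConv, hk]
  refine ⟨?_, ?_, ?_⟩
  · rw [hF]
    exact (hη.comp (by fun_prop)).mul hg
  · rw [hF]
    exact (hηc.comp_homeomorph (Homeomorph.mulLeft₀ _ hc0)).mul_right
  · rw [hF]
    have h1 : tsupport (fun u => η (c * u) * fourierL1 g u) ⊆ Set.Ici ε := by
      refine closure_minimal (fun u hu => ?_) isClosed_Ici
      by_contra h
      exact hu (by simp only [h0 u (not_le.1 h).le, mul_zero])
    exact h1.trans fun u hu => hε.trans_le hu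

/-- Multiplication by `ψ(t / m)`, where `ψ` is the Fourier transform of a test function of integral
one on `[-3, -1]`, moves the Fourier transform of `h ∈ H^1(ℝ)` into `[1 / m, ∞)` and makes it
smooth. -/
theorem hardyOne_subset_closure_bandLimited : (hardyOne : Set (LOne ℂ)) ⊆ closure bandLimited := by
  intro h hh
  let b : ContDiffBump (-2 : ℝ) := ⟨1 / 2, 1, by norm_num, by norm_num⟩
  let χ : ℝ → ℂ := fun v => (b.normed volume v : ℂ)
  have hχ0 (v : ℝ) (hv : -1 ≤ v) : χ v = 0 := by
    have : v ∉ Function.support (b.normed volume) := by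
      rw [b.support_normed_eq, Metric.mem_ball, Real.dist_eq, not_lt]
      have hr : b.rOut = 1 := rfl
      rw [hr, sub_neg_eq_add, abs_of_nonneg (by linarith)]
      linarith
    simp only [χ, Function.notMem_support.1 this, Complex.ofReal_zero]
  have hχd : ContDiff ℝ ∞ χ := Complex.ofRealCLM.contDiff.comp b.contDiff_normed
  have hχc : HasCompactSupport χ :=
    b.hasCompactSupport_normed.comp_left (g := Complex.ofReal) (by simp)
  have hχi : Integrable χ := hχd.continuous.integrable_of_hasCompactSupport hχc
  have hχ1 : ∫ v, χ v = 1 := by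
    simp only [χ]
    rw [integral_complex_ofReal, b.integral_normed, Complex.ofReal_one]
  obtain ⟨ψ, -, hψ⟩ := exists_schwartz_fourier (θ := fun u => (2 * Real.pi : ℂ) * χ (-u))
    (contDiff_const.mul (hχd.comp contDiff_neg))
    ((hχc.comp_homeomorph (Homeomorph.neg ℝ)).mul_left)
  have hψ' (t : ℝ) : ψ t = ∫ v, χ v * Complex.exp (-(Complex.I * t * v)) := by
    rw [hψ, ← integral_neg_eq_self, ← integral_const_mul]
    congr 1
    ext v
    have hpi : (Real.pi : ℂ) ≠ 0 := by exact_mod_cast Real.pi_ne_zero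
    rw [neg_neg]
    push_cast
    field_simp
  have hψ0 : ψ 0 = 1 := by rw [hψ', ← hχ1]; simp
  obtain ⟨C, hC⟩ : ∃ C, ∀ t, ‖ψ t‖ ≤ C := ⟨_, fun t => norm_le_seminorm ℝ ψ t⟩
  have hm (m : ℕ) : (0 : ℝ) < (m : ℝ) + 1 := by positivity
  have hψc (m : ℕ) : Continuous fun t : ℝ => ψ (t / ((m : ℝ) + 1)) :=
    ψ.continuous.comp (by fun_prop)
  have hint (m : ℕ) : Integrable fun t : ℝ => ψ (t / ((m : ℝ) + 1)) * h t :=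
    (L1.integrable_coeFn h).bdd_mul (hψc m).aestronglyMeasurable (ae_of_all _ fun t => hC _)
  have hlim : Tendsto (fun m => (hint m).toL1 _) atTop (𝓝 h) := by
    rw [tendsto_iff_norm_sub_tendsto_zero]
    have h1 (m : ℕ) : ‖(hint m).toL1 _ - h‖ = ∫ t, ‖ψ (t / ((m : ℝ) + 1)) * h t - h t‖ := by
      rw [L1.norm_eq_integral_norm]
      refine integral_congr_ae ?_
      filter_upwards [(hint m).coeFn_toL1, Lp.coeFn_sub ((hint m).toL1 _) h] with t h2 h3
      rw [h3, Pi.sub_apply, h2]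
    simp_rw [h1]
    rw [← integral_zero ℝ ℝ]
    refine tendsto_integral_of_dominated_convergence (fun t => C * ‖h t‖ + ‖h t‖)
      (fun m => ((hint m).sub (L1.integrable_coeFn h)).norm.aestronglyMeasurable)
      (((L1.integrable_coeFn h).norm.const_mul C).add (L1.integrable_coeFn h).norm)
      (fun m => ae_of_all _ fun t => ?_) (ae_of_all _ fun t => ?_)
    · rw [norm_norm]
      refine (norm_sub_le _ _).trans ?_
      rw [norm_mul]
      gcongr
      exact hC _
    · have h2 : Tendsto (fun m : ℕ => t / ((m : ℝ) + 1)) atTop (𝓝 0) := by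
        simpa [div_eq_mul_inv] using
          (tendsto_one_div_add_atTop_nhds_zero_nat (𝕜 := ℝ)).const_mul t
      have h3 := (((ψ.continuous.tendsto 0).comp h2).mul_const (h t)).sub_const (h t)
      rw [hψ0, one_mul, sub_self] at h3
      simpa using h3.norm
  refine isClosed_closure.mem_of_tendsto hlim (Eventually.of_forall fun m => ?_)
  refine mem_closure_bandLimited_of_contDiff (contDiff_fourierL1 (hint m) fun n => ?_)
    (ε := 1 / ((m : ℝ) + 1)) (by positivity) fun u hu => ?_
  · have h1 := (L1.integrable_coeFn h).norm.bdd_mul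
      (f := fun t : ℝ => ‖t‖ ^ n * ‖ψ (t / ((m : ℝ) + 1))‖)
      (c := ((m : ℝ) + 1) ^ n * SchwartzMap.seminorm ℝ n 0 ψ)
      (Continuous.aestronglyMeasurable ((continuous_norm.pow n).mul (hψc m).norm))
      (ae_of_all _ fun t => ?_)
    · refine h1.congr (ae_of_all _ fun t => ?_)
      simp only [norm_mul, mul_assoc]
    · have h2 := norm_pow_mul_le_seminorm ℝ ψ n (t / ((m : ℝ) + 1))
      rw [norm_mul, norm_norm, norm_pow, norm_norm]
      rw [norm_div, div_pow, Real.norm_of_nonneg (hm m).le, div_mul_eq_mul_div,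
        div_le_iff₀ (by have := hm m; positivity)] at h2
      linarith
  · -- `ψ(t / m) e^{-itu}` is the Fourier transform of a dilated translate of `χ`.
    rw [fourierL1_toL1]
    let M : ℝ := (m : ℝ) + 1
    have hM : 0 < M := hm m
    let θ : ℝ → ℂ := fun w => (M : ℂ) * χ (M * (w - u))
    have hθ : Integrable θ := ((hχi.comp_mul_left' hM.ne').comp_sub_right u).const_mul (M : ℂ)
    have h1 (t : ℝ) : ψ (t / M) * h t * Complex.exp (-(Complex.I * t * u)) =
        h t * ∫ w, θ w * Complex.exp (-(Complex.I * t * w)) := by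
      have h2 : ∫ w, θ w * Complex.exp (-(Complex.I * t * w)) =
          ψ (t / M) * Complex.exp (-(Complex.I * t * u)) := by
        have h4 := integral_sub_right_eq_self (fun w : ℝ => (M : ℂ) *
          (χ (M * w) * Complex.exp (-(Complex.I * t * (((M * w : ℝ) : ℂ) / M + u))))) (μ := volume) u
        have hMc : (M : ℂ) ≠ 0 := by exact_mod_cast hM.ne'
        have h3 : ∫ w : ℝ, (M : ℂ) *
            (χ (M * w) * Complex.exp (-(Complex.I * t * (((M * w : ℝ) : ℂ) / M + u)))) =
            ∫ v : ℝ, χ v * Complex.exp (-(Complex.I * t * (v / M + u))) := by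
          rw [Measure.integral_comp_mul_left (fun v : ℝ => (M : ℂ) *
            (χ v * Complex.exp (-(Complex.I * t * (v / M + u))))) M, integral_const_mul,
            abs_of_pos (inv_pos.2 hM), Complex.real_smul, Complex.ofReal_inv,
            inv_mul_cancel_left₀ hMc]
        rw [h3] at h4
        rw [hψ', ← integral_mul_const]
        calc _ = _ := ?_
          _ = _ := h4
          _ = _ := ?_
        · congr 1
          ext w
          simp only [θ, mul_assoc]
          congr 4
          push_cast
          field_simp
          ring
        · congr 1
          ext v
          rw [mul_assoc (χ v), ← Complex.exp_add]
          congr 2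
          push_cast
          ring
      rw [h2]
      ring
    change ∫ t, ψ (t / M) * h t * Complex.exp (-(Complex.I * t * u)) = 0
    simp_rw [h1]
    rw [integral_mul_fourier h hθ]
    refine integral_eq_zero_of_ae (ae_of_all _ fun w => ?_)
    rw [Pi.zero_apply]
    rcases le_or_gt w 0 with hw | hw
    · simp only [hh w hw, zero_mul]
    · have h5 : -1 ≤ M * (w - u) := by
        have h6 : M * u ≤ 1 := by
          have := mul_le_mul_of_nonneg_left hu hM.le
          rwa [mul_one_div_cancel hM.ne'] at this
        nlinarith
      simp only [θ, hχ0 _ h5, mul_zero]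

end Band

/-! ### Vector valued Hardy spaces -/

section Vector

variable {Z : Type*} [NormedAddCommGroup Z] [NormedSpace ℂ Z]

theorem isClosed_hardyOneVec : IsClosed (hardyOneVec Z : Set (LOne Z)) :=
  Submodule.isClosed_topologicalClosure _

instance [CompleteSpace Z] : CompleteSpace (hardyOneVec Z) :=
  isClosed_hardyOneVec.completeSpace_coe

theorem tensorL1_mem_hardyOneVec {g : LOne ℂ} (hg : g ∈ hardyOne) (z : Z) :
    tensorL1 g z ∈ hardyOneVec Z := (hardyTensor ⟨g, hg⟩ z).2

/-- Band limited elementary tensors generate `H^1(ℝ; Z)`. -/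
theorem hardyOneVec_le {P : Submodule ℂ (LOne Z)} (hc : IsClosed (P : Set (LOne Z)))
    (hP : ∀ g ∈ bandLimited, ∀ z : Z, tensorL1 g z ∈ P) : hardyOneVec Z ≤ P := by
  refine Submodule.topologicalClosure_minimal _ (Submodule.span_le.2 ?_) hc
  rintro _ ⟨h, hh, z, rfl⟩
  have h1 : closure bandLimited ⊆ {g | tensorCLM z g ∈ P} :=
    closure_minimal (fun g hg => hP g hg z) (hc.preimage (tensorCLM z).continuous)
  exact h1 (hardyOne_subset_closure_bandLimited hh)

/-- Density of the elementary tensors `g ⊗ z` with `g` band limited: a closed subspace of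
`hardyOneVec Z` containing all of them is everything. -/
theorem mem_of_hardyTensor_mem {P : Submodule ℂ (hardyOneVec Z)}
    (hc : IsClosed (P : Set (hardyOneVec Z)))
    (hP : ∀ g : hardyOne, g.1 ∈ bandLimited → ∀ z : Z, hardyTensor g z ∈ P) (h : hardyOneVec Z) :
    h ∈ P := by
  have hPc : IsClosed ((P.map (hardyOneVec Z).subtype : Submodule ℂ (LOne Z)) : Set (LOne Z)) :=
    isClosed_hardyOneVec.isClosedEmbedding_subtypeVal.isClosedMap _ hc
  obtain ⟨h', hh', he⟩ := hardyOneVec_le hPc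
    (fun g hg z => ⟨_, hP ⟨g, bandLimited_subset_hardyOne hg⟩ hg z, rfl⟩) h.2
  rwa [show h = h' from Subtype.ext he.symm]

theorem shift_mem_hardyOneVec (s : ℝ) (h : LOne Z) (hh : h ∈ hardyOneVec Z) :
    shift s h ∈ hardyOneVec Z := by
  refine hardyOneVec_le (P := (hardyOneVec Z).comap (shift s).toLinearMap)
    (isClosed_hardyOneVec.preimage (shift s).continuous) (fun g hg z => ?_) hh
  change shift s (tensorL1 g z) ∈ hardyOneVec Z
  rw [shift_tensorL1]
  exact tensorL1_mem_hardyOneVec (shift_mem_hardyOne s g (bandLimited_subset_hardyOne hg)) z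

theorem tensorL1_scalar (g : LOne ℂ) (z : ℂ) : tensorL1 g z = z • g := by
  refine Lp.ext ?_
  filter_upwards [coeFn_tensorL1 g z, Lp.coeFn_smul z g] with t h1 h2
  rw [h1, h2, Pi.smul_apply, smul_eq_mul, smul_eq_mul, mul_comm]

theorem hardyOneVec_scalar : hardyOneVec ℂ = hardyOne := by
  refine le_antisymm (hardyOneVec_le isClosed_hardyOne fun g hg z => ?_) fun g hg => ?_
  · rw [tensorL1_scalar]
    exact Submodule.smul_mem _ _ (bandLimited_subset_hardyOne hg)
  · have := tensorL1_mem_hardyOneVec hg (1 : ℂ)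
    rwa [tensorL1_scalar, one_smul] at this

end Vector

/-! ### The duality between `C_0(ℝ; X)` and `L^1(ℝ; Z)` -/

section Dual

variable {X Z : Type*} [NormedAddCommGroup X] [NormedSpace ℂ X]
  [NormedAddCommGroup Z] [NormedSpace ℂ Z]

theorem c0_norm_apply_le (f : C₀(ℝ, X)) (t : ℝ) : ‖f t‖ ≤ ‖f‖ := f.toBCF.norm_coe_le_norm t

theorem c0_norm_le {f : C₀(ℝ, X)} {C : ℝ} (hC : 0 ≤ C) (h : ∀ t, ‖f t‖ ≤ C) : ‖f‖ ≤ C :=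
  (BoundedContinuousFunction.norm_le (f := f.toBCF) hC).2 h

variable (β : X →L[ℂ] Z →L[ℂ] ℂ)

theorem integrable_dual (f : C₀(ℝ, X)) (h : LOne Z) : Integrable fun t => β (f (-t)) (h t) := by
  refine ((L1.integrable_coeFn h).norm.const_mul (‖β‖ * ‖f‖)).mono'
    (β.aestronglyMeasurable_comp₂ (f.continuous.comp continuous_neg).aestronglyMeasurable
      (Lp.aestronglyMeasurable h)) (ae_of_all _ fun t => (β.le_opNorm₂ _ _).trans ?_)
  gcongr
  exact c0_norm_apply_le f _

/-- The duality `(f, h) ↦ ⟨h, f⟩` as a bounded bilinear map. -/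
def dualCLM : C₀(ℝ, X) →L[ℂ] LOne Z →L[ℂ] ℂ :=
  LinearMap.mkContinuous₂
    (LinearMap.mk₂ ℂ (dualPair β)
      (fun f g h => by
        unfold dualPair
        rw [← integral_add (integrable_dual β f h) (integrable_dual β g h)]
        refine integral_congr_ae (ae_of_all _ fun t => ?_)
        simp)
      (fun c f h => by
        unfold dualPair
        rw [← integral_smul]
        refine integral_congr_ae (ae_of_all _ fun t => ?_)
        simp)
      (fun f h g => by
        unfold dualPair
        rw [← integral_add (integrable_dual β f h) (integrable_dual β f g)]
        refine integral_congr_ae ?_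
        filter_upwards [Lp.coeFn_add h g] with t ht
        rw [ht, Pi.add_apply, map_add])
      (fun c f h => by
        unfold dualPair
        rw [← integral_smul]
        refine integral_congr_ae ?_
        filter_upwards [Lp.coeFn_smul c h] with t ht
        rw [ht, Pi.smul_apply, map_smul]))
    ‖β‖ (fun f h => by
      rw [LinearMap.mk₂_apply]
      refine (norm_integral_le_integral_norm _).trans ?_
      rw [L1.norm_eq_integral_norm, ← integral_const_mul]
      refine integral_mono (integrable_dual β f h).norm
        ((L1.integrable_coeFn h).norm.const_mul _) fun t => (β.le_opNorm₂ _ _).trans ?_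
      gcongr
      exact c0_norm_apply_le f _)

theorem dualCLM_apply (f : C₀(ℝ, X)) (h : LOne Z) : dualCLM β f h = dualPair β f h := rfl

theorem norm_dualCLM_le : ‖dualCLM β‖ ≤ ‖β‖ := LinearMap.mkContinuous₂_norm_le _ β.opNorm_nonneg _

theorem norm_dualPair_le (hβ : ‖β‖ ≤ 1) (f : C₀(ℝ, X)) (h : LOne Z) :
    ‖dualPair β f h‖ ≤ ‖f‖ * ‖h‖ := by
  refine ((dualCLM β).le_opNorm₂ f h).trans ?_
  rw [mul_assoc]
  exact mul_le_of_le_one_left (by positivity) ((norm_dualCLM_le β).trans hβ)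

/-- Convolutions are coefficients of the translation group. -/
theorem convPair_eq_dualPair (f : C₀(ℝ, X)) (h : LOne Z) (s : ℝ) :
    convPair β f h s = dualPair β f (shift (-s) h) := by
  unfold convPair dualPair
  rw [← integral_neg_eq_self]
  refine integral_congr_ae ?_
  filter_upwards [coeFn_shift (-s) h] with t ht
  rw [ht]
  congr 2
  ring

/-- The translation `(τ_s f)(t) = f(t - s)` on `C_0(ℝ; X)`. -/
def c0Shift (s : ℝ) (f : C₀(ℝ, X)) : C₀(ℝ, X) where
  toFun t := f (t - s)
  continuous_toFun := f.continuous.comp (continuous_id.sub continuous_const)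
  zero_at_infty' :=
    (zero_at_infty f).comp (Homeomorph.subRight s).isClosedEmbedding.tendsto_cocompact

theorem c0Shift_apply (s : ℝ) (f : C₀(ℝ, X)) (t : ℝ) : c0Shift s f t = f (t - s) := rfl

theorem continuous_c0Shift (f : C₀(ℝ, X)) : Continuous fun s => c0Shift s f := by
  have hu : UniformContinuous f := ZeroAtInftyContinuousMap.uniformContinuous f
  rw [Metric.continuous_iff]
  intro s ε hε
  obtain ⟨δ, hδ, h⟩ := Metric.uniformContinuous_iff.1 hu (ε / 2) (half_pos hε)
  refine ⟨δ, hδ, fun r hr => ?_⟩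
  rw [dist_eq_norm]
  refine (c0_norm_le (half_pos hε).le fun t => ?_).trans_lt (half_lt_self hε)
  rw [ZeroAtInftyContinuousMap.sub_apply, ← dist_eq_norm]
  refine (h ?_).le
  rwa [dist_sub_left]

theorem dualPair_c0Shift (s : ℝ) (f : C₀(ℝ, X)) (h : LOne Z) :
    dualPair β (c0Shift s f) h = dualPair β f (shift s h) := by
  unfold dualPair
  rw [← integral_sub_right_eq_self _ s]
  refine integral_congr_ae ?_
  filter_upwards [coeFn_shift s h] with t ht
  rw [ht, c0Shift_apply]
  congr 3
  ring

/-- A trapezoidal cutoff function, equal to one on `[-R, R]` and to zero outside `[-R-1, R+1]`. -/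
def ramp (R t : ℝ) : ℝ := max 0 (min 1 (R + 1 - |t|))

theorem continuous_ramp (R : ℝ) : Continuous (ramp R) := by unfold ramp; fun_prop

theorem ramp_nonneg (R t : ℝ) : 0 ≤ ramp R t := le_max_left _ _

theorem ramp_le_one (R t : ℝ) : ramp R t ≤ 1 := max_le zero_le_one (min_le_left _ _)

theorem ramp_eq_one {R t : ℝ} (h : |t| ≤ R) : ramp R t = 1 := by
  unfold ramp
  rw [min_eq_left (by linarith), max_eq_right zero_le_one]

theorem ramp_eq_zero {R t : ℝ} (h : R + 1 ≤ |t|) : ramp R t = 0 :=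
  max_eq_left ((min_le_right _ _).trans (by linarith))

theorem hasCompactSupport_ramp (R : ℝ) : HasCompactSupport (ramp R) :=
  HasCompactSupport.intro (isCompact_Icc (a := -(R + 1)) (b := R + 1)) fun _ ht =>
    ramp_eq_zero (le_of_not_ge fun h => ht (abs_le.1 h))

/-- The product of a continuous function with a cutoff function, as an element of `C_0(ℝ; X)`. -/
def rampMul (R : ℝ) (g : C(ℝ, X)) : C₀(ℝ, X) where
  toFun t := (ramp R t : ℂ) • g t
  continuous_toFun := (Complex.continuous_ofReal.comp (continuous_ramp R)).smul g.continuous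
  zero_at_infty' := HasCompactSupport.is_zero_at_infty
    (((hasCompactSupport_ramp R).comp_left (g := Complex.ofReal) (by simp)).smul_right)

theorem rampMul_apply (R : ℝ) (g : C(ℝ, X)) (t : ℝ) : rampMul R g t = (ramp R t : ℂ) • g t := rfl

theorem norm_rampMul_le {g : C(ℝ, X)} {C : ℝ} (hC : 0 ≤ C) (hg : ∀ t, ‖g t‖ ≤ C) (R : ℝ) :
    ‖rampMul R g‖ ≤ C := by
  refine c0_norm_le hC fun t => ?_
  rw [rampMul_apply, norm_smul, Complex.norm_real, Real.norm_of_nonneg (ramp_nonneg R t)]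
  exact (mul_le_of_le_one_left (norm_nonneg _) (ramp_le_one R t)).trans (hg t)

/-- The unit ball of `C_0(ℝ; X)` computes the norm of `L^1(ℝ; Z)`: for a continuous `v` with compact
support, the sets `{x : ‖x‖ ≤ 1, ‖v(t)‖ - δ(t) ≤ Re β(x, v(t))}` are convex and a point of one of them
stays in the neighbouring ones, so there is a continuous selection. -/
theorem norm_le_of_dualPair_le {β : X →L[ℂ] Z →L[ℂ] ℂ} (h1 : ‖β‖ ≤ 1) (hβ : IsNorming β)
    {w : LOne Z} {C : ℝ} (hC0 : 0 ≤ C) (hC : ∀ f : C₀(ℝ, X), ‖dualPair β f w‖ ≤ C * ‖f‖) :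
    ‖w‖ ≤ C := by
  have key (ε : ℝ) (hε : 0 < ε) : ‖w‖ ≤ C + ε * (2 + Real.pi) := by
    obtain ⟨v, hvc, hvw, hv, hvi⟩ :=
      (L1.integrable_coeFn w).exists_hasCompactSupport_integral_sub_le hε
    obtain ⟨g, hg⟩ := exists_continuous_forall_mem_convex_of_local_const
      (t := fun t : ℝ => {x : X | ‖x‖ ≤ 1 ∧ ‖v t‖ - ε * (1 + t ^ 2)⁻¹ ≤ (β x (v t)).re})
      (fun t => by
        refine Convex.inter (s := {x : X | ‖x‖ ≤ 1}) ?_ ?_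
        · simpa [Metric.closedBall, dist_zero_right] using convex_closedBall (0 : X) 1
        · exact convex_halfSpace_ge (f := fun x : X => (β x (v t)).re)
            ⟨fun x y => by simp, fun c x => by simp⟩ _)
      (fun t => by
        obtain ⟨x, hx, hxt⟩ := hβ (v t) (ε * (1 + t ^ 2)⁻¹) (by positivity)
        have h2 : Continuous fun s : ℝ => (β x (v s)).re - (‖v s‖ - ε * (1 + s ^ 2)⁻¹) := by
          refine ((Complex.continuous_re.comp ((β x).continuous.comp hv))).sub
            (hv.norm.sub (continuous_const.mul (Continuous.inv₀ (by fun_prop) fun s => ?_)))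
          positivity
        refine ⟨x, ?_⟩
        filter_upwards [(h2.tendsto t).eventually (lt_mem_nhds (sub_pos.2 hxt))] with s hs
        exact ⟨hx, (sub_pos.1 hs).le⟩)
    obtain ⟨R, hR⟩ := hvc.isCompact.isBounded.subset_closedBall 0
    have hvR (t : ℝ) (ht : R < |t|) : v t = 0 := by
      refine image_eq_zero_of_notMem_tsupport fun h => ?_
      have := hR h
      rw [mem_closedBall_zero_iff, Real.norm_eq_abs] at this
      linarith
    let f : C₀(ℝ, X) := rampMul R (g.comp ⟨fun t => -t, continuous_neg⟩)
    have hf1 : ‖f‖ ≤ 1 := norm_rampMul_le zero_le_one (fun t => (hg (-t)).1) R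
    have hft (t : ℝ) : β (f (-t)) (v t) = β (g t) (v t) := by
      rcases le_or_gt |t| R with h | h
      · simp only [f, rampMul_apply]
        rw [ramp_eq_one (by rwa [abs_neg]), Complex.ofReal_one, one_smul]
        simp
      · rw [hvR t h, map_zero, map_zero]
    have hvn : ‖hvi.toL1 v‖ = ∫ t, ‖v t‖ := by
      rw [L1.norm_eq_integral_norm]
      refine integral_congr_ae ?_
      filter_upwards [hvi.coeFn_toL1] with t ht
      rw [ht]
    have hwv : ‖w - hvi.toL1 v‖ ≤ ε := by
      rw [L1.norm_eq_integral_norm]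
      refine (le_of_eq (integral_congr_ae ?_)).trans hvw
      filter_upwards [hvi.coeFn_toL1, Lp.coeFn_sub w (hvi.toL1 v)] with t ht ht'
      rw [ht', Pi.sub_apply, ht]
    have hfv : dualPair β f (hvi.toL1 v) = ∫ t, β (g t) (v t) := by
      refine integral_congr_ae ?_
      filter_upwards [hvi.coeFn_toL1] with t ht
      rw [ht, hft]
    have hgi : Integrable fun t => β (g t) (v t) := by
      refine (integrable_dual β f (hvi.toL1 v)).congr ?_
      filter_upwards [hvi.coeFn_toL1] with t ht
      rw [ht, hft]
    have hlow : ‖hvi.toL1 v‖ - ε * Real.pi ≤ ‖dualPair β f (hvi.toL1 v)‖ := by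
      rw [hvn, ← integral_univ_inv_one_add_sq, ← integral_const_mul,
        ← integral_sub hvi.norm (integrable_inv_one_add_sq.const_mul ε), hfv]
      refine le_trans ?_ (Complex.re_le_norm _)
      have h3 : (∫ t, β (g t) (v t)).re = ∫ t, (β (g t) (v t)).re :=
        (integral_re hgi).symm
      rw [h3]
      exact integral_mono (hvi.norm.sub (integrable_inv_one_add_sq.const_mul ε)) hgi.re
        fun t => (hg t).2
    have hup : ‖dualPair β f (hvi.toL1 v)‖ ≤ C + ε := by
      have h4 : dualPair β f (hvi.toL1 v) = dualPair β f w - dualPair β f (w - hvi.toL1 v) := by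
        simp only [← dualCLM_apply, map_sub, sub_sub_cancel]
      rw [h4]
      refine (norm_sub_le _ _).trans (add_le_add ?_ ?_)
      · exact (hC f).trans (mul_le_of_le_one_right hC0 hf1)
      · exact ((norm_dualPair_le β h1 f _).trans
          (mul_le_of_le_one_left (norm_nonneg _) hf1)).trans hwv
    have h5 := norm_le_norm_add_norm_sub (hvi.toL1 v) w
    rw [norm_sub_rev] at h5
    linarith
  refine le_of_forall_pos_le_add fun ε hε => ?_
  have hp : 0 < 2 + Real.pi := by positivity
  have := key (ε / (2 + Real.pi)) (by positivity)
  rwa [div_mul_cancel₀ _ hp.ne'] at this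

theorem dualPair_injective {β : X →L[ℂ] Z →L[ℂ] ℂ} (h1 : ‖β‖ ≤ 1) (hβ : IsNorming β)
    {w w' : LOne Z} (h : ∀ f : C₀(ℝ, X), dualPair β f w = dualPair β f w') : w = w' := by
  refine sub_eq_zero.1 (norm_le_zero_iff.1 (norm_le_of_dualPair_le h1 hβ le_rfl fun f => ?_))
  rw [← dualCLM_apply, map_sub, dualCLM_apply, dualCLM_apply, h, sub_self, norm_zero, zero_mul]

theorem dualPair_tensorL1 (β : X →L[ℂ] Z →L[ℂ] ℂ) (f : C₀(ℝ, X)) (g : LOne ℂ) (z : Z) :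
    dualPair β f (tensorL1 g z) = ∫ t, β (f (-t)) z * g t := by
  refine integral_congr_ae ?_
  filter_upwards [coeFn_tensorL1 g z] with t ht
  rw [ht, map_smul, smul_eq_mul, mul_comm]

end Dual

/-! ### Functions in `Z_0` annihilate the Hardy space -/

section Annihilator

variable {X Z : Type*} [NormedAddCommGroup X] [NormedSpace ℂ X]
  [NormedAddCommGroup Z] [NormedSpace ℂ Z]

theorem integral_Z0_mul_bandLimited {z : C₀(ℝ, ℂ)} (hz : z ∈ Z0) {g : LOne ℂ}
    (hg : g ∈ bandLimited) : ∫ t, z (-t) * g t = 0 := by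
  obtain ⟨κ, k, hkκ, hk, hκ⟩ := exists_fourierL1_eq hg.1 hg.2.1
  have hgk : g = k := fourierL1_injective (ae_of_all _ fun u => (hk u).symm)
  have h1 := hz.2 (fun u => (2 * Real.pi : ℂ)⁻¹ * fourierL1 g (-u))
    (contDiff_const.mul (hg.1.comp contDiff_neg))
    ((hg.2.1.comp_homeomorph (Homeomorph.neg ℝ)).mul_left) ?_
  · rw [← h1]
    refine integral_congr_ae ?_
    filter_upwards [hkκ] with t ht
    rw [hgk, ht, hκ, ← hgk, ← integral_neg_eq_self, ← integral_const_mul]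
    congr 2
    ext u
    have h2 : Complex.I * t * ((-u : ℝ) : ℂ) = -(Complex.I * t * u) := by push_cast; ring
    rw [h2]
    ring
  · have h2 : tsupport (fun u => (2 * Real.pi : ℂ)⁻¹ * fourierL1 g (-u)) ⊆
        (fun u : ℝ => -u) ⁻¹' tsupport (fourierL1 g) := by
      refine closure_minimal (fun u hu => subset_tsupport _ fun h => hu ?_)
        ((isClosed_tsupport _).preimage continuous_neg)
      simp only [h, mul_zero]
    intro u hu
    have h3 : 0 < -u := hg.2.2 (h2 hu)
    exact neg_pos.1 h3

theorem dualPair_eq_zero_of_mem_Z0Tensor (β : X →L[ℂ] Z →L[ℂ] ℂ) {f : C₀(ℝ, X)}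
    (hf : f ∈ Z0Tensor X) {h : LOne Z} (hh : h ∈ hardyOneVec Z) : dualPair β f h = 0 := by
  let P : Submodule ℂ C₀(ℝ, X) := LinearMap.ker ((dualCLM β).flip h : C₀(ℝ, X) →ₗ[ℂ] ℂ)
  suffices h1 : Z0Tensor X ≤ P from h1 hf
  refine Submodule.topologicalClosure_minimal _ (Submodule.span_le.2 ?_)
    ((dualCLM β).flip h).isClosed_ker
  rintro _ ⟨z, hz, a, rfl⟩
  refine hardyOneVec_le (P := LinearMap.ker (dualCLM β (c0Tensor z a) : LOne Z →ₗ[ℂ] ℂ))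
    (dualCLM β (c0Tensor z a)).isClosed_ker (fun g hg b => ?_) hh
  change dualPair β (c0Tensor z a) (tensorL1 g b) = 0
  rw [dualPair_tensorL1]
  have h2 (t : ℝ) : β (c0Tensor z a (-t)) b * g t = β a b * (z (-t) * g t) := by
    change β (z (-t) • a) b * g t = _
    rw [map_smul, smul_apply, smul_eq_mul]
    ring
  simp_rw [h2]
  rw [integral_const_mul, integral_Z0_mul_bandLimited hz hg, mul_zero]

end Annihilator

/-! ### Bounded maps on projective tensor products -/

section Projective

variable {X Y E : Type*} [SeminormedAddCommGroup X] [NormedSpace ℂ X]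
  [SeminormedAddCommGroup Y] [NormedSpace ℂ Y] [NormedAddCommGroup E] [NormedSpace ℂ E]

theorem norm_projTmul_le (x : X) (y : Y) : ‖(projTmul x y : ProjTensor X Y)‖ ≤ ‖x‖ * ‖y‖ := by
  unfold projTmul
  rw [UniformSpace.Completion.norm_coe]
  refine csInf_le (PreProj.costs_bddBelow _) ⟨[(x, y)], ?_, by simp⟩
  simp only [List.map_cons, List.map_nil, List.sum_singleton]

theorem PreProj.norm_map_le {L : PreProj X Y →ₗ[ℂ] E} {C : ℝ} (hC : 0 ≤ C)
    (hL : ∀ x y, ‖L (PreProj.mk x y)‖ ≤ C * (‖x‖ * ‖y‖)) (u : PreProj X Y) :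
    ‖L u‖ ≤ C * ‖u‖ := by
  have key (r : ℝ) (hr : r ∈ PreProj.costs u) : ‖L u‖ ≤ C * r := by
    obtain ⟨l, rfl, rfl⟩ := hr
    induction l with
    | nil => simp
    | cons p l ih =>
      simp only [List.map_cons, List.sum_cons, map_add, mul_add]
      exact (norm_add_le _ _).trans (add_le_add (hL _ _) ih)
  rcases hC.eq_or_lt with rfl | hC'
  · obtain ⟨r, hr⟩ := PreProj.costs_nonempty u
    simpa using key r hr
  · rw [← div_le_iff₀' hC']
    refine le_csInf (PreProj.costs_nonempty u) fun r hr => ?_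
    rw [div_le_iff₀' hC']
    exact key r hr

theorem ProjTensor.ext {T T' : ProjTensor X Y →L[ℂ] E}
    (h : ∀ x y, T (projTmul x y) = T' (projTmul x y)) : T = T' := by
  let e : PreProj X Y →ₗ[ℂ] ProjTensor X Y :=
    (UniformSpace.Completion.toComplL : PreProj X Y →L[ℂ] ProjTensor X Y)
  let R (S : ProjTensor X Y →L[ℂ] E) : PreProj X Y →ₗ[ℂ] E := (S : ProjTensor X Y →ₗ[ℂ] E).comp e
  have key : R T = R T' := TensorProduct.ext' h
  refine ContinuousLinearMap.ext fun Φ => ?_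
  exact UniformSpace.Completion.induction_on Φ (isClosed_eq T.continuous T'.continuous)
    fun u => LinearMap.congr_fun key u

theorem ProjTensor.exists_lift [CompleteSpace E] (L : PreProj X Y →ₗ[ℂ] E) {C : ℝ} (hC : 0 ≤ C)
    (hL : ∀ x y, ‖L (PreProj.mk x y)‖ ≤ C * (‖x‖ * ‖y‖)) :
    ∃ T : ProjTensor X Y →L[ℂ] E, (∀ x y, T (projTmul x y) = L (PreProj.mk x y)) ∧ ‖T‖ ≤ C := by
  let e : PreProj X Y →ₗ[ℂ] ProjTensor X Y :=
    (UniformSpace.Completion.toComplL : PreProj X Y →L[ℂ] ProjTensor X Y)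
  have he : DenseRange e := UniformSpace.Completion.denseRange_coe
  have hn (u : PreProj X Y) : ‖L u‖ ≤ C * ‖e u‖ := by
    have h1 : ‖e u‖ = ‖u‖ := UniformSpace.Completion.norm_coe u
    rw [h1]
    exact PreProj.norm_map_le hC hL u
  exact ⟨L.extendOfNorm e, fun x y => LinearMap.extendOfNorm_eq he ⟨C, hn⟩ (PreProj.mk x y),
    LinearMap.opNorm_extendOfNorm_le he hC hn⟩

end Projective

section QuotientTensor

variable {X Y E : Type*} [NormedAddCommGroup X] [NormedSpace ℂ X]
  [NormedAddCommGroup Y] [NormedSpace ℂ Y] [NormedAddCommGroup E] [NormedSpace ℂ E]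

/-- The class of `f` in the quotient by `Z_0 ⊗ X`, tensored with `y`. -/
def quotTmul (f : C₀(ℝ, X)) (y : Y) : ProjTensor (C0Quot X) Y :=
  projTmul (Submodule.Quotient.mk f : C0Quot X) y

theorem norm_quotTmul_le (f : C₀(ℝ, X)) (y : Y) : ‖quotTmul f y‖ ≤ ‖f‖ * ‖y‖ :=
  (norm_projTmul_le _ _).trans
    (mul_le_mul_of_nonneg_right (Submodule.Quotient.norm_mk_le _ f) (norm_nonneg _))

theorem quotTmul_ext {T T' : ProjTensor (C0Quot X) Y →L[ℂ] E}
    (h : ∀ f y, T (quotTmul f y) = T' (quotTmul f y)) : T = T' :=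
  ProjTensor.ext fun x y => by
    obtain ⟨f, rfl⟩ := Submodule.Quotient.mk_surjective _ x
    exact h f y

theorem exists_quotLift [CompleteSpace E] (B : C₀(ℝ, X) →ₗ[ℂ] Y →ₗ[ℂ] E) {C : ℝ} (hC : 0 ≤ C)
    (hn : ∀ f y, ‖B f y‖ ≤ C * (‖f‖ * ‖y‖)) (hB : ∀ f ∈ Z0Tensor X, ∀ y, B f y = 0) :
    ∃ T : ProjTensor (C0Quot X) Y →L[ℂ] E, (∀ f y, T (quotTmul f y) = B f y) ∧ ‖T‖ ≤ C := by
  have hB' : Z0Tensor X ≤ LinearMap.ker B := fun f hf =>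
    LinearMap.mem_ker.2 (LinearMap.ext fun y => hB f hf y)
  let L : PreProj (C0Quot X) Y →ₗ[ℂ] E := TensorProduct.lift ((Z0Tensor X).liftQ B hB')
  have hL (f : C₀(ℝ, X)) (y : Y) : L (PreProj.mk (Submodule.Quotient.mk f) y) = B f y :=
    TensorProduct.lift.tmul _ _
  have hb (x : C0Quot X) (y : Y) : ‖L (PreProj.mk x y)‖ ≤ C * (‖x‖ * ‖y‖) := by
    refine le_of_forall_pos_le_add fun ε hε => ?_
    have hp : 0 < C * ‖y‖ + 1 := by positivity
    obtain ⟨f, rfl, hf⟩ := Submodule.Quotient.norm_mk_lt x (div_pos hε hp)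
    rw [hL]
    calc ‖B f y‖ ≤ C * (‖f‖ * ‖y‖) := hn f y
      _ ≤ C * ((‖(Submodule.Quotient.mk f : C0Quot X)‖ + ε / (C * ‖y‖ + 1)) * ‖y‖) := by gcongr
      _ = C * (‖(Submodule.Quotient.mk f : C0Quot X)‖ * ‖y‖) +
          ε * ((C * ‖y‖) / (C * ‖y‖ + 1)) := by ring
      _ ≤ _ := by
        gcongr
        exact mul_le_of_le_one_right hε.le ((div_le_one hp).2 (by linarith))
  obtain ⟨T, hT, hTn⟩ := ProjTensor.exists_lift L hC hb
  exact ⟨T, fun f y => (hT _ y).trans (hL f y), hTn⟩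

end QuotientTensor

/-! ### The space of sums of convolutions -/

section Algebra

variable {X Z : Type*} [NormedAddCommGroup X] [NormedSpace ℂ X]
  [NormedAddCommGroup Z] [NormedSpace ℂ Z] {β : X →L[ℂ] Z →L[ℂ] ℂ} {V : Submodule ℂ (LOne Z)}

namespace A0Space

theorem ext {F G : A0Space β V} (h : ∀ s, toFun β V F s = toFun β V G s) : F = G :=
  Subtype.ext (funext h)

theorem toFun_conv (f : C₀(ℝ, X)) (h : V) (s : ℝ) :
    toFun β V (conv β V f h) s = dualPair β f (shift (-s) h.1) := convPair_eq_dualPair β f h.1 s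

theorem norm_le_tsum {F : A0Space β V} {f : ℕ → C₀(ℝ, X)} {h : ℕ → V}
    (hF : IsRep β V (toFun β V F) f h) : ‖F‖ ≤ ∑' k, ‖f k‖ * ‖h k‖ :=
  csInf_le ⟨0, fun _ => repCosts_nonneg⟩ ⟨f, h, hF, rfl⟩

theorem exists_isRep_lt (F : A0Space β V) {r : ℝ} (hr : ‖F‖ < r) :
    ∃ (f : ℕ → C₀(ℝ, X)) (h : ℕ → V), IsRep β V (toFun β V F) f h ∧ ∑' k, ‖f k‖ * ‖h k‖ < r := by
  obtain ⟨_, ⟨f, h, hF, rfl⟩, hlt⟩ := exists_lt_of_csInf_lt (repCosts_nonempty β V F) hr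
  exact ⟨f, h, hF, hlt⟩

theorem norm_conv_le (f : C₀(ℝ, X)) (h : V) : ‖conv β V f h‖ ≤ ‖f‖ * ‖h‖ := by
  refine csInf_le ⟨0, fun _ => repCosts_nonneg⟩
    ⟨fun k => if k = 0 then f else 0, fun k => if k = 0 then h else 0,
      ⟨summable_of_ne_finset_zero (s := {0}) fun k hk => ?_, fun s => ?_⟩, ?_⟩
  · have hk' : k ≠ 0 := by simpa using hk
    simp [hk']
  · rw [tsum_eq_single 0]
    · rfl
    · intro k hk
      simp [hk, convPair]
  · rw [tsum_eq_single 0]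
    · simp
    · intro k hk
      simp [hk]

variable (β V) in
/-- The map `(f, h) ↦ f ∗ h` as a bilinear map. -/
def convLin : C₀(ℝ, X) →ₗ[ℂ] V →ₗ[ℂ] A0Space β V :=
  LinearMap.mk₂ ℂ (conv β V)
    (fun f g h => ext fun s => by
      rw [map_add, Pi.add_apply]
      simp only [toFun_conv, ← dualCLM_apply, map_add, add_apply])
    (fun c f h => ext fun s => by
      rw [map_smul, Pi.smul_apply]
      simp only [toFun_conv, ← dualCLM_apply, map_smul, smul_apply])
    (fun f h g => ext fun s => by
      rw [map_add, Pi.add_apply]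
      simp only [toFun_conv, ← dualCLM_apply, Submodule.coe_add, map_add])
    (fun c f h => ext fun s => by
      rw [map_smul, Pi.smul_apply]
      simp only [toFun_conv, ← dualCLM_apply, Submodule.coe_smul, map_smul])

theorem convLin_apply (f : C₀(ℝ, X)) (h : V) : convLin β V f h = conv β V f h := rfl

theorem norm_toFun_le (hβ : ‖β‖ ≤ 1) (F : A0Space β V) (s : ℝ) : ‖toFun β V F s‖ ≤ ‖F‖ :=
  le_csInf (repCosts_nonempty β V F) fun _ hr =>
    (norm_le_of_repCosts hr s).trans (mul_le_of_le_one_left (repCosts_nonneg hr) hβ)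

theorem continuous_toFun (F : A0Space β V) : Continuous (toFun β V F) := by
  obtain ⟨f, h, hs, hF⟩ := F.2
  have h1 : toFun β V F = fun s => ∑' k, convPair β (f k) (h k).1 s := funext hF
  rw [h1]
  have h2 (k : ℕ) : Continuous fun s => convPair β (f k) (h k).1 s := by
    have h3 : (fun s => convPair β (f k) (h k).1 s) =
        fun s => dualCLM β (f k) (shift (-s) (h k).1) :=
      funext fun s => convPair_eq_dualPair β (f k) (h k).1 s
    rw [h3]
    exact (dualCLM β (f k)).continuous.comp ((continuous_shift _).comp continuous_neg)
  have h4 (k : ℕ) (s : ℝ) : ‖convPair β (f k) (h k).1 s‖ ≤ ‖β‖ * (‖f k‖ * ‖h k‖) :=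
    norm_convPair_le β (f k) (h k).1 s
  exact continuous_tsum h2 (hs.mul_left ‖β‖) h4

/-- Absolutely convergent sums over any countable index set define elements of the space. -/
theorem exists_sum {ι : Type*} (σ : ι ≃ ℕ) {f : ι → C₀(ℝ, X)} {h : ι → V}
    (hs : Summable fun i => ‖f i‖ * ‖h i‖) : ∃ F : A0Space β V,
      (∀ s, HasSum (fun i => convPair β (f i) (h i).1 s) (toFun β V F s)) ∧
      ‖F‖ ≤ ∑' i, ‖f i‖ * ‖h i‖ := by
  have hs' : Summable fun k => ‖f (σ.symm k)‖ * ‖h (σ.symm k)‖ := 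
    (σ.symm.summable_iff (f := fun i => ‖f i‖ * ‖h i‖)).2 hs
  have hrep : IsRep β V (fun s => ∑' k, convPair β (f (σ.symm k)) (h (σ.symm k)).1 s)
      (fun k => f (σ.symm k)) (fun k => h (σ.symm k)) := ⟨hs', fun _ => rfl⟩
  refine ⟨(⟨_, _, _, hrep⟩ : ↥(algA0 β V)), fun s => ?_, ?_⟩
  · have h1 : HasSum (fun k => convPair β (f (σ.symm k)) (h (σ.symm k)).1 s)
        (∑' k, convPair β (f (σ.symm k)) (h (σ.symm k)).1 s) :=
      (Summable.of_norm (summable_convPair hs' s)).hasSum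
    exact (σ.symm.hasSum_iff (f := fun i => convPair β (f i) (h i).1 s)).1 h1
  · refine (norm_le_tsum hrep).trans (le_of_eq ?_)
    exact σ.symm.tsum_eq (fun i => ‖f i‖ * ‖h i‖)

instance : CompleteSpace (A0Space β V) := by
  refine NormedAddCommGroup.completeSpace_of_summable_imp_tendsto fun u hu => ?_
  have hrep (n : ℕ) := exists_isRep_lt (u n) (lt_add_of_pos_right ‖u n‖
    (show (0 : ℝ) < (1 / 2) ^ n by positivity))
  choose f h hF hlt using hrep
  set b : ℕ → ℝ := fun n => ∑' k, ‖f n k‖ * ‖h n k‖ with hb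
  have hb0 (n : ℕ) : 0 ≤ b n := tsum_nonneg fun k => by positivity
  have hbs : Summable b :=
    Summable.of_nonneg_of_le hb0 (fun n => (hlt n).le) (hu.add summable_geometric_two)
  have hprod (m : ℕ) : Summable fun p : ℕ × ℕ => ‖f (p.1 + m) p.2‖ * ‖h (p.1 + m) p.2‖ := by
    rw [summable_prod_of_nonneg fun p => by positivity]
    exact ⟨fun n => (hF (n + m)).1, (summable_nat_add_iff m).2 hbs⟩
  have hG (m : ℕ) := exists_sum (β := β) Nat.pairEquiv (hprod m)
  choose G hGs hGn using hG
  have hGv (m : ℕ) (s : ℝ) : HasSum (fun n => toFun β V (u (n + m)) s) (toFun β V (G m) s) := by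
    refine (hGs m s).prod_fiberwise fun n => ?_
    rw [(hF (n + m)).2 s]
    exact (summable_convPair (hF (n + m)).1 s).of_norm.hasSum
  refine ⟨G 0, ?_⟩
  rw [tendsto_iff_norm_sub_tendsto_zero]
  have hsub (m : ℕ) : G 0 - ∑ i ∈ Finset.range m, u i = G m := by
    refine ext fun s => ?_
    rw [map_sub, map_sum, Pi.sub_apply, Finset.sum_apply, sub_eq_iff_eq_add, add_comm]
    refine (hGv 0 s).unique ?_
    exact (hasSum_nat_add_iff' (f := fun n => toFun β V (u n) s) m).1 (by simpa using hGv m s)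
  simp_rw [norm_sub_rev _ (G 0), hsub]
  refine squeeze_zero (fun _ => norm_nonneg _) (fun m => (hGn m).trans (le_of_eq ?_))
    (tendsto_sum_nat_add b)
  exact (hprod m).tsum_prod' fun n => (hF (n + m)).1

theorem hasSum_conv (hβ : ‖β‖ ≤ 1) {F : A0Space β V} {f : ℕ → C₀(ℝ, X)} {h : ℕ → V}
    (hF : IsRep β V (toFun β V F) f h) : HasSum (fun k => conv β V (f k) (h k)) F := by
  have hs : Summable fun k => conv β V (f k) (h k) :=
    Summable.of_norm_bounded hF.1 fun k => norm_conv_le _ _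
  convert hs.hasSum
  refine ext fun s => ?_
  rw [hF.2 s]
  let ev : A0Space β V →L[ℂ] ℂ := LinearMap.mkContinuous
    ((LinearMap.proj s).comp (toFun β V)) 1 fun G => by rw [one_mul]; exact norm_toFun_le hβ G s
  exact (ev.hasSum hs.hasSum).tsum_eq

/-- A functional `φ` on the space is as large as its values on the convolutions. -/
theorem norm_le_of_conv (hβ : ‖β‖ ≤ 1) {φ : StrongDual ℂ (A0Space β V)} {C : ℝ} (hC : 0 ≤ C)
    (h : ∀ f h, ‖φ (conv β V f h)‖ ≤ C * (‖f‖ * ‖h‖)) : ‖φ‖ ≤ C := by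
  refine φ.opNorm_le_bound hC fun F => le_of_forall_gt_imp_ge_of_dense fun r hr => ?_
  rcases hC.eq_or_lt with rfl | hC'
  · obtain ⟨f, g, hF⟩ := F.2
    have h1 := (φ.hasSum (hasSum_conv hβ hF)).tsum_eq
    have h2 (k : ℕ) : φ (conv β V (f k) (g k)) = 0 := by
      have := h (f k) (g k)
      rwa [zero_mul, norm_le_zero_iff] at this
    simp_rw [h2, tsum_zero] at h1
    rw [← h1, norm_zero]
    rw [zero_mul] at hr
    exact hr.le
  · obtain ⟨f, g, hF, hlt⟩ := exists_isRep_lt F (r := r / C) (by rwa [lt_div_iff₀' hC'])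
    have h1 := (φ.hasSum (hasSum_conv hβ hF)).tsum_eq
    rw [← h1]
    rw [lt_div_iff₀' hC'] at hlt
    refine (tsum_of_norm_bounded (hF.1.mul_left C).hasSum fun k => h _ _).trans ?_
    rw [tsum_mul_left]
    exact hlt.le

end A0Space

end Algebra

/-! ### The quotient map onto the algebra and the embedding of operators -/

section Predual

variable {X Z : Type*} [NormedAddCommGroup X] [NormedSpace ℂ X]
  [NormedAddCommGroup Z] [NormedSpace ℂ Z] [CompleteSpace Z] {β : X →L[ℂ] Z →L[ℂ] ℂ}

/-- The map `f ⊗ h ↦ f ∗ h` is well defined on the quotient because `Z_0 ⊗ X` annihilates the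
translation invariant space `H^1(ℝ; Z)`. -/
theorem exists_convQuotientMap (hβ : ‖β‖ ≤ 1) :
    ∃ Λ : ProjTensor (C0Quot X) (hardyOneVec Z) →L[ℂ] A0Space β (hardyOneVec Z),
      (∀ f h, Λ (quotTmul f h) = A0Space.conv β (hardyOneVec Z) f h) ∧ IsBanachQuotientMap Λ := by
  obtain ⟨Λ, hΛ, hΛn⟩ := exists_quotLift (A0Space.convLin β (hardyOneVec Z)) zero_le_one
    (fun f h => by rw [one_mul]; exact A0Space.norm_conv_le f h)
    (fun f hf h => A0Space.ext fun s => by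
      rw [A0Space.convLin_apply, A0Space.toFun_conv, map_zero, Pi.zero_apply]
      exact dualPair_eq_zero_of_mem_Z0Tensor β hf (shift_mem_hardyOneVec _ _ h.2))
  refine ⟨Λ, hΛ, hΛn, fun F hF => ?_⟩
  obtain ⟨f, h, hrep, hlt⟩ := A0Space.exists_isRep_lt F hF
  have hs : Summable fun k => quotTmul (f k) (h k) :=
    Summable.of_norm_bounded hrep.1 fun k => norm_quotTmul_le _ _
  refine ⟨∑' k, quotTmul (f k) (h k), ?_, ?_⟩
  · rw [Λ.map_tsum hs]
    simp_rw [hΛ]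
    exact (A0Space.hasSum_conv hβ hrep).tsum_eq
  · exact (tsum_of_norm_bounded hrep.1.hasSum fun k => norm_quotTmul_le _ _).trans_lt hlt

theorem exists_operatorEmbedding (hβ : ‖β‖ ≤ 1) (hn : IsNorming β) :
    ∃ Θ : (hardyOneVec Z →L[ℂ] hardyOneVec Z) →ₗᵢ[ℂ]
        StrongDual ℂ (ProjTensor (C0Quot X) (hardyOneVec Z)),
      ∀ W f h, Θ W (quotTmul f h) = dualPair β f (W h).1 := by
  have key (W : hardyOneVec Z →L[ℂ] hardyOneVec Z) :
      ∃ T : StrongDual ℂ (ProjTensor (C0Quot X) (hardyOneVec Z)),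
        (∀ f h, T (quotTmul f h) = dualPair β f (W h).1) ∧ ‖T‖ ≤ ‖W‖ := by
    let B : C₀(ℝ, X) →ₗ[ℂ] hardyOneVec Z →ₗ[ℂ] ℂ :=
      LinearMap.mk₂ ℂ (fun f h => dualCLM β f (W h).1) (by simp) (by simp) (by simp) (by simp)
    refine exists_quotLift B (norm_nonneg W) (fun f h => ?_) fun f hf h =>
      dualPair_eq_zero_of_mem_Z0Tensor β hf (W h).2
    calc ‖dualPair β f (W h).1‖ ≤ ‖f‖ * ‖W h‖ := norm_dualPair_le β hβ f _
      _ ≤ ‖f‖ * (‖W‖ * ‖h‖) := by gcongr; exact W.le_opNorm h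
      _ = ‖W‖ * (‖f‖ * ‖h‖) := by ring
  choose Θ hΘ hΘn using key
  refine ⟨⟨⟨⟨Θ, fun W W' => quotTmul_ext fun f h => ?_⟩, fun c W => quotTmul_ext fun f h => ?_⟩,
    fun W => le_antisymm (hΘn W) ?_⟩, hΘ⟩
  · refine (hΘ _ f h).trans ((map_add (dualCLM β f) (W h).1 (W' h).1).trans ?_)
    exact congrArg₂ (· + ·) (hΘ W f h).symm (hΘ W' f h).symm
  · refine (hΘ _ f h).trans ((map_smul (dualCLM β f) c (W h).1).trans ?_)
    exact congrArg (c • ·) (hΘ W f h).symm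
  · refine W.opNorm_le_bound (norm_nonneg _) fun h => ?_
    refine norm_le_of_dualPair_le hβ hn (w := (W h).1) (C := ‖Θ W‖ * ‖h‖) (by positivity)
      fun f => ?_
    have h1 : ‖Θ W (quotTmul f h)‖ = ‖dualPair β f (W h).1‖ := congrArg norm (hΘ W f h)
    calc ‖dualPair β f (W h).1‖ = ‖Θ W (quotTmul f h)‖ := h1.symm
      _ ≤ ‖Θ W‖ * (‖f‖ * ‖h‖) :=
          ((Θ W).le_opNorm _).trans (by gcongr; exact norm_quotTmul_le f h)
      _ = ‖Θ W‖ * ‖h‖ * ‖f‖ := by ring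

/-- A functional on the algebra and the operator that represents it have the same norm. -/
theorem norm_eq_of_conv_eq_dualPair {V : Submodule ℂ (LOne Z)} (hβ : ‖β‖ ≤ 1) (hn : IsNorming β)
    {φ : StrongDual ℂ (A0Space β V)} {W : V →L[ℂ] V}
    (h : ∀ f h, φ (A0Space.conv β V f h) = dualPair β f (W h).1) : ‖W‖ = ‖φ‖ := by
  refine le_antisymm (W.opNorm_le_bound (norm_nonneg _) fun g => ?_)
    (A0Space.norm_le_of_conv hβ W.opNorm_nonneg fun f g => ?_)
  · refine norm_le_of_dualPair_le hβ hn (w := (W g).1) (by positivity) fun f => ?_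
    rw [← h]
    calc ‖φ (A0Space.conv β V f g)‖ ≤ ‖φ‖ * (‖f‖ * ‖g‖) :=
          (φ.le_opNorm _).trans (by gcongr; exact A0Space.norm_conv_le f g)
      _ = ‖φ‖ * ‖g‖ * ‖f‖ := by ring
  · rw [h]
    calc ‖dualPair β f (W g).1‖ ≤ ‖f‖ * ‖W g‖ := norm_dualPair_le β hβ f _
      _ ≤ ‖f‖ * (‖W‖ * ‖g‖) := by gcongr; exact W.le_opNorm g
      _ = ‖W‖ * (‖f‖ * ‖g‖) := by ring

end Predual

/-! ### Representation of bilinear forms by operators -/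

section Represent

variable {X Z : Type*} [NormedAddCommGroup X] [NormedSpace ℂ X]
  [NormedAddCommGroup Z] [NormedSpace ℂ Z] {β : X →L[ℂ] Z →L[ℂ] ℂ} {V : Submodule ℂ (LOne Z)}

/-- The vectors `h` for which the functional `Φ h` on `C_0(ℝ; X)` is given by an integrable
function. -/
def represented (β : X →L[ℂ] Z →L[ℂ] ℂ) (Φ : V →ₗ[ℂ] StrongDual ℂ C₀(ℝ, X)) : Submodule ℂ V where
  carrier := {h | ∃ w : LOne Z, ∀ f, Φ h f = dualPair β f w}
  zero_mem' := ⟨0, fun f => by rw [← dualCLM_apply, map_zero, map_zero, zero_apply]⟩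
  add_mem' := by
    rintro h g ⟨w, hw⟩ ⟨v, hv⟩
    exact ⟨w + v, fun f => by
      rw [map_add, add_apply, hw, hv, ← dualCLM_apply, ← dualCLM_apply, ← dualCLM_apply, map_add]⟩
  smul_mem' := by
    rintro c h ⟨w, hw⟩
    exact ⟨c • w, fun f => by
      rw [map_smul, smul_apply, hw, ← dualCLM_apply, ← dualCLM_apply, map_smul]⟩

variable {Φ : V →ₗ[ℂ] StrongDual ℂ C₀(ℝ, X)} {C : ℝ}

theorem norm_le_of_represents (hβ : ‖β‖ ≤ 1) (hn : IsNorming β) (hC : ∀ h, ‖Φ h‖ ≤ C * ‖h‖)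
    {h : V} {w : LOne Z} (hw : ∀ f, Φ h f = dualPair β f w) : ‖w‖ ≤ C * ‖h‖ := by
  refine norm_le_of_dualPair_le hβ hn ((Φ h).opNorm_nonneg.trans (hC h)) fun f => ?_
  rw [← hw]
  exact ((Φ h).le_opNorm f).trans (mul_le_mul_of_nonneg_right (hC h) (norm_nonneg _))

theorem continuous_apply_of_bound (hC : ∀ h, ‖Φ h‖ ≤ C * ‖h‖) (f : C₀(ℝ, X)) :
    Continuous fun h => Φ h f :=
  (LinearMap.mkContinuous ((ContinuousLinearMap.apply ℂ ℂ f : StrongDual ℂ C₀(ℝ, X) →ₗ[ℂ] ℂ).comp Φ)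
    (C * ‖f‖) fun h => ((Φ h).le_opNorm f).trans <| by
      rw [mul_right_comm]; exact mul_le_mul_of_nonneg_right (hC h) (norm_nonneg _)).continuous

/-- The graph of `h ↦ w` is closed, and the projection of it to the first factor is bounded below. -/
theorem isClosed_represented [CompleteSpace Z] [CompleteSpace V] (hβ : ‖β‖ ≤ 1) (hn : IsNorming β)
    (hC : ∀ h, ‖Φ h‖ ≤ C * ‖h‖) : IsClosed (represented β Φ : Set V) := by
  let G : Submodule ℂ (V × LOne Z) :=
    { carrier := {p | ∀ f, Φ p.1 f = dualPair β f p.2}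
      zero_mem' := fun f => by
        rw [← dualCLM_apply, Prod.fst_zero, Prod.snd_zero, map_zero, map_zero, zero_apply]
      add_mem' := fun {p q} hp hq f => by
        rw [Prod.fst_add, Prod.snd_add, map_add, add_apply, hp, hq, ← dualCLM_apply,
          ← dualCLM_apply, ← dualCLM_apply, map_add]
      smul_mem' := fun c p hp f => by
        rw [Prod.smul_fst, Prod.smul_snd, map_smul, smul_apply, hp, ← dualCLM_apply,
          ← dualCLM_apply, map_smul] }
  have hGc : IsClosed (G : Set (V × LOne Z)) := by
    have : (G : Set (V × LOne Z)) = ⋂ f : C₀(ℝ, X), {p | Φ p.1 f = dualCLM β f p.2} := by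
      ext p
      rw [Set.mem_iInter]
      rfl
    rw [this]
    exact isClosed_iInter fun f =>
      isClosed_eq ((continuous_apply_of_bound hC f).comp continuous_fst)
        ((dualCLM β f).continuous.comp continuous_snd)
  have : CompleteSpace G := hGc.completeSpace_coe
  let pr : G →L[ℂ] V := (ContinuousLinearMap.fst ℂ V (LOne Z)).comp G.subtypeL
  have hanti : AntilipschitzWith (max 1 C.toNNReal) pr := by
    refine pr.antilipschitz_of_bound fun p => ?_
    have h1 : ‖p.1.2‖ ≤ C * ‖p.1.1‖ := norm_le_of_represents hβ hn hC p.2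
    change max ‖p.1.1‖ ‖p.1.2‖ ≤ ((max 1 C.toNNReal : NNReal) : ℝ) * ‖p.1.1‖
    rw [NNReal.coe_max, NNReal.coe_one]
    refine max_le (le_mul_of_one_le_left (norm_nonneg _) (le_max_left _ _)) (h1.trans ?_)
    gcongr
    exact (Real.le_coe_toNNReal C).trans (le_max_right _ _)
  have hr := hanti.isClosed_range pr.uniformContinuous
  have heq : (represented β Φ : Set V) = Set.range pr := by
    refine Set.ext fun h => ⟨?_, ?_⟩
    · rintro ⟨w, hw⟩
      exact ⟨⟨(h, w), hw⟩, rfl⟩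
    · rintro ⟨p, rfl⟩
      exact ⟨p.1.2, p.2⟩
  rw [heq]
  exact hr

theorem exists_representing_operator (hβ : ‖β‖ ≤ 1) (hn : IsNorming β)
    (hC : ∀ h, ‖Φ h‖ ≤ C * ‖h‖) (hΦ : ∀ h, h ∈ represented β Φ) :
    ∃ T : V →L[ℂ] LOne Z, ∀ f h, Φ h f = dualPair β f (T h) := by
  choose T hT using hΦ
  refine ⟨LinearMap.mkContinuous ⟨⟨T, fun h g => ?_⟩, fun c h => ?_⟩ C fun h =>
    norm_le_of_represents hβ hn hC (hT h), fun f h => hT h f⟩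
  · refine dualPair_injective hβ hn fun f => ?_
    rw [← hT, map_add, add_apply, hT, hT, ← dualCLM_apply, ← dualCLM_apply, ← dualCLM_apply,
      map_add]
  · refine dualPair_injective hβ hn fun f => ?_
    rw [← hT, map_smul, smul_apply, hT, ← dualCLM_apply, ← dualCLM_apply, RingHom.id_apply,
      map_smul]

end Represent

/-! ### Functionals on the scalar algebra are given by integrable functions -/

section Scalar

/-- The pairing of `ℂ` with itself. -/
abbrev mulPairing : ℂ →L[ℂ] ℂ →L[ℂ] ℂ := ContinuousLinearMap.mul ℂ ℂ

theorem norm_mulPairing_le : ‖mulPairing‖ ≤ 1 := ContinuousLinearMap.opNorm_mul_le ℂ ℂ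

theorem isNorming_mulPairing : IsNorming mulPairing := by
  intro z ε hε
  rcases eq_or_ne z 0 with rfl | hz
  · exact ⟨0, by simp, by simpa using hε⟩
  · have hz' : ‖z‖ ≠ 0 := norm_ne_zero_iff.2 hz
    refine ⟨(starRingEnd ℂ) z / ‖z‖, ?_, ?_⟩
    · rw [norm_div, RCLike.norm_conj, Complex.norm_real, norm_norm, div_self hz']
    · have h1 : mulPairing ((starRingEnd ℂ) z / ‖z‖) z = (‖z‖ : ℂ) := by
        rw [ContinuousLinearMap.mul_apply', div_mul_eq_mul_div, Complex.conj_mul', sq,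
          mul_div_assoc, div_self (by exact_mod_cast hz'), mul_one]
      rw [h1, Complex.ofReal_re]
      linarith

theorem dualPair_dilConv_schwartz (f : C₀(ℝ, ℂ)) (κ : SchwartzMap ℝ ℂ) {k : LOne ℂ}
    (hk : k =ᵐ[volume] κ) (h : LOne ℂ) :
    dualPair mulPairing f (dilConv k 1 h) =
      ∫ s, f s * dualPair mulPairing κ.toZeroAtInfty (shift s h) := by
  have h1 (r : ℝ) : dualPair mulPairing f (shift (1 * r) h) = ∫ t, f (-t) * h (t - r) := by
    refine integral_congr_ae ?_
    filter_upwards [coeFn_shift (1 * r) h] with t ht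
    rw [ht, one_mul]
    rfl
  have h2 (s : ℝ) : dualPair mulPairing κ.toZeroAtInfty (shift s h) =
      ∫ r, κ r * h (-r - s) := by
    rw [← integral_neg_eq_self]
    refine integral_congr_ae ?_
    filter_upwards [coeFn_shift s h] with t ht
    rw [ht, neg_neg]
    rfl
  have h3 : Integrable (fun p : ℝ × ℝ => f (-p.1) * (κ p.2 * h (p.1 - p.2)))
      (volume.prod volume) := by
    have h4 := κ.integrable.convolution_integrand (μ := volume) (ν := volume) (ContinuousLinearMap.mul ℂ ℂ)
      (L1.integrable_coeFn h)
    refine h4.bdd_mul (c := ‖f‖)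
      (f.continuous.comp (continuous_neg.comp continuous_fst)).aestronglyMeasurable
      (ae_of_all _ fun p => c0_norm_apply_le f _)
  have h5 := map_dilConv (dualCLM mulPairing f) k 1 h
  simp only [dualCLM_apply, h1] at h5
  rw [h5]
  calc ∫ r, k r • ∫ t, f (-t) * h (t - r) = ∫ r, ∫ t, f (-t) * (κ r * h (t - r)) := by
        refine integral_congr_ae ?_
        filter_upwards [hk] with r hr
        rw [hr, smul_eq_mul, ← integral_const_mul]
        congr 1
        ext t
        ring
    _ = ∫ t, ∫ r, f (-t) * (κ r * h (t - r)) := (integral_integral_swap h3).symm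
    _ = ∫ s, f s * dualPair mulPairing κ.toZeroAtInfty (shift s h) := by
        conv_rhs => rw [← integral_neg_eq_self]
        simp_rw [h2, integral_const_mul]
        congr 1
        ext t
        congr 2
        ext r
        congr 2
        ring

theorem rampMul_tendsto {X : Type*} [NormedAddCommGroup X] [NormedSpace ℂ X] (f : C₀(ℝ, X)) :
    Tendsto (fun n : ℕ => rampMul n (f : C(ℝ, X))) atTop (𝓝 f) := by
  rw [Metric.tendsto_atTop]
  intro ε hε
  have h1 : ∀ᶠ t in cocompact ℝ, ‖f t‖ < ε / 2 := by
    have := (zero_at_infty f).norm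
    rw [norm_zero] at this
    exact this.eventually_lt_const (half_pos hε)
  rw [← Metric.cobounded_eq_cocompact, ← comap_norm_atTop, eventually_comap] at h1
  obtain ⟨R, hR⟩ := eventually_atTop.1 h1
  obtain ⟨N, hN⟩ := exists_nat_ge R
  refine ⟨N, fun n hn => ?_⟩
  rw [dist_eq_norm]
  refine (c0_norm_le (half_pos hε).le fun t => ?_).trans_lt (half_lt_self hε)
  rw [ZeroAtInftyContinuousMap.sub_apply, rampMul_apply]
  change ‖(ramp n t : ℂ) • f t - f t‖ ≤ ε / 2
  rcases le_or_gt |t| n with ht | ht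
  · rw [ramp_eq_one ht, Complex.ofReal_one, one_smul, sub_self, norm_zero]
    exact (half_pos hε).le
  · have h2 : ‖f t‖ < ε / 2 := hR ‖t‖ (by
      rw [Real.norm_eq_abs]
      exact (hN.trans (Nat.cast_le.2 hn)).trans ht.le) t rfl
    have h3 : (ramp n t : ℂ) • f t - f t = -(((1 - ramp n t : ℝ) : ℂ) • f t) := by
      push_cast
      rw [sub_smul, one_smul, neg_sub]
    rw [h3, norm_neg, norm_smul, Complex.norm_real,
      Real.norm_of_nonneg (by linarith [ramp_le_one n t])]
    exact (mul_le_of_le_one_left (norm_nonneg _) (by linarith [ramp_nonneg n t])).trans h2.le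

/-- A continuous function that integrates against compactly supported continuous functions to a
bounded functional is integrable. -/
theorem exists_dualPair_of_ramp (L : C₀(ℝ, ℂ) →L[ℂ] ℂ) {w : ℝ → ℂ} (hw : Continuous w)
    (hL : ∀ (n : ℕ) (f : C(ℝ, ℂ)), L (rampMul n f) = ∫ s, rampMul n f (-s) * w s) :
    ∃ v : LOne ℂ, ∀ f, L f = dualPair mulPairing f v := by
  have hri (n : ℕ) {g : ℝ → ℝ} (hg : Continuous g) : Integrable fun t => ramp n t * g t :=
    ((continuous_ramp n).mul hg).integrable_of_hasCompactSupport
      (hasCompactSupport_ramp n).mul_right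
  have hramp (n : ℕ) (t : ℝ) : ramp n (-t) = ramp n t := by unfold ramp; rw [abs_neg]
  have key (n : ℕ) (ε : ℝ) (hε : 0 < ε) :
      ∫ t, ramp n t * ‖w t‖ ≤ ‖L‖ + ε * ∫ t, ramp n t * 1 := by
    have hd (t : ℝ) : ‖w t‖ + ε ≠ 0 := by positivity
    have hd' (t : ℝ) : (‖w t‖ : ℂ) + (ε : ℂ) ≠ 0 := by exact_mod_cast hd t
    let g : C(ℝ, ℂ) := ⟨fun t => (starRingEnd ℂ) (w (-t)) / ((‖w (-t)‖ : ℂ) + (ε : ℂ)),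
      (Complex.continuous_conj.comp (hw.comp continuous_neg)).div (by fun_prop) fun t => hd' (-t)⟩
    have hg : ‖rampMul n g‖ ≤ 1 := norm_rampMul_le zero_le_one (fun t => by
      change ‖(starRingEnd ℂ) (w (-t)) / ((‖w (-t)‖ : ℂ) + (ε : ℂ))‖ ≤ 1
      rw [norm_div, RCLike.norm_conj, ← Complex.ofReal_add, Complex.norm_real,
        Real.norm_of_nonneg (by positivity)]
      exact div_le_one_of_le₀ (by linarith) (by positivity)) _
    have h1 : L (rampMul n g) = ((∫ t, ramp n t * (‖w t‖ ^ 2 / (‖w t‖ + ε)) : ℝ) : ℂ) := by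
      rw [hL, ← integral_complex_ofReal]
      congr 1
      ext t
      rw [rampMul_apply, hramp]
      change (ramp n t : ℂ) • ((starRingEnd ℂ) (w (- -t)) / ((‖w (- -t)‖ : ℂ) + (ε : ℂ))) * w t = _
      rw [neg_neg, smul_eq_mul, mul_assoc, div_mul_eq_mul_div, Complex.conj_mul']
      push_cast
      rfl
    have h2 : ‖L (rampMul n g)‖ ≤ ‖L‖ :=
      (L.le_opNorm _).trans (mul_le_of_le_one_right (norm_nonneg _) hg)
    have hc : Continuous fun t => ‖w t‖ ^ 2 / (‖w t‖ + ε) :=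
      (hw.norm.pow 2).div (hw.norm.add continuous_const) hd
    rw [h1, Complex.norm_real, Real.norm_of_nonneg (integral_nonneg fun t =>
      mul_nonneg (ramp_nonneg n t) (by positivity))] at h2
    refine le_trans ?_ (add_le_add_left h2 _)
    rw [← integral_const_mul, ← integral_add (hri n hc) ((hri n continuous_const).const_mul ε)]
    refine integral_mono (hri n hw.norm) ((hri n hc).add ((hri n continuous_const).const_mul ε))
      fun t => ?_
    have h3 : ‖w t‖ ≤ ‖w t‖ ^ 2 / (‖w t‖ + ε) + ε := by
      rw [← sub_le_iff_le_add, le_div_iff₀ (by positivity)]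
      nlinarith
    calc ramp n t * ‖w t‖ ≤ ramp n t * (‖w t‖ ^ 2 / (‖w t‖ + ε) + ε) :=
          mul_le_mul_of_nonneg_left h3 (ramp_nonneg n t)
      _ = _ := by ring
  have key' (n : ℕ) : ∫ t, ramp n t * ‖w t‖ ≤ ‖L‖ := by
    have h1 : Tendsto (fun ε : ℝ => ‖L‖ + ε * ∫ t, ramp n t * 1) (𝓝[>] 0) (𝓝 ‖L‖) := by
      have h2 : Continuous fun ε : ℝ => ‖L‖ + ε * ∫ t, ramp n t * 1 := by fun_prop
      have h3 := h2.tendsto 0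
      rw [zero_mul, add_zero] at h3
      exact h3.mono_left nhdsWithin_le_nhds
    exact ge_of_tendsto h1 (eventually_mem_nhdsWithin.mono fun ε hε => key n ε hε)
  have hwi : Integrable w := by
    refine (aecover_Icc (a := fun n : ℕ => -(n : ℝ)) (b := fun n : ℕ => (n : ℝ))
      (tendsto_neg_atTop_atBot.comp tendsto_natCast_atTop_atTop)
      tendsto_natCast_atTop_atTop).integrable_of_integral_norm_bounded ‖L‖
      (fun n => hw.continuousOn.integrableOn_Icc) (Eventually.of_forall fun n => ?_)
    refine le_trans ?_ (key' n)
    rw [← integral_indicator measurableSet_Icc]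
    refine integral_mono ((hw.norm.continuousOn.integrableOn_Icc).integrable_indicator
      measurableSet_Icc) (hri n hw.norm) fun t => ?_
    by_cases ht : t ∈ Set.Icc (-(n : ℝ)) n
    · rw [Set.indicator_of_mem ht, ramp_eq_one (abs_le.2 ht), one_mul]
    · rw [Set.indicator_of_notMem ht]
      exact mul_nonneg (ramp_nonneg n t) (norm_nonneg _)
  refine ⟨hwi.toL1 w, fun f => ?_⟩
  have h1 (g : C₀(ℝ, ℂ)) : dualPair mulPairing g (hwi.toL1 w) = ∫ s, g (-s) * w s := by
    refine integral_congr_ae ?_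
    filter_upwards [hwi.coeFn_toL1] with t ht
    rw [ht]
    rfl
  refine tendsto_nhds_unique ((L.continuous.tendsto f).comp (rampMul_tendsto f)) ?_
  have h2 := (((dualCLM mulPairing).flip (hwi.toL1 w)).continuous.tendsto f).comp
    (rampMul_tendsto f)
  refine h2.congr fun n => ?_
  rw [Function.comp_apply, Function.comp_apply, hL, ← h1]
  rfl

/-- The bilinear form `Φ(g, f)` depends only on the function `f ∗ g`. -/
def DependsOnConv (Φ : hardyOne →ₗ[ℂ] StrongDual ℂ C₀(ℝ, ℂ)) : Prop :=
  ∀ (f f' : C₀(ℝ, ℂ)) (g g' : hardyOne),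
    (∀ s, dualPair mulPairing f (shift s g.1) = dualPair mulPairing f' (shift s g'.1)) →
      Φ g f = Φ g' f'

/-- A band limited `g` satisfies `g = κ ∗ g` for some Schwartz function `κ`, so that
`f ∗ g = (f ∗ κ) ∗ g` and `Φ(g, f) = ∫ f(s) Φ(g, κ(· - s)) ds`. -/
theorem bandLimited_represented {Φ : hardyOne →ₗ[ℂ] StrongDual ℂ C₀(ℝ, ℂ)} (hΦ : DependsOnConv Φ)
    {g : hardyOne} (hg : g.1 ∈ bandLimited) : g ∈ represented mulPairing Φ := by
  obtain ⟨η, hη, hηc, hη1, -⟩ := exists_cutoff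
  obtain ⟨R, hR⟩ := hg.2.1.isCompact.isBounded.exists_norm_le
  have hR' : 0 < max R 1 := lt_max_of_lt_right one_pos
  obtain ⟨κ, k, hkκ, hk, -⟩ := exists_fourierL1_eq (θ := fun u => η ((max R 1)⁻¹ * u))
    (hη.comp (contDiff_const.mul contDiff_id))
    (hηc.comp_homeomorph (Homeomorph.mulLeft₀ _ (inv_ne_zero hR'.ne')))
  have hkg (r : ℝ) : dilConv k 1 (shift r g.1) = shift r g.1 := by
    refine fourierL1_injective (ae_of_all _ fun u => ?_)
    rw [fourierL1_dilConv, one_mul, hk, fourierL1_shift]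
    by_cases hu : u ∈ tsupport (fourierL1 g.1)
    · rw [hη1, one_mul]
      rw [abs_mul, abs_of_pos (inv_pos.2 hR'), inv_mul_le_iff₀ hR', mul_one]
      exact (hR u hu).trans (le_max_left _ _)
    · rw [image_eq_zero_of_notMem_tsupport hu, mul_zero, mul_zero]
  have hshift : Continuous fun s => c0Shift s κ.toZeroAtInfty := continuous_c0Shift _
  refine exists_dualPair_of_ramp (Φ g) (w := fun s => Φ g (c0Shift (-s) κ.toZeroAtInfty))
    ((Φ g).continuous.comp (hshift.comp continuous_neg)) fun n f => ?_
  set f₁ := rampMul n f with hf₁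
  have hf₁c : HasCompactSupport f₁ :=
    ((hasCompactSupport_ramp n).comp_left (g := Complex.ofReal) (by simp)).smul_right
  have hi : Integrable fun s => f₁ s • c0Shift s κ.toZeroAtInfty :=
    (f₁.continuous.smul hshift).integrable_of_hasCompactSupport hf₁c.smul_right
  have h1 (L : C₀(ℝ, ℂ) →L[ℂ] ℂ) : L (∫ s, f₁ s • c0Shift s κ.toZeroAtInfty) =
      ∫ s, f₁ s * L (c0Shift s κ.toZeroAtInfty) := by
    rw [← L.integral_comp_comm hi]
    simp_rw [map_smul, smul_eq_mul]
  have h2 : Φ g f₁ = Φ g (∫ s, f₁ s • c0Shift s κ.toZeroAtInfty) := by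
    refine hΦ _ _ _ _ fun r => ?_
    have h3 := h1 ((dualCLM mulPairing).flip (shift r g.1))
    simp only [ContinuousLinearMap.flip_apply, dualCLM_apply, dualPair_c0Shift] at h3
    rw [h3, ← dualPair_dilConv_schwartz f₁ κ hkκ, hkg]
  rw [h2, h1 (Φ g), ← integral_neg_eq_self]

end Scalar

/-! ### Translation invariant operators on the Hardy space are Fourier multipliers -/

section Multiplier

theorem exists_dilate (k : LOne ℂ) {c : ℝ} (hc : 0 < c) :
    ∃ k' : LOne ℂ, ‖k'‖ = ‖k‖ ∧ ∀ u, fourierL1 k' u = fourierL1 k (u / c) := by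
  have hi : Integrable fun t => (c : ℂ) * k (c * t) :=
    ((L1.integrable_coeFn k).comp_mul_left' hc.ne').const_mul _
  refine ⟨hi.toL1 _, ?_, fun u => ?_⟩
  · rw [L1.norm_eq_integral_norm, L1.norm_eq_integral_norm]
    calc ∫ t, ‖hi.toL1 _ t‖ = ∫ t, c * ‖k (c * t)‖ := by
          refine integral_congr_ae ?_
          filter_upwards [hi.coeFn_toL1] with t ht
          rw [ht, norm_mul, Complex.norm_real, Real.norm_of_nonneg hc.le]
      _ = ∫ t, ‖k t‖ := by
          rw [integral_const_mul, Measure.integral_comp_mul_left (fun t => ‖k t‖) c, smul_eq_mul,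
            abs_of_pos (inv_pos.2 hc), mul_inv_cancel_left₀ hc.ne']
  · rw [fourierL1_toL1]
    simp_rw [mul_assoc]
    rw [integral_const_mul]
    have h1 := Measure.integral_comp_mul_left
      (fun t : ℝ => k t * Complex.exp (-(Complex.I * t * (u / c : ℝ)))) c
    rw [abs_of_pos (inv_pos.2 hc)] at h1
    have hc' : (c : ℂ) ≠ 0 := by exact_mod_cast hc.ne'
    have h2 : fourierL1 k (u / c) =
        (c : ℂ) * ∫ t : ℝ, k (c * t) * Complex.exp (-(Complex.I * (c * t : ℝ) * (u / c : ℝ))) := by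
      rw [h1, Complex.real_smul, Complex.ofReal_inv, mul_inv_cancel_left₀ hc']
      rfl
    rw [h2]
    congr 2
    ext t
    congr 3
    push_cast
    field_simp

theorem exists_hardyOne_fourier_one :
    ∃ k : LOne ℂ, k ∈ hardyOne ∧ fourierL1 k 1 = 1 := by
  obtain ⟨η, hη, hηc, hη1, hη2⟩ := exists_cutoff
  let e : ℝ ≃ₜ ℝ := (Homeomorph.mulLeft₀ (2 : ℝ) two_ne_zero).trans (Homeomorph.addRight (-2))
  obtain ⟨-, k, -, hk, -⟩ := exists_fourierL1_eq (θ := fun u => η (e u))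
    (hη.comp (by change ContDiff ℝ ∞ fun u : ℝ => 2 * u + -2; fun_prop)) (hηc.comp_homeomorph e)
  refine ⟨k, fun u hu => ?_, ?_⟩
  · rw [hk]
    refine hη2 _ ?_
    change 2 ≤ |2 * u + -2|
    rw [abs_of_nonpos (by linarith)]
    linarith
  · rw [hk]
    refine hη1 _ ?_
    change |(2 : ℝ) * 1 + -2| ≤ 1
    norm_num

theorem dilConv_comm (g h : LOne ℂ) : dilConv g 1 h = dilConv h 1 g :=
  fourierL1_injective (ae_of_all _ fun u => by
    rw [fourierL1_dilConv, fourierL1_dilConv, one_mul, mul_comm])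

variable {T : hardyOne →L[ℂ] LOne ℂ}

theorem fourierL1_map_dilConv
    (hT : ∀ (s : ℝ) (g : hardyOne), T ⟨shift s g.1, shift_mem_hardyOne s g.1 g.2⟩ = shift s (T g))
    (k : LOne ℂ) (g : hardyOne) (u : ℝ) :
    fourierL1 (T ⟨dilConv k 1 g.1, dilConv_mem shift_mem_hardyOne k 1 g.2⟩) u =
      fourierL1 k u * fourierL1 (T g) u := by
  rw [map_dilConv_of_mem shift_mem_hardyOne T k 1 g.2]
  have h1 (s : ℝ) : T ⟨shift (1 * s) g.1, shift_mem_hardyOne (1 * s) g.1 g.2⟩ =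
      shift (1 * s) (T g) := hT (1 * s) g
  simp_rw [h1]
  exact (fourierL1_dilConv k 1 (T g) u).trans (by rw [one_mul])

/-- `T` commutes with convolutions. Convolving with a function whose transform is `1` at a point
`u < 0` and vanishes on `(0, ∞)` shows that `T g` has no spectrum on the negative half line. -/
theorem map_mem_hardyOne
    (hT : ∀ (s : ℝ) (g : hardyOne), T ⟨shift s g.1, shift_mem_hardyOne s g.1 g.2⟩ = shift s (T g))
    (g : hardyOne) : T g ∈ hardyOne := by
  have h1 (u : ℝ) (hu : u < 0) : fourierL1 (T g) u = 0 := by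
    obtain ⟨k, hk, hk1⟩ := exists_hardyOne_fourier_one
    -- reflect and dilate, to move the spectrum of `k` to the negative half line
    have hi : Integrable fun t => k (-t) := (L1.integrable_coeFn k).comp_neg
    have hneg (v : ℝ) : fourierL1 (hi.toL1 _) v = fourierL1 k (-v) := by
      rw [fourierL1_toL1, ← integral_neg_eq_self]
      refine integral_congr_ae (ae_of_all _ fun t => ?_)
      simp
    obtain ⟨k', -, hk'⟩ := exists_dilate (hi.toL1 _) (neg_pos.2 hu)
    have h2 := fourierL1_map_dilConv hT k' g u
    have h3 : (⟨dilConv k' 1 g.1, dilConv_mem shift_mem_hardyOne k' 1 g.2⟩ : hardyOne) = 0 := by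
      refine Subtype.ext (eq_zero_of_fourierL1_ae (ae_of_all _ fun v => ?_))
      rw [fourierL1_dilConv, one_mul, hk', hneg]
      rcases le_or_gt v 0 with hv | hv
      · rw [g.2 v hv, mul_zero]
      · rw [hk _ (neg_nonpos.2 (div_nonneg hv.le (neg_pos.2 hu).le)), zero_mul]
    rw [h3, map_zero, fourierL1_zero, hk', hneg, div_neg, neg_neg, div_self hu.ne, hk1, one_mul]
      at h2
    exact h2.symm
  have h2 : closure (Set.Iio (0 : ℝ)) ⊆ {u | fourierL1 (T g) u = 0} :=
    closure_minimal h1 (isClosed_eq (continuous_fourierL1 _) continuous_const)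
  rw [closure_Iio] at h2
  exact fun u hu => h2 hu

/-- The symbol at `v` is the value at `v` of the transform of `T k_v`, where `k_v` are the dilates of
one function, normalized so that the transform of `k_v` is `1` at `v`. It is bounded because the
`k_v` have the same norm, and continuous because near `v` it is also the quotient of the transforms
of `T k_v` and `k_v`. -/
theorem exists_multiplier_of_shift
    (hT : ∀ (s : ℝ) (g : hardyOne), T ⟨shift s g.1, shift_mem_hardyOne s g.1 g.2⟩ = shift s (T g)) :
    ∃ S ∈ fourierMultipliers, ∀ g, (S g).1 = T g := by
  let S : hardyOne →L[ℂ] hardyOne := T.codRestrict hardyOne (map_mem_hardyOne hT)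
  refine ⟨S, ?_, fun g => rfl⟩
  obtain ⟨k, hk, hk1⟩ := exists_hardyOne_fourier_one
  have hdil (v : Set.Ioi (0 : ℝ)) := exists_dilate k v.2
  choose κ hκn hκ using hdil
  have hκm (v : Set.Ioi (0 : ℝ)) : κ v ∈ hardyOne := fun u hu => by
    rw [hκ]
    exact hk _ (div_nonpos_of_nonpos_of_nonneg hu v.2.le)
  have hκ1 (v : Set.Ioi (0 : ℝ)) : fourierL1 (κ v) v = 1 := by
    rw [hκ, div_self v.2.ne', hk1]
  have hcomm (g h : hardyOne) (u : ℝ) :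
      fourierL1 g.1 u * fourierL1 (T h) u = fourierL1 h.1 u * fourierL1 (T g) u := by
    rw [← fourierL1_map_dilConv hT, ← fourierL1_map_dilConv hT]
    congr 3
    exact dilConv_comm _ _
  let m : ℝ → ℂ := fun u => if h : 0 < u then fourierL1 (T ⟨κ ⟨u, h⟩, hκm ⟨u, h⟩⟩) u else 0
  have hm (g : hardyOne) (u : ℝ) (hu : 0 < u) :
      fourierL1 (T g) u = m u * fourierL1 g.1 u := by
    have h1 := hcomm ⟨κ ⟨u, hu⟩, hκm ⟨u, hu⟩⟩ g u
    have h2 : fourierL1 (κ ⟨u, hu⟩) u = 1 := hκ1 ⟨u, hu⟩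
    simp only [m, dif_pos hu]
    rwa [h2, one_mul, mul_comm] at h1
  have hmb (u : ℝ) (hu : 0 < u) : ‖m u‖ ≤ ‖T‖ * ‖k‖ := by
    simp only [m, dif_pos hu]
    refine (norm_fourierL1_le _ _).trans ((T.le_opNorm _).trans (le_of_eq ?_))
    exact congrArg (‖T‖ * ·) (hκn ⟨u, hu⟩)
  have hmc : ContinuousOn m (Set.Ioi 0) := by
    intro v hv
    refine ContinuousAt.continuousWithinAt ?_
    set g : hardyOne := ⟨κ ⟨v, hv⟩, hκm ⟨v, hv⟩⟩ with hg
    have h1 : fourierL1 g.1 v = 1 := hκ1 ⟨v, hv⟩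
    have h2 : ∀ᶠ u in 𝓝 v, fourierL1 g.1 u ≠ 0 :=
      (continuous_fourierL1 g.1).continuousAt.eventually_ne (by rw [h1]; exact one_ne_zero)
    have h3 : (fun u => fourierL1 (T g) u / fourierL1 g.1 u) =ᶠ[𝓝 v] m := by
      filter_upwards [h2, Ioi_mem_nhds hv] with u hu hu'
      rw [hm g u hu', mul_div_cancel_right₀ _ hu]
    exact ((continuous_fourierL1 _).continuousAt.div (continuous_fourierL1 _).continuousAt
      (by rw [h1]; exact one_ne_zero)).congr h3
  have hml : MemLp m ∞ (volume.restrict (Set.Ioi (0 : ℝ))) :=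
    memLp_top_of_bound (hmc.aestronglyMeasurable measurableSet_Ioi) (‖T‖ * ‖k‖)
      ((ae_restrict_iff' measurableSet_Ioi).2 (ae_of_all _ hmb))
  refine ⟨hml.toLp m, fun g => ?_⟩
  filter_upwards [hml.coeFn_toLp, ae_restrict_mem measurableSet_Ioi] with u hu hu'
  rw [hu]
  exact hm g u hu'

/-- Functionals that depend only on the convolution are given by Fourier multipliers. -/
theorem exists_multiplier {Φ : hardyOne →ₗ[ℂ] StrongDual ℂ C₀(ℝ, ℂ)} (hΦ : DependsOnConv Φ)
    {C : ℝ} (hC : ∀ g, ‖Φ g‖ ≤ C * ‖g‖) :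
    ∃ T ∈ fourierMultipliers, ∀ f g, Φ g f = dualPair mulPairing f (T g).1 := by
  have hall (g : hardyOne) : g ∈ represented mulPairing Φ := by
    have h1 : IsClosed (Subtype.val '' (represented mulPairing Φ : Set hardyOne)) :=
      isClosed_hardyOne.isClosedEmbedding_subtypeVal.isClosedMap _
        (isClosed_represented norm_mulPairing_le isNorming_mulPairing hC)
    have h2 : closure bandLimited ⊆ Subtype.val '' (represented mulPairing Φ : Set hardyOne) :=
      closure_minimal (fun k hk => ⟨⟨k, bandLimited_subset_hardyOne hk⟩,
        bandLimited_represented hΦ hk, rfl⟩) h1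
    obtain ⟨g', hg', he⟩ := h2 (hardyOne_subset_closure_bandLimited g.2)
    rwa [← Subtype.ext he]
  obtain ⟨T, hT⟩ := exists_representing_operator norm_mulPairing_le isNorming_mulPairing hC hall
  obtain ⟨S, hS, hST⟩ := exists_multiplier_of_shift (T := T) fun s g => by
    refine dualPair_injective norm_mulPairing_le isNorming_mulPairing fun f => ?_
    rw [← hT, ← dualPair_c0Shift, ← hT]
    refine hΦ _ _ _ _ fun r => ?_
    rw [dualPair_c0Shift, shift_shift, shift_shift, add_comm]
  exact ⟨S, hS, fun f g => by rw [hST, hT]⟩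

end Multiplier

/-! ### Functionals on the vector valued algebra -/

section Vector

variable {X Z : Type*} [NormedAddCommGroup X] [NormedSpace ℂ X]
  [NormedAddCommGroup Z] [NormedSpace ℂ Z]

theorem c0Tensor_apply (f : C₀(ℝ, ℂ)) (x : X) (t : ℝ) : c0Tensor f x t = f t • x := rfl

theorem norm_c0Tensor_le (f : C₀(ℝ, ℂ)) (x : X) : ‖c0Tensor f x‖ ≤ ‖f‖ * ‖x‖ :=
  c0_norm_le (by positivity) fun t => by
    rw [c0Tensor_apply, norm_smul]
    exact mul_le_mul_of_nonneg_right (c0_norm_apply_le f t) (norm_nonneg _)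

/-- The map `f ↦ f ⊗ x`. -/
def c0TensorLin (x : X) : C₀(ℝ, ℂ) →ₗ[ℂ] C₀(ℝ, X) where
  toFun f := c0Tensor f x
  map_add' f g := by
    ext t
    exact add_smul (f t) (g t) x
  map_smul' c f := by
    ext t
    exact mul_smul c (f t) x

/-- The scalar function `t ↦ β(f(t), z)`. -/
def c0Pair (β : X →L[ℂ] Z →L[ℂ] ℂ) (f : C₀(ℝ, X)) (z : Z) : C₀(ℝ, ℂ) where
  toFun t := β (f t) z
  continuous_toFun := (β.flip z).continuous.comp f.continuous
  zero_at_infty' := by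
    have h := ((β.flip z).continuous.tendsto 0).comp (zero_at_infty f)
    rwa [map_zero] at h

variable {β : X →L[ℂ] Z →L[ℂ] ℂ}

theorem dualPair_tensor_eq (f : C₀(ℝ, X)) (g : LOne ℂ) (z : Z) :
    dualPair β f (tensorL1 g z) = dualPair mulPairing (c0Pair β f z) g := dualPair_tensorL1 β f g z

theorem c0Pair_c0Tensor {x : X} {z : Z} (h : β x z = 1) (f : C₀(ℝ, ℂ)) :
    c0Pair β (c0Tensor f x) z = f := by
  ext t
  change β (f t • x) z = f t
  rw [map_smul, smul_apply, h, smul_eq_mul, mul_one]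

theorem norm_hardyTensor_le (g : hardyOne) (z : Z) : ‖hardyTensor g z‖ ≤ ‖g‖ * ‖z‖ := by
  refine ((ContinuousLinearMap.toSpanSingleton ℂ z).norm_compLp_le g.1).trans (le_of_eq ?_)
  rw [ContinuousLinearMap.norm_toSpanSingleton, mul_comm]
  rfl

theorem conv_hardyTensor_eq {f f' : C₀(ℝ, X)} {g g' : hardyOne} {z z' : Z}
    (h : ∀ s, dualPair mulPairing (c0Pair β f z) (shift s g.1) =
      dualPair mulPairing (c0Pair β f' z') (shift s g'.1)) :
    A0Space.conv β (hardyOneVec Z) f (hardyTensor g z) =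
      A0Space.conv β (hardyOneVec Z) f' (hardyTensor g' z') := by
  refine A0Space.ext fun s => ?_
  rw [A0Space.toFun_conv, A0Space.toFun_conv]
  change dualPair β f (shift (-s) (tensorL1 g.1 z)) = dualPair β f' (shift (-s) (tensorL1 g'.1 z'))
  rw [shift_tensorL1, shift_tensorL1, dualPair_tensor_eq, dualPair_tensor_eq, h]

/-- The form `(h, f) ↦ φ(f ∗ h)`. -/
def convForm {V : Submodule ℂ (LOne Z)} (φ : StrongDual ℂ (A0Space β V)) :
    V →ₗ[ℂ] StrongDual ℂ C₀(ℝ, X) where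
  toFun h := LinearMap.mkContinuous
    ((φ : A0Space β V →ₗ[ℂ] ℂ).comp ((A0Space.convLin β V).flip h)) (‖φ‖ * ‖h‖) fun f =>
      (φ.le_opNorm _).trans <| by
        rw [mul_assoc, mul_comm ‖h‖]
        exact mul_le_mul_of_nonneg_left (A0Space.norm_conv_le f h) (norm_nonneg _)
  map_add' h g := by
    ext f
    exact (congrArg φ (map_add (A0Space.convLin β V f) h g)).trans (map_add φ _ _)
  map_smul' c h := by
    ext f
    exact (congrArg φ (map_smul (A0Space.convLin β V f) c h)).trans (map_smul φ _ _)

theorem convForm_apply {V : Submodule ℂ (LOne Z)} (φ : StrongDual ℂ (A0Space β V)) (h : V)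
    (f : C₀(ℝ, X)) : convForm φ h f = φ (A0Space.conv β V f h) := rfl

theorem norm_convForm_le {V : Submodule ℂ (LOne Z)} (φ : StrongDual ℂ (A0Space β V)) (h : V) :
    ‖convForm φ h‖ ≤ ‖φ‖ * ‖h‖ :=
  ContinuousLinearMap.opNorm_le_bound _ (by positivity) fun f => (φ.le_opNorm _).trans <| by
    rw [mul_assoc, mul_comm ‖h‖]
    exact mul_le_mul_of_nonneg_left (A0Space.norm_conv_le f h) (norm_nonneg _)

/-- On elementary tensors, `f ∗ (g ⊗ z)` is the scalar convolution `β(f, z) ∗ g`, so `φ` is given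
there by the multiplier `T` of a scalar functional, `φ(f ∗ (g ⊗ z)) = ⟨Tg ⊗ z, f⟩`. The vectors on
which `φ` is represented form a closed subspace. -/
theorem exists_operator_of_functional [CompleteSpace Z] (hβ : ‖β‖ ≤ 1) (hn : IsNorming β) {x₀ : X}
    {z₀ : Z} (h₀ : β x₀ z₀ = 1) (φ : StrongDual ℂ (A0Space β (hardyOneVec Z))) :
    ∃ T ∈ fourierMultipliers, ∃ W : hardyOneVec Z →L[ℂ] hardyOneVec Z,
      (∀ g z, W (hardyTensor g z) = hardyTensor (T g) z) ∧
        ∀ f h, φ (A0Space.conv β (hardyOneVec Z) f h) = dualPair β f (W h).1 := by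
  have hb (g : hardyOne) (f : C₀(ℝ, ℂ)) : ‖convForm φ (hardyTensor g z₀) (c0TensorLin x₀ f)‖ ≤
      ‖φ‖ * ‖z₀‖ * ‖x₀‖ * ‖g‖ * ‖f‖ := by
    calc ‖convForm φ (hardyTensor g z₀) (c0Tensor f x₀)‖
        ≤ (‖φ‖ * ‖hardyTensor g z₀‖) * ‖c0Tensor f x₀‖ :=
          (convForm φ (hardyTensor g z₀)).le_of_opNorm_le (norm_convForm_le φ _) _
      _ ≤ (‖φ‖ * (‖g‖ * ‖z₀‖)) * (‖f‖ * ‖x₀‖) := by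
          gcongr
          · exact norm_hardyTensor_le g z₀
          · exact norm_c0Tensor_le f x₀
      _ = ‖φ‖ * ‖z₀‖ * ‖x₀‖ * ‖g‖ * ‖f‖ := by ring
  let L (g : hardyOne) : StrongDual ℂ C₀(ℝ, ℂ) :=
    LinearMap.mkContinuous ((convForm φ (hardyTensor g z₀) : C₀(ℝ, X) →ₗ[ℂ] ℂ).comp
      (c0TensorLin x₀)) (‖φ‖ * ‖z₀‖ * ‖x₀‖ * ‖g‖) (hb g)
  have hL (g : hardyOne) (f : C₀(ℝ, ℂ)) :
      L g f = φ (A0Space.conv β (hardyOneVec Z) (c0Tensor f x₀) (hardyTensor g z₀)) := rfl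
  let Φ : hardyOne →ₗ[ℂ] StrongDual ℂ C₀(ℝ, ℂ) :=
    { toFun := L
      map_add' := fun g h => by
        ext f
        rw [add_apply, hL, hL, hL, ← convForm_apply, hardyTensor_add, map_add]
        rfl
      map_smul' := fun c g => by
        ext f
        rw [smul_apply, hL, hL, ← convForm_apply, hardyTensor_smul, map_smul]
        rfl }
  have hΦ : DependsOnConv Φ := fun f f' g g' h => by
    change L g f = L g' f'
    rw [hL, hL]
    congr 1
    refine conv_hardyTensor_eq fun s => ?_
    rw [c0Pair_c0Tensor h₀, c0Pair_c0Tensor h₀, h]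
  obtain ⟨T, hT, hTΦ⟩ := exists_multiplier hΦ (C := ‖φ‖ * ‖z₀‖ * ‖x₀‖) fun g =>
    (L g).opNorm_le_bound (by positivity) (hb g)
  have htensor (f : C₀(ℝ, X)) (g : hardyOne) (z : Z) :
      φ (A0Space.conv β (hardyOneVec Z) f (hardyTensor g z)) =
        dualPair β f (hardyTensor (T g) z).1 := by
    calc φ (A0Space.conv β (hardyOneVec Z) f (hardyTensor g z)) = L g (c0Pair β f z) := by
          rw [hL]
          congr 1
          refine conv_hardyTensor_eq fun s => ?_
          rw [c0Pair_c0Tensor h₀]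
      _ = dualPair β f (hardyTensor (T g) z).1 :=
          (hTΦ _ g).trans (dualPair_tensor_eq f (T g).1 z).symm
  have hrep := mem_of_hardyTensor_mem
    (isClosed_represented hβ hn (Φ := convForm φ) (norm_convForm_le φ))
    fun g _ z => ⟨(hardyTensor (T g) z).1, fun f => htensor f g z⟩
  obtain ⟨W, hW⟩ := exists_representing_operator hβ hn (norm_convForm_le φ) hrep
  have hWt (g : hardyOne) (z : Z) : W (hardyTensor g z) = (hardyTensor (T g) z).1 :=
    dualPair_injective hβ hn fun f => by rw [← hW, convForm_apply, htensor]
  have hWm (h : hardyOneVec Z) : W h ∈ hardyOneVec Z :=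
    mem_of_hardyTensor_mem (P := (hardyOneVec Z).comap (W : hardyOneVec Z →ₗ[ℂ] LOne Z))
      (isClosed_hardyOneVec.preimage W.continuous)
      (fun g _ z => by
        change W (hardyTensor g z) ∈ hardyOneVec Z
        rw [hWt]
        exact (hardyTensor (T g) z).2) h
  exact ⟨T, hT, W.codRestrict _ hWm, fun g z => Subtype.ext (hWt g z), fun f h => hW f h⟩

end Vector

/-! ### Every bounded multiplier defines a functional -/

section Converse

variable {X Z : Type*} [NormedAddCommGroup X] [NormedSpace ℂ X]
  [NormedAddCommGroup Z] [NormedSpace ℂ Z] {β : X →L[ℂ] Z →L[ℂ] ℂ}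

theorem integrable_mul_toFun {V : Submodule ℂ (LOne Z)} (hβ : ‖β‖ ≤ 1) (w : LOne ℂ)
    (F : A0Space β V) : Integrable fun s => w s * A0Space.toFun β V F (-s) :=
  (L1.integrable_coeFn w).mul_bdd (c := ‖F‖)
    ((A0Space.continuous_toFun F).comp continuous_neg).aestronglyMeasurable
    (ae_of_all _ fun s => A0Space.norm_toFun_le hβ F (-s))

/-- Every integrable function acts on the algebra by `F ↦ ∫ w(s) F(-s) ds`, and
`f ∗ h ↦ ⟨w ∗ h, f⟩`. -/
theorem exists_integral_functional [CompleteSpace Z] {V : Submodule ℂ (LOne Z)} (hβ : ‖β‖ ≤ 1)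
    (w : LOne ℂ) : ∃ φ : StrongDual ℂ (A0Space β V), ∀ f h,
      φ (A0Space.conv β V f h) = dualPair β f (dilConv w 1 h.1) := by
  refine ⟨LinearMap.mkContinuous
    { toFun := fun F => ∫ s, w s * A0Space.toFun β V F (-s)
      map_add' := fun F G => by
        rw [← integral_add (integrable_mul_toFun hβ w F) (integrable_mul_toFun hβ w G)]
        simp_rw [map_add, Pi.add_apply, mul_add]
      map_smul' := fun c F => by
        rw [RingHom.id_apply, smul_eq_mul, ← integral_const_mul]
        simp_rw [map_smul, Pi.smul_apply, smul_eq_mul, mul_left_comm] } ‖w‖ fun F => ?_,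
    fun f h => ?_⟩
  · rw [L1.norm_eq_integral_norm, ← integral_mul_const]
    refine norm_integral_le_of_norm_le ((L1.integrable_coeFn w).norm.mul_const _)
      (ae_of_all _ fun s => ?_)
    rw [norm_mul]
    exact mul_le_mul_of_nonneg_left (A0Space.norm_toFun_le hβ F _) (norm_nonneg _)
  · have h1 := map_dilConv (dualCLM β f) w 1 h.1
    simp only [dualCLM_apply, one_mul, smul_eq_mul] at h1
    rw [h1]
    refine integral_congr_ae (ae_of_all _ fun s => ?_)
    change w s * A0Space.toFun β V (A0Space.conv β V f h) (-s) = _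
    rw [A0Space.toFun_conv, neg_neg]

/-- The functions `ρ_n` with transforms `η(u/n) - η(nu)` on the positive half line, where `η` is a
cutoff function. Although `ρ_n ∗ h`, for `h ∈ H^1`, is also a difference of two convolutions with
dilates of one function, only `ρ_n` is in `H^1`. -/
theorem exists_approx_identity : ∃ (k : LOne ℂ) (ρ : ℕ → hardyOne),
    (∀ n, ∀ u > 0, fourierL1 (ρ n).1 u =
      fourierL1 k (((n : ℝ) + 1)⁻¹ * u) - fourierL1 k (((n : ℝ) + 1) * u)) ∧
    ∀ g ∈ bandLimited, ∀ᶠ n : ℕ in atTop,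
      dilConv k ((n : ℝ) + 1)⁻¹ g - dilConv k ((n : ℝ) + 1) g = g := by
  obtain ⟨η, hη, hηc, hη1, hη2⟩ := exists_cutoff
  obtain ⟨-, k, -, hk, -⟩ := exists_fourierL1_eq hη hηc
  have hpos (n : ℕ) : (0 : ℝ) < (n : ℝ) + 1 := by positivity
  have hsm (n : ℕ) := exists_fourierL1_eq
    (θ := fun u => (η (((n : ℝ) + 1)⁻¹ * u) - η (((n : ℝ) + 1) * u)) *
      (Real.smoothTransition (((n : ℝ) + 1) * u) : ℂ))
    (((hη.comp (contDiff_const.mul contDiff_id)).sub (hη.comp (contDiff_const.mul contDiff_id))).mul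
      (Complex.ofRealCLM.contDiff.comp
        (Real.smoothTransition.contDiff.comp (contDiff_const.mul contDiff_id))))
    (((hηc.comp_homeomorph (Homeomorph.mulLeft₀ _ (inv_ne_zero (hpos n).ne'))).sub
      (hηc.comp_homeomorph (Homeomorph.mulLeft₀ _ (hpos n).ne'))).mul_right)
  choose _ ρ _ hρ _ using hsm
  refine ⟨k, fun n => ⟨ρ n, fun u hu => ?_⟩, fun n u hu => ?_, fun g hg => ?_⟩
  · rw [hρ, Real.smoothTransition.zero_of_nonpos (mul_nonpos_of_nonneg_of_nonpos (hpos n).le hu),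
      Complex.ofReal_zero, mul_zero]
  · rw [hρ, hk, hk]
    rcases le_or_gt 1 (((n : ℝ) + 1) * u) with h | h
    · rw [Real.smoothTransition.one_of_one_le h, Complex.ofReal_one, mul_one]
    · have h1 : |((n : ℝ) + 1) * u| ≤ 1 := by
        rw [abs_of_pos (mul_pos (hpos n) hu)]
        exact h.le
      have h2 : |((n : ℝ) + 1)⁻¹ * u| ≤ 1 := by
        rw [abs_of_pos (mul_pos (inv_pos.2 (hpos n)) hu)]
        refine le_trans ?_ h.le
        gcongr
        have h3 : (1 : ℝ) ≤ (n : ℝ) + 1 := by linarith [(Nat.cast_nonneg n : (0 : ℝ) ≤ n)]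
        exact (inv_le_one_of_one_le₀ h3).trans h3
      rw [hη1 _ h1, hη1 _ h2, sub_self, zero_mul]
  · obtain ⟨a, ha, hag⟩ := hg.2.1.isCompact.exists_forall_le' (f := fun u : ℝ => u)
      continuousOn_id (a := 0) fun u hu => hg.2.2 hu
    obtain ⟨R, hR⟩ := hg.2.1.isCompact.isBounded.exists_norm_le
    obtain ⟨N, hN⟩ := exists_nat_ge (max R (2 / a))
    filter_upwards [eventually_ge_atTop N] with n hn
    have hn' : max R (2 / a) ≤ (n : ℝ) + 1 :=
      (hN.trans (Nat.cast_le.2 hn)).trans (by linarith)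
    refine fourierL1_injective (ae_of_all _ fun u => ?_)
    rw [fourierL1_sub, fourierL1_dilConv, fourierL1_dilConv, hk, hk]
    by_cases hu : u ∈ tsupport (fourierL1 g)
    · have hau : a ≤ u := hag u hu
      have hu0 : 0 < u := ha.trans_le hau
      rw [hη1, hη2, one_mul, zero_mul, sub_zero]
      · rw [abs_of_pos (mul_pos (hpos n) hu0)]
        have h1 : 2 / a ≤ (n : ℝ) + 1 := (le_max_right _ _).trans hn'
        rw [div_le_iff₀ ha] at h1
        exact h1.trans (mul_le_mul_of_nonneg_left hau (hpos n).le)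
      · rw [abs_mul, abs_of_pos (inv_pos.2 (hpos n)), inv_mul_le_iff₀ (hpos n), mul_one]
        exact (hR u hu).trans ((le_max_left _ _).trans hn')
    · rw [image_eq_zero_of_notMem_tsupport hu, mul_zero, mul_zero, sub_zero]

/-- A bounded sequence of functionals has a weak* cluster point. -/
theorem exists_weak_cluster_functional {E : Type*} [NormedAddCommGroup E] [NormedSpace ℂ E]
    {φ : ℕ → StrongDual ℂ E} {C : ℝ} (hC : ∀ n, ‖φ n‖ ≤ C) :
    ∃ ψ : StrongDual ℂ E, ∀ x y, Tendsto (fun n => φ n x) atTop (𝓝 y) → ψ x = y := by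
  obtain ⟨ψ, -, hψ⟩ := (WeakDual.isCompact_closedBall (𝕜 := ℂ)
    (0 : StrongDual ℂ E) C).exists_mapClusterPt
      (f := atTop) (u := fun n => StrongDual.toWeakDual (φ n)) (tendsto_principal.2
        (Eventually.of_forall fun n => mem_closedBall_zero_iff.2 (hC n)))
  refine ⟨WeakDual.toStrongDual ψ, fun x y h2 => ?_⟩
  have h1 := hψ.continuousAt_comp (WeakDual.eval_continuous x).continuousAt
  have h3 : ClusterPt (WeakDual.toStrongDual ψ x) (𝓝 y) := ClusterPt.mono h1 h2
  exact eq_of_nhds_neBot h3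

/-- The convolution `dilConv k c` as an operator on `H^1(ℝ; Z)`. -/
def hardyDilConv [CompleteSpace Z] (k : LOne ℂ) (c : ℝ) : hardyOneVec Z →L[ℂ] hardyOneVec Z :=
  ((dilConv k c).comp (hardyOneVec Z).subtypeL).codRestrict (hardyOneVec Z) fun h =>
    dilConv_mem shift_mem_hardyOneVec k c h.2

theorem norm_dilConv_apply_le (k : LOne ℂ) (c : ℝ) (h : LOne Z) :
    ‖dilConv k c h‖ ≤ ‖k‖ * ‖h‖ := by
  have h1 : ‖(dilConv k c : LOne Z →L[ℂ] LOne Z)‖ ≤ ‖k‖ := norm_dilConv_le k c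
  have h2 : ‖dilConv k c h‖ ≤ ‖(dilConv k c : LOne Z →L[ℂ] LOne Z)‖ * ‖h‖ :=
    (dilConv k c).le_opNorm h
  have h3 : 0 ≤ ‖h‖ := norm_nonneg h
  nlinarith

theorem norm_hardyDilConv_apply_le [CompleteSpace Z] (k : LOne ℂ) (c : ℝ) (h : hardyOneVec Z) :
    ‖hardyDilConv k c h‖ ≤ ‖k‖ * ‖h‖ := by
  have h1 : ‖hardyDilConv k c h‖ = ‖dilConv k c h.1‖ := rfl
  have h2 : ‖h‖ = ‖h.1‖ := rfl
  rw [h1, h2]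
  exact norm_dilConv_apply_le k c h.1

/-- For the approximate identity `Q_n`, `h ↦ (T ρ_n) ∗ h` is `W Q_n`, so the functionals of `T ρ_n` are
uniformly bounded by `‖W‖`. A weak* cluster point of them represents `W`. -/
theorem exists_functional_of_operator [CompleteSpace Z] (hβ : ‖β‖ ≤ 1)
    {T : hardyOne →L[ℂ] hardyOne} (hT : T ∈ fourierMultipliers)
    {W : hardyOneVec Z →L[ℂ] hardyOneVec Z}
    (hW : ∀ g z, W (hardyTensor g z) = hardyTensor (T g) z) :
    ∃ φ : StrongDual ℂ (A0Space β (hardyOneVec Z)),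
      ∀ f h, φ (A0Space.conv β (hardyOneVec Z) f h) = dualPair β f (W h).1 := by
  obtain ⟨m, hm⟩ := hT
  obtain ⟨k, ρ, hρ, hk⟩ := exists_approx_identity
  set D : ℝ → hardyOneVec Z →L[ℂ] hardyOneVec Z := hardyDilConv k with hDdef
  set E : ℕ → hardyOneVec Z →L[ℂ] hardyOneVec Z := fun n => hardyDilConv (T (ρ n)).1 1 with hEdef
  let d (c : ℝ) (g : hardyOne) : hardyOne :=
    ⟨dilConv k c g.1, dilConv_mem shift_mem_hardyOne k c g.2⟩
  have hD (c : ℝ) (g : hardyOne) (z : Z) : D c (hardyTensor g z) = hardyTensor (d c g) z :=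
    Subtype.ext (dilConv_tensorL1 k c g.1 z)
  have hDn (c : ℝ) (h : hardyOneVec Z) : ‖D c h‖ ≤ ‖k‖ * ‖h‖ := norm_hardyDilConv_apply_le k c h
  have hsub (g g' : hardyOne) (z : Z) :
      hardyTensor g z - hardyTensor g' z = hardyTensor (g - g') z :=
    Subtype.ext (map_sub (tensorCLM z) g.1 g'.1).symm
  have hQ (n : ℕ) (g : hardyOne) (z : Z) :
      (D ((n : ℝ) + 1)⁻¹ - D ((n : ℝ) + 1)) (hardyTensor g z) =
        hardyTensor (d ((n : ℝ) + 1)⁻¹ g - d ((n : ℝ) + 1) g) z := by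
    rw [sub_apply, hD, hD, hsub]
  have hE (n : ℕ) : E n = W.comp (D ((n : ℝ) + 1)⁻¹ - D ((n : ℝ) + 1)) := by
    refine hardyOneVec_ext fun g z => ?_
    rw [ContinuousLinearMap.comp_apply, hQ, hW]
    refine Subtype.ext ((dilConv_tensorL1 (T (ρ n)).1 1 g.1 z).trans ?_)
    change tensorL1 (dilConv (T (ρ n)).1 1 g.1) z = tensorL1 _ z
    congr 1
    refine fourierL1_injective ?_
    have h1 := hm (ρ n)
    have h2 := hm (d ((n : ℝ) + 1)⁻¹ g - d ((n : ℝ) + 1) g)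
    rw [ae_restrict_iff' measurableSet_Ioi] at h1 h2
    filter_upwards [h1, h2] with u h1 h2
    rw [fourierL1_dilConv, one_mul]
    rcases le_or_gt u 0 with hu | hu
    · rw [g.2 u hu, mul_zero, (T _).2 u hu]
    · rw [h1 hu, h2 hu, hρ n u hu]
      change _ = m u * fourierL1 (dilConv k ((n : ℝ) + 1)⁻¹ g.1 - dilConv k ((n : ℝ) + 1) g.1) u
      rw [fourierL1_sub, fourierL1_dilConv, fourierL1_dilConv]
      ring
  choose φ hφ using fun n => exists_integral_functional (V := hardyOneVec Z) hβ (T (ρ n)).1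
  have hφE (n : ℕ) (f : C₀(ℝ, X)) (h : hardyOneVec Z) :
      φ n (A0Space.conv β (hardyOneVec Z) f h) = dualPair β f (E n h).1 := hφ n f h
  have hφn (n : ℕ) : ‖φ n‖ ≤ ‖W‖ * (2 * ‖k‖) := by
    refine A0Space.norm_le_of_conv hβ (mul_nonneg W.opNorm_nonneg (by positivity)) fun f h => ?_
    rw [hφE, hE, ContinuousLinearMap.comp_apply, sub_apply]
    refine (norm_dualPair_le β hβ f _).trans ?_
    have h1 : ‖W (D ((n : ℝ) + 1)⁻¹ h - D ((n : ℝ) + 1) h)‖ ≤ ‖W‖ * (‖k‖ * ‖h‖ + ‖k‖ * ‖h‖) :=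
      (W.le_opNorm _).trans (mul_le_mul_of_nonneg_left
        ((norm_sub_le _ _).trans (add_le_add (hDn _ h) (hDn _ h))) W.opNorm_nonneg)
    calc ‖f‖ * ‖W (D ((n : ℝ) + 1)⁻¹ h - D ((n : ℝ) + 1) h)‖
        ≤ ‖f‖ * (‖W‖ * (‖k‖ * ‖h‖ + ‖k‖ * ‖h‖)) := mul_le_mul_of_nonneg_left h1 (norm_nonneg _)
      _ = ‖W‖ * (2 * ‖k‖) * (‖f‖ * ‖h‖) := by ring
  obtain ⟨ψ, hψ⟩ := exists_weak_cluster_functional hφn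
  refine ⟨ψ, fun f h => ?_⟩
  let P : Submodule ℂ (hardyOneVec Z) := LinearMap.eqLocus
    ((ContinuousLinearMap.apply ℂ ℂ f : StrongDual ℂ C₀(ℝ, X) →ₗ[ℂ] ℂ).comp (convForm ψ))
    ((dualCLM β f : LOne Z →ₗ[ℂ] ℂ).comp
      ((hardyOneVec Z).subtype.comp (W : hardyOneVec Z →ₗ[ℂ] hardyOneVec Z)))
  refine mem_of_hardyTensor_mem (P := P) ?_ (fun g hg z => ?_) h
  · exact isClosed_eq (continuous_apply_of_bound (norm_convForm_le ψ) f)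
      ((dualCLM β f).continuous.comp (continuous_subtype_val.comp W.continuous))
  · refine hψ (A0Space.conv β (hardyOneVec Z) f (hardyTensor g z)) _
      (tendsto_const_nhds.congr' ?_)
    filter_upwards [hk g.1 hg] with n hn
    rw [hφE, hE, ContinuousLinearMap.comp_apply, hQ]
    have h1 : d ((n : ℝ) + 1)⁻¹ g - d ((n : ℝ) + 1) g = g := Subtype.ext hn
    rw [h1]
    rfl

end Converse

/-! ### The dual of the algebra -/

section Dual

variable {X Z : Type*} [NormedAddCommGroup X] [NormedSpace ℂ X]
  [NormedAddCommGroup Z] [NormedSpace ℂ Z] [CompleteSpace Z] {β : X →L[ℂ] Z →L[ℂ] ℂ}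

theorem IsNorming.exists_eq_one [Nontrivial Z] (hn : IsNorming β) : ∃ x z, β x z = 1 := by
  obtain ⟨z, hz⟩ := exists_ne (0 : Z)
  obtain ⟨x, -, hx⟩ := hn z ‖z‖ (norm_pos_iff.2 hz)
  have h : β x z ≠ 0 := fun h => by
    rw [h, Complex.zero_re, sub_self] at hx
    exact lt_irrefl _ hx
  exact ⟨x, (β x z)⁻¹ • z, by rw [map_smul, smul_eq_mul, inv_mul_cancel₀ h]⟩

/-- Functionals on the algebra are represented isometrically by operators; the operators that occur
are the extensions of `T ⊗ I` for multipliers `T`. -/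
theorem exists_dualEmbedding [Nontrivial Z] (hβ : ‖β‖ ≤ 1) (hn : IsNorming β) :
    ∃ R : StrongDual ℂ (A0Space β (hardyOneVec Z)) →ₗᵢ[ℂ] (hardyOneVec Z →L[ℂ] hardyOneVec Z),
      (∀ φ f h, φ (A0Space.conv β (hardyOneVec Z) f h) = dualPair β f (R φ h).1) ∧
      Set.range R = Set.range (MultSpace.tensorExt Z) := by
  obtain ⟨x₀, z₀, h₀⟩ := hn.exists_eq_one
  choose T hT W hW hφ using fun φ => exists_operator_of_functional hβ hn h₀ φ
  have huniq {W₁ W₂ : hardyOneVec Z →L[ℂ] hardyOneVec Z}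
      (h : ∀ f g, dualPair β f (W₁ g).1 = dualPair β f (W₂ g).1) : W₁ = W₂ :=
    ContinuousLinearMap.ext fun g => Subtype.ext (dualPair_injective hβ hn fun f => h f g)
  have hadd (φ ψ : StrongDual ℂ (A0Space β (hardyOneVec Z))) : W (φ + ψ) = W φ + W ψ :=
    huniq fun f g => (hφ (φ + ψ) f g).symm.trans <|
      (congrArg₂ (· + ·) (hφ φ f g) (hφ ψ f g)).trans
        (map_add (dualCLM β f) (W φ g).1 (W ψ g).1).symm
  have hsmul (c : ℂ) (φ : StrongDual ℂ (A0Space β (hardyOneVec Z))) : W (c • φ) = c • W φ :=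
    huniq fun f g => (hφ (c • φ) f g).symm.trans <|
      (congrArg (c • ·) (hφ φ f g)).trans (map_smul (dualCLM β f) c (W φ g).1).symm
  have hnorm (φ : StrongDual ℂ (A0Space β (hardyOneVec Z))) : ‖W φ‖ = ‖φ‖ :=
    norm_eq_of_conv_eq_dualPair hβ hn (hφ φ)
  let R : StrongDual ℂ (A0Space β (hardyOneVec Z)) →ₗᵢ[ℂ] (hardyOneVec Z →L[ℂ] hardyOneVec Z) :=
    ⟨⟨⟨W, hadd⟩, hsmul⟩, hnorm⟩
  refine ⟨R, hφ, Set.Subset.antisymm ?_ ?_⟩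
  · rintro _ ⟨φ, rfl⟩
    let S : MultSpace Z := (⟨T φ, hT φ, W φ, hW φ⟩ : ↥(boundedMultipliers Z))
    refine ⟨S, hardyOneVec_ext fun g z => ?_⟩
    rw [MultSpace.tensorExt_hardyTensor]
    exact (hW φ g z).symm
  · rintro _ ⟨S, rfl⟩
    obtain ⟨φ, h⟩ := exists_functional_of_operator hβ S.2.1 (MultSpace.tensorExt_hardyTensor S)
    exact ⟨φ, huniq fun f g => (hφ φ f g).symm.trans (h f g)⟩

/-- An isometry with the same range as the tensor extension of multipliers factors through it. -/
theorem exists_multSpaceEquiv [Nontrivial Z] {E : Type*} [NormedAddCommGroup E] [NormedSpace ℂ E]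
    (R : E →ₗᵢ[ℂ] (hardyOneVec Z →L[ℂ] hardyOneVec Z))
    (hR : Set.range R = Set.range (MultSpace.tensorExt Z)) :
    ∃ J : E ≃ₗᵢ[ℂ] MultSpace Z, ∀ φ, MultSpace.tensorExt Z (J φ) = R φ := by
  have hex (φ : E) : ∃ S : MultSpace Z, MultSpace.tensorExt Z S = R φ := hR.subset ⟨φ, rfl⟩
  choose J hJ using hex
  have hinj := MultSpace.tensorExt_injective (Z := Z)
  have hadd (φ ψ : E) : J (φ + ψ) = J φ + J ψ := hinj (by rw [hJ, map_add, map_add, hJ, hJ])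
  have hsmul (c : ℂ) (φ : E) : J (c • φ) = c • J φ := hinj (by rw [hJ, map_smul, map_smul, hJ])
  have hnorm (φ : E) : ‖J φ‖ = ‖φ‖ := by rw [MultSpace.norm_def, hJ, R.norm_map]
  let J' : E →ₗᵢ[ℂ] MultSpace Z := ⟨⟨⟨J, hadd⟩, hsmul⟩, hnorm⟩
  refine ⟨LinearIsometryEquiv.ofSurjective J' fun S => ?_, hJ⟩
  obtain ⟨φ, hφ⟩ := hR.superset ⟨S, rfl⟩
  exact ⟨φ, hinj ((hJ φ).trans hφ)⟩

/-- The adjoint of the quotient map `f ⊗ h ↦ f ∗ h` is an isometry onto the bounded multipliers. -/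
theorem exists_adjoint_isometry [Nontrivial Z] (hβ : ‖β‖ ≤ 1) (hn : IsNorming β) :
    ∃ (Θ : (hardyOneVec Z →L[ℂ] hardyOneVec Z) →ₗᵢ[ℂ]
        StrongDual ℂ (ProjTensor (C0Quot X) (hardyOneVec Z)))
      (Λ : ProjTensor (C0Quot X) (hardyOneVec Z) →L[ℂ] A0Space β (hardyOneVec Z))
      (R : StrongDual ℂ (A0Space β (hardyOneVec Z)) →ₗᵢ[ℂ] (hardyOneVec Z →L[ℂ] hardyOneVec Z)),
      (∀ W f h, Θ W (quotTmul f h) = dualPair β f (W h).1) ∧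
      (∀ f h, Λ (quotTmul f h) = A0Space.conv β (hardyOneVec Z) f h) ∧
      IsBanachQuotientMap Λ ∧ (∀ φ, Θ (R φ) = φ ∘L Λ) ∧
      Set.range R = Set.range (MultSpace.tensorExt Z) ∧
      ∃ J : StrongDual ℂ (A0Space β (hardyOneVec Z)) ≃ₗᵢ[ℂ] MultSpace Z,
        ∀ φ, MultSpace.tensorExt Z (J φ) = R φ := by
  obtain ⟨Θ, hΘ⟩ := exists_operatorEmbedding hβ hn
  obtain ⟨Λ, hΛ, hΛq⟩ := exists_convQuotientMap hβ
  obtain ⟨R, hR, hRr⟩ := exists_dualEmbedding hβ hn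
  refine ⟨Θ, Λ, R, hΘ, hΛ, hΛq, fun φ => quotTmul_ext fun f h => ?_, hRr,
    exists_multSpaceEquiv R hRr⟩
  refine (hΘ (R φ) f h).trans ((hR φ f h).symm.trans ?_)
  exact (congrArg φ (hΛ f h)).symm

/-- The case `Z = ℂ` of `exists_functional_of_operator`, for any `U` equal to `hardyOneVec ℂ`, so
that it applies to `hardyOne` although the two submodules are not definitionally equal. -/
theorem exists_functional_of_multiplier {U : Submodule ℂ (LOne ℂ)} (hU : U = hardyOneVec ℂ)
    {T : hardyOne →L[ℂ] hardyOne} (hT : T ∈ fourierMultipliers) {S : U →L[ℂ] U}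
    (hS : ∀ (g : hardyOne) (hg : g.1 ∈ U), (S ⟨g.1, hg⟩).1 = (T g).1) :
    ∃ φ : StrongDual ℂ (A0Space mulPairing U),
      ∀ f h, φ (A0Space.conv mulPairing U f h) = dualPair mulPairing f (S h).1 := by
  subst hU
  refine exists_functional_of_operator norm_mulPairing_le hT fun g z => Subtype.ext ?_
  have hg : g.1 ∈ hardyOneVec ℂ := by
    rw [hardyOneVec_scalar]
    exact g.2
  have h1 : hardyTensor g z = z • (⟨g.1, hg⟩ : hardyOneVec ℂ) := Subtype.ext (tensorL1_scalar g.1 z)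
  rw [h1, map_smul, Submodule.coe_smul, hS]
  exact (tensorL1_scalar (T g).1 z).symm

theorem exists_scalarDualEquiv :
    ∃ J : StrongDual ℂ A0 ≃ₗᵢ[ℂ] fourierMultipliers, ∀ φ f h,
      φ (A0Space.conv mulPairing hardyOne f h) = dualPair mulPairing f ((J φ).1 h).1 := by
  have key (φ : StrongDual ℂ A0) : ∃ T ∈ fourierMultipliers, ∀ f g,
      φ (A0Space.conv mulPairing hardyOne f g) = dualPair mulPairing f (T g).1 :=
    exists_multiplier (Φ := convForm φ) (fun f f' g g' h => by
      rw [convForm_apply, convForm_apply]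
      congr 1
      exact A0Space.ext fun s => by rw [A0Space.toFun_conv, A0Space.toFun_conv, h])
      (norm_convForm_le φ)
  choose T hT hφ using key
  have huniq {W₁ W₂ : fourierMultipliers}
      (h : ∀ f g, dualPair mulPairing f (W₁.1 g).1 = dualPair mulPairing f (W₂.1 g).1) : W₁ = W₂ :=
    Subtype.ext <| ContinuousLinearMap.ext fun g => Subtype.ext <|
      dualPair_injective norm_mulPairing_le isNorming_mulPairing fun f => h f g
  let S (φ : StrongDual ℂ A0) : fourierMultipliers := ⟨T φ, hT φ⟩
  have hadd (φ ψ : StrongDual ℂ A0) : S (φ + ψ) = S φ + S ψ :=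
    huniq fun f g => (hφ (φ + ψ) f g).symm.trans <|
      (congrArg₂ (· + ·) (hφ φ f g) (hφ ψ f g)).trans
        (map_add (dualCLM mulPairing f) (T φ g).1 (T ψ g).1).symm
  have hsmul (c : ℂ) (φ : StrongDual ℂ A0) : S (c • φ) = c • S φ :=
    huniq fun f g => (hφ (c • φ) f g).symm.trans <|
      (congrArg (c • ·) (hφ φ f g)).trans (map_smul (dualCLM mulPairing f) c (T φ g).1).symm
  have hnorm (φ : StrongDual ℂ A0) : ‖S φ‖ = ‖φ‖ :=
    norm_eq_of_conv_eq_dualPair norm_mulPairing_le isNorming_mulPairing (hφ φ)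
  let J : StrongDual ℂ A0 →ₗᵢ[ℂ] fourierMultipliers := ⟨⟨⟨S, hadd⟩, hsmul⟩, hnorm⟩
  refine ⟨LinearIsometryEquiv.ofSurjective J fun S => ?_, hφ⟩
  obtain ⟨φ, h⟩ := exists_functional_of_multiplier hardyOneVec_scalar.symm S.2 (S := S.1)
    fun g hg => rfl
  exact ⟨φ, huniq fun f g => (hφ φ f g).symm.trans (h f g)⟩

end Dual

end

end HardyMultipliers

theorem proposition4p2 :
    (∃ (Θ : (HardySOne →L[ℂ] HardySOne) →ₗᵢ[ℂ] StrongDual ℂ PreSpace)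
      (Λ : PreSpace →L[ℂ] A0SOne)
      (Λstar : StrongDual ℂ A0SOne →ₗᵢ[ℂ] (HardySOne →L[ℂ] HardySOne)),
      -- `Θ` is the isometric embedding of `B(H^1(ℝ; S^1))` by the pairing of `S^∞` and `S^1`
      (∀ (W : HardySOne →L[ℂ] HardySOne) (f : C₀(ℝ, SInf)) (h : HardySOne),
        Θ W (classTmul f h) = dualPair trDual f (W h).1) ∧
      -- `Λ` is the canonical quotient map
      (∀ (f : C₀(ℝ, SInf)) (h : HardySOne),
        Λ (classTmul f h) = A0Space.conv trDual (hardyOneVec SOne) f h) ∧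
      IsBanachQuotientMap Λ ∧
      -- `Λstar` is the adjoint of `Λ`, regarded as valued in `B(H^1(ℝ; S^1))`
      (∀ φ : StrongDual ℂ A0SOne, Θ (Λstar φ) = φ ∘L Λ) ∧
      -- its range is the space of `S^1`-bounded Fourier multipliers
      Set.range Λstar = Set.range (MultSpace.tensorExt SOne) ∧
      -- so it is an isometric isomorphism onto that space
      ∃ J : StrongDual ℂ A0SOne ≃ₗᵢ[ℂ] MultSpace SOne,
        ∀ φ : StrongDual ℂ A0SOne, MultSpace.tensorExt SOne (J φ) = Λstar φ) ∧
    -- the scalar case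
    ∃ J₀ : StrongDual ℂ A0 ≃ₗᵢ[ℂ] fourierMultipliers,
      ∀ (φ : StrongDual ℂ A0) (f : C₀(ℝ, ℂ)) (h : hardyOne),
        φ (A0Space.conv (ContinuousLinearMap.mul ℂ ℂ) hardyOne f h) =
          dualPair (ContinuousLinearMap.mul ℂ ℂ) f ((J₀ φ).1 h).1 := by
  exact ⟨exists_adjoint_isometry (norm_trPairing_le stdBasis) (isNorming_trPairing stdBasis),
    exists_scalarDualEquiv⟩
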